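/- **Setting.** Let $\gamma=\frac{\sqrt5+1}{2}$ and let $F:\mathbb T^2=(\mathbb R/2\pi\mathbb Z)^2\to\mathbb R$ have the Fourier expansion $F(\theta)=\sum_{k\in\mathbb Z^2}F^{[k]}e^{ik\cdot\theta}$ (convergent at every point), with zero mean, $F^{[0]}=0$. Assume that for some $r_1,r_2>0$ $$\sup_{k\in\mathbb Z^2}\left|F^{[k]}e^{r_1|k_1|+r_2|k_2|}\right|<\infty,$$ and that there are $a>0$ and $k_0\in\mathbb N$ such that $F^{[k]}$ is real and $F^{[k]}>a\,e^{-r_1|k_1|-r_2|k_2|}$ whenever $|k_1|/|k_2|$ is (in lowest terms) a continued fraction convergent of $\gamma$ and $|k_2|>k_0$. For $\varepsilon>0$ and $\alpha\in[0,1)$ define $$\mathcal M(u,\theta_1,\theta_2;\varepsilon,\alpha)=4\int_{-\infty}^{+\infty}\beta(u+s)\,F\!\left(\theta_1+\frac s\varepsilon,\theta_2+\frac{\gamma s}\varepsilon\right)ds,\qquad \beta(u)=\frac{\sinh u\cosh u}{(\cosh^2u-2\alpha\sinh u)^2}.$$ Let $c$ be the $2\ln\gamma$-periodic function with $$c(\delta)=C_0\cosh\frac{\delta-\delta_0}2\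 \text{ for }\ \delta\in[\delta_0-\ln\gamma,\delta_0+\ln\gamma],\quad C_0=2\sqrt{\frac{\gamma r_1+r_2}{\gamma+\gamma^{-1}}},\quad \delta_0=\ln\frac{\gamma+\gamma^{-1}}{\gamma^2(r_1\gamma+r_2)}.$$ For $\alpha\in(0,1)$ let $\rho_-=\rho_-(\alpha)$ be the unique complex number with $\sinh\rho_-=\alpha+i\sqrt{1-\alpha^2}$ and $0<\Im\rho_-<\pi/2$. Fix $u_0>0$ and write $$S(\varepsilon,\alpha)=\sup_{(u,\theta_1,\theta_2)\in(-u_0,u_0)\times\mathbb T^2}|\mathcal M(u,\theta_1,\theta_2;\varepsilon,\alpha)| .$$ **Proposition.** The integral defining $\mathcal M$ converges absolutely for all $\varepsilon>0$, $\alpha\in[0,1)$ and real $u,\theta_1,\theta_2$, and the following hold; in each case the assertion includes that the supremum $S(\varepsilon,\alpha)$ is finite. 1. For all $\nu>1$ and $C>0$ there are $\varepsilon_0,C_1,C_2>0$ such that for all $\varepsilon\in(0,\varepsilon_0)$ and $\alpha\in[0,1)$ with $0\le\alpha\le C\varepsilon^\nu$, $$\frac{C_1}{\varepsilon}e^{-c(\ln(2\varepsilon/\pi))\sqrt{\frac{\pi}{2\varepsilon}}}\le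 S(\varepsilon,\alpha)\le\frac{C_2}{\varepsilon}e^{-c(\ln(2\varepsilon/\pi))\sqrt{\frac{\pi}{2\varepsilon}}}.$$ 2. (Case $\alpha=\alpha_*\varepsilon+\mathcal O(\varepsilon^2)$.) For all $\alpha_*\ge0$ and $K\ge0$ there are $\varepsilon_0,C_2>0$ such that for all $\varepsilon\in(0,\varepsilon_0)$ and $\alpha\in[0,1)$ with $|\alpha-\alpha_*\varepsilon|\le K\varepsilon^2$, $$S(\varepsilon,\alpha)\le\frac{C_2}{\varepsilon}e^{-c(\ln(2\varepsilon/\pi))\sqrt{\frac{\pi}{2\varepsilon}}}.$$ 3. For all $\nu\in(0,1]$, $r\in[0,2)$ and $C>0$ there are $\varepsilon_0,C_1,C_2>0$ such that for all $\varepsilon\in(0,\varepsilon_0)$ and $\alpha\in[0,1)$ with $C\varepsilon^\nu<\alpha<1-C\varepsilon^r$, $$\frac{C_1}{\sqrt{\varepsilon\alpha}\,(1-\alpha)^{5/4}}e^{-c(\ln(\varepsilon/\Im\rho_-))\sqrt{\frac{\Im\rho_-}{\varepsilon}}}\le S(\varepsilon,\alpha)\le\frac{C_2}{\sqrt{\varepsilon\alpha}\,(1-\alpha)^{5/4}}e^{-c(\ln(\varepsilon/\Im\rho_-))\sqrt{\frac{\Im\rho_-}{\varepsilon}}}.$$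 The constants $\varepsilon_0,C_1,C_2$ may depend on $F,r_1,r_2,u_0$ and on the constants $\nu,C,r,\alpha_*,K$ of the case, but not on $\varepsilon$ and $\alpha$. -/

import Mathlib

namespace MelnikovQP

noncomputable section

/-- The golden mean `γ = (√5 + 1) / 2`. -/
abbrev γ : ℝ := Real.goldenRatio

/-- The Fourier expansion `F(θ₁, θ₂) = ∑ F^[k] e^{i k·θ}` over `k ∈ ℤ²`; in particular `F` is
`2π`-periodic in both variables, that is, a real function on `𝕋²`. -/
def HasFourierExpansion (F : ℝ → ℝ → ℝ) (Fhat : ℤ × ℤ → ℂ) : Prop :=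
  ∀ θ₁ θ₂ : ℝ, HasSum
    (fun k : ℤ × ℤ =>
      Fhat k * Complex.exp (Complex.I * ((k.1 : ℂ) * (θ₁ : ℂ) + (k.2 : ℂ) * (θ₂ : ℂ))))
    ((F θ₁ θ₂ : ℝ) : ℂ)

/-- `sup_k |F^[k] e^{r₁|k₁| + r₂|k₂|}| < ∞`. -/
def FourierUpper (r₁ r₂ : ℝ) (Fhat : ℤ × ℤ → ℂ) : Prop :=
  BddAbove (Set.range fun k : ℤ × ℤ =>
    ‖Fhat k * ((Real.exp (r₁ * |(k.1 : ℝ)| + r₂ * |(k.2 : ℝ)|) : ℝ) : ℂ)‖)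

/-- `|k₁| / |k₂|` is, in lowest terms, a continued fraction convergent of `γ`. -/
def IsConvergentIndex (k : ℤ × ℤ) : Prop :=
  IsCoprime k.1 k.2 ∧
    ∃ n : ℕ, (GenContFract.of γ).convs n = |(k.1 : ℝ)| / |(k.2 : ℝ)|

/-- There are `a > 0` and `k₀` such that `F^[k]` is real and `F^[k] > a e^{-r₁|k₁| - r₂|k₂|}`
for all `k` with `|k₂| > k₀` for which `|k₁| / |k₂|` is a convergent of `γ`. -/
def FourierLower (r₁ r₂ : ℝ) (Fhat : ℤ × ℤ → ℂ) : Prop :=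
  ∃ a : ℝ, 0 < a ∧ ∃ k₀ : ℕ, ∀ k : ℤ × ℤ, IsConvergentIndex k → (k₀ : ℤ) < |k.2| →
    (Fhat k).im = 0 ∧ a * Real.exp (-r₁ * |(k.1 : ℝ)| - r₂ * |(k.2 : ℝ)|) < (Fhat k).re

/-- `β(u) = sinh u cosh u / (cosh² u - 2 α sinh u)²`. -/
def β (α u : ℝ) : ℝ :=
  Real.sinh u * Real.cosh u / (Real.cosh u ^ 2 - 2 * α * Real.sinh u) ^ 2

/-- The integrand `β(u + s) F(θ₁ + s/ε, θ₂ + γ s/ε)`. -/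
def melnikovIntegrand (F : ℝ → ℝ → ℝ) (ε α u θ₁ θ₂ s : ℝ) : ℝ :=
  β α (u + s) * F (θ₁ + s / ε) (θ₂ + γ * s / ε)

/-- The quasiperiodic Melnikov function. -/
def melnikov (F : ℝ → ℝ → ℝ) (ε α u θ₁ θ₂ : ℝ) : ℝ :=
  4 * ∫ s : ℝ, melnikovIntegrand F ε α u θ₁ θ₂ s

/-- The values of `|ℳ|` on `(-u₀, u₀) × 𝕋²` (the angles run over `ℝ²`, by periodicity). -/
def melnikovValues (F : ℝ → ℝ → ℝ) (ε α u₀ : ℝ) : Set ℝ :=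
  {m | ∃ u θ₁ θ₂ : ℝ, u ∈ Set.Ioo (-u₀) u₀ ∧ m = |melnikov F ε α u θ₁ θ₂|}

/-- The supremum of `|ℳ|` on `(-u₀, u₀) × 𝕋²`. -/
def melnikovSup (F : ℝ → ℝ → ℝ) (ε α u₀ : ℝ) : ℝ := sSup (melnikovValues F ε α u₀)

theorem two_log_gamma_pos : 0 < 2 * Real.log γ :=
  mul_pos two_pos (Real.log_pos Real.one_lt_goldenRatio)

/-- `C₀ = 2 √((γ r₁ + r₂) / (γ + γ⁻¹))`. -/
def C₀ (r₁ r₂ : ℝ) : ℝ := 2 * Real.sqrt ((γ * r₁ + r₂) / (γ + γ⁻¹))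

/-- `ε* = (γ + γ⁻¹) / (γ² (r₁ γ + r₂))`. -/
def εstar (r₁ r₂ : ℝ) : ℝ := (γ + γ⁻¹) / (γ ^ 2 * (r₁ * γ + r₂))

/-- `δ₀ = ln ε*`. -/
def δ₀ (r₁ r₂ : ℝ) : ℝ := Real.log (εstar r₁ r₂)

/-- The `2 ln γ`-periodic function equal to `C₀ cosh ((δ - δ₀) / 2)` on
`[δ₀ - ln γ, δ₀ + ln γ]`. -/
def c (r₁ r₂ δ : ℝ) : ℝ :=
  C₀ r₁ r₂ * Real.cosh
    ((toIcoMod two_log_gamma_pos (δ₀ r₁ r₂ - Real.log γ) δ - δ₀ r₁ r₂) / 2)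

theorem c_periodic (r₁ r₂ : ℝ) : Function.Periodic (c r₁ r₂) (2 * Real.log γ) := by
  intro δ
  simp only [c, toIcoMod_add_right]

theorem c_eq (r₁ r₂ δ : ℝ)
    (hδ : δ ∈ Set.Icc (δ₀ r₁ r₂ - Real.log γ) (δ₀ r₁ r₂ + Real.log γ)) :
    c r₁ r₂ δ = C₀ r₁ r₂ * Real.cosh ((δ - δ₀ r₁ r₂) / 2) := by
  rcases hδ.2.lt_or_eq with h | h
  · have : toIcoMod two_log_gamma_pos (δ₀ r₁ r₂ - Real.log γ) δ = δ :=
      (toIcoMod_eq_self two_log_gamma_pos).2 ⟨hδ.1, by linarith⟩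
    rw [c, this]
  · have e : δ = (δ₀ r₁ r₂ - Real.log γ) + 2 * Real.log γ := by rw [h]; ring
    have : toIcoMod two_log_gamma_pos (δ₀ r₁ r₂ - Real.log γ) δ
        = δ₀ r₁ r₂ - Real.log γ := by
      rw [e, toIcoMod_add_right, toIcoMod_apply_left]
    rw [c, this, ← Real.cosh_neg, h]
    congr 2
    ring

/-- `ρ` is the singularity `ρ₋` of `β`: the solution of `sinh ρ = α + i √(1 - α²)` with
`0 < Im ρ < π / 2`. -/
def IsRhoMinus (α : ℝ) (ρ : ℂ) : Prop :=
  Complex.sinh ρ = (α : ℂ) + Complex.I * ((Real.sqrt (1 - α ^ 2) : ℝ) : ℂ) ∧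
    0 < ρ.im ∧ ρ.im < Real.pi / 2

theorem sinh_parts (z : ℂ) :
    Complex.sinh z = ((Real.sinh z.re * Real.cos z.im : ℝ) : ℂ)
      + Complex.I * ((Real.cosh z.re * Real.sin z.im : ℝ) : ℂ) := by
  conv_lhs => rw [← Complex.re_add_im z, Complex.sinh_add, Complex.sinh_mul_I,
    Complex.cosh_mul_I]
  push_cast
  ring

/-- For every `α ∈ (0, 1)` there is exactly one such `ρ₋`. -/
theorem existsUnique_rhoMinus {α : ℝ} (h0 : 0 < α) (h1 : α < 1) : ∃! ρ, IsRhoMinus α ρ := by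
  have key : ∀ ρ : ℂ, Complex.sinh ρ = (α : ℂ) + Complex.I * ((Real.sqrt (1 - α ^ 2) : ℝ) : ℂ) ↔
      Real.sinh ρ.re * Real.cos ρ.im = α ∧
      Real.cosh ρ.re * Real.sin ρ.im = Real.sqrt (1 - α ^ 2) := by
    intro ρ
    rw [sinh_parts, Complex.ext_iff]
    simp only [Complex.add_re, Complex.add_im, Complex.ofReal_re, Complex.ofReal_im,
      Complex.I_mul_re, Complex.I_mul_im, neg_zero, add_zero, zero_add]
  have hpos : 0 < 1 - α := by linarith
  refine ⟨⟨Real.arsinh (Real.sqrt α), Real.arcsin (Real.sqrt (1 - α))⟩, ⟨?_, ?_, ?_⟩, ?_⟩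
  · rw [key]
    have hle : Real.sqrt (1 - α) ≤ 1 := Real.sqrt_le_one.2 (by linarith)
    simp only [Real.sinh_arsinh, Real.cosh_arsinh, Real.cos_arcsin,
      Real.sin_arcsin (by linarith [Real.sqrt_nonneg (1 - α)]) hle, Real.sq_sqrt h0.le,
      Real.sq_sqrt hpos.le]
    constructor
    · rw [show 1 - (1 - α) = α by ring, Real.mul_self_sqrt h0.le]
    · rw [← Real.sqrt_mul (by linarith)]
      congr 1
      ring
  · exact Real.arcsin_pos.2 (Real.sqrt_pos.2 hpos)
  · refine Real.arcsin_lt_pi_div_two.2 ?_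
    rw [Real.sqrt_lt' one_pos]
    linarith
  · rintro ρ ⟨hs, hi0, hi1⟩
    rw [key] at hs
    obtain ⟨e1, e2⟩ := hs
    have hcos : 0 < Real.cos ρ.im := Real.cos_pos_of_mem_Ioo ⟨by linarith, hi1⟩
    have hsin : 0 < Real.sin ρ.im := Real.sin_pos_of_pos_of_lt_pi hi0 (by linarith)
    have hsh : 0 < Real.sinh ρ.re := by
      by_contra hneg
      nlinarith [not_lt.1 hneg]
    have q2 : (Real.cosh ρ.re * Real.sin ρ.im) ^ 2 = 1 - α ^ 2 := by
      rw [e2, Real.sq_sqrt (by nlinarith)]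
    have q1 : (Real.sinh ρ.re * Real.cos ρ.im) ^ 2 = α ^ 2 := by rw [e1]
    rw [mul_pow, Real.cosh_sq] at q2
    rw [mul_pow] at q1
    have p := Real.sin_sq_add_cos_sq ρ.im
    set S := Real.sinh ρ.re
    set C := Real.cos ρ.im
    set s := Real.sin ρ.im
    have hS : S ^ 2 = α := by
      have hs2 : s ^ 2 = 1 - C ^ 2 := by linarith
      rw [hs2] at q2
      have hC : C ^ 2 = S ^ 2 := by nlinarith
      rw [hC] at q1
      have : (S ^ 2 - α) * (S ^ 2 + α) = 0 := by nlinarith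
      rcases mul_eq_zero.1 this with h | h
      · linarith
      · nlinarith [sq_nonneg S]
    have hC : s ^ 2 = 1 - α := by
      rw [hS] at q1
      have : α * (C ^ 2 - α) = 0 := by nlinarith
      rcases mul_eq_zero.1 this with h | h
      · linarith
      · linarith
    refine Complex.ext ?_ ?_
    · change ρ.re = Real.arsinh (Real.sqrt α)
      rw [← hS, Real.sqrt_sq hsh.le, Real.arsinh_sinh]
    · change ρ.im = Real.arcsin (Real.sqrt (1 - α))
      rw [← hC, Real.sqrt_sq hsin.le, Real.arcsin_sin (by linarith) hi1.le]

end

end MelnikovQP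

/-! ### Arithmetic of `ℤ[γ]`: frequencies, norm form, Fibonacci indices. -/

namespace MelnikovQP

noncomputable section

/-! Write ω = k₁ + γ k₂ (`freq`), ω' for its conjugate, and `bhat` for the Fourier transform of `β`.
Integrating the expansion of `F` term by term turns ℳ into an absolutely convergent trigonometric
series whose coefficients have modulus 4 |F^[k]| |bhat(ω/ε)| (`hasSum_melnikov`). Hence the supremum
is at most the sum of these moduli and at least each one of them.

The transform. Integration by parts replaces the double poles of `β` by simple ones. For 0 < α < 1
the strip 0 ≤ Im z ≤ π contains exactly the poles ρ₋ and πi - ρ₋, and on its upper side the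
integrand is a reflected conjugate of its values on the real line, so the residue theorem gives
bhat(w) + e^{-πw} conj(bhat(w)) in closed form (`bhat_add_conj`). The main part of the residues has
size w e^{-w Im ρ₋} / (√α (1 - α)). It becomes w² e^{-w Im ρ₋} when w√α is small, because the two
poles merge at πi/2 and their contributions nearly cancel. The bounds at α = 0 are limits.

The sum. Put X = √(y/ε), with y = Im ρ₋, or y = π/2 in the limit. The k-th term decays with exponent
r₁|k₁| + r₂|k₂| + X²|ω|, the weight is at least L|ω'| - D|ω| (`wnorm_ge`), and ωω' is a nonzero
integer. If ωω' = ±1 and |ω| ≤ 1, then ±k is a Fibonacci index and the exponent is, up to a bounded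
error, Lγⁿ + X²γ⁻ⁿ. The minimum of this over integers n is exactly c(ln(ε/y)) X (`c_attained`,
`c_mul_le_energy`), which is the origin of the periodic function `c`. All other indices have an
exponent larger by a fixed factor (`exponent_sq_ge`), so the whole sum is comparable to its largest
term (`exists_expTerm_sum_le`).

The prefactors. At the minimising index w = |ω|/ε is of order 1/√(yε). For small α this makes w² of
order 1/ε. Otherwise y is of order √(1 - α), and w/(√α (1 - α)) is of order 1/(√(εα)(1 - α)^{5/4}).
When α = O(ε), replacing y by π/2 changes the exponent by a bounded amount (`c_mul_sqrt_le`). -/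

theorem γ_sq : γ ^ 2 = γ + 1 := Real.goldenRatio_sq

theorem one_lt_γ : 1 < γ := Real.one_lt_goldenRatio

theorem γ_lt_two : γ < 2 := Real.goldenRatio_lt_two

theorem γ_pos : 0 < γ := Real.goldenRatio_pos

theorem inv_γ : γ⁻¹ = γ - 1 := by
  have h := γ_sq
  have hp := γ_pos
  generalize γ = g at *
  field_simp
  linarith

theorem γ_add_inv_pos : 0 < γ + γ⁻¹ := add_pos γ_pos (inv_pos.2 γ_pos)

/-- The frequency `k · (1, γ)`. -/
def freq (k : ℤ × ℤ) : ℝ := k.1 + γ * k.2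

/-- The Galois conjugate of the frequency. -/
def conjFreq (k : ℤ × ℤ) : ℝ := k.1 + (1 - γ) * k.2

/-- The weighted size of an index. -/
def wnorm (r₁ r₂ : ℝ) (k : ℤ × ℤ) : ℝ := r₁ * |(k.1 : ℝ)| + r₂ * |(k.2 : ℝ)|

/-- The norm form of `ℤ[γ]`. -/
def nform (k : ℤ × ℤ) : ℤ := k.1 ^ 2 + k.1 * k.2 - k.2 ^ 2

theorem freq_mul_conjFreq (k : ℤ × ℤ) : freq k * conjFreq k = nform k := by
  have h := γ_sq
  simp only [freq, conjFreq, nform]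
  push_cast
  generalize γ = g at *
  linear_combination (-(k.2 : ℝ) ^ 2) * h

theorem freq_ne_zero {k : ℤ × ℤ} (hk : k ≠ 0) : freq k ≠ 0 := by
  intro h
  have h' : γ * (k.2 : ℝ) = ((-k.1 : ℤ) : ℝ) := by
    simp only [freq] at h
    push_cast
    linarith
  by_cases h2 : k.2 = 0
  · rw [h2] at h'
    have : k.1 = 0 := by
      have h3 : ((-k.1 : ℤ) : ℝ) = 0 := by rw [← h']; simp
      have := Int.cast_eq_zero.1 h3
      omega
    exact hk (Prod.ext this h2)
  · exact (Real.goldenRatio_irrational.mul_intCast h2).ne_int _ h'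

theorem conjFreq_ne_zero {k : ℤ × ℤ} (hk : k ≠ 0) : conjFreq k ≠ 0 := by
  have : conjFreq k = freq (k.1 + k.2, -k.2) := by
    simp only [conjFreq, freq]; push_cast; ring
  rw [this]
  refine freq_ne_zero fun h => hk ?_
  have h1 := congrArg Prod.fst h
  have h2 := congrArg Prod.snd h
  simp only [Prod.fst_zero, Prod.snd_zero] at h1 h2
  exact Prod.ext (by simp; omega) (by simp; omega)

theorem nform_ne_zero {k : ℤ × ℤ} (hk : k ≠ 0) : nform k ≠ 0 := by
  have := mul_ne_zero (freq_ne_zero hk) (conjFreq_ne_zero hk)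
  rw [freq_mul_conjFreq] at this
  exact_mod_cast this

theorem abs_freq_mul_abs_conjFreq (k : ℤ × ℤ) : |freq k| * |conjFreq k| = |nform k| := by
  rw [← abs_mul, freq_mul_conjFreq, Int.cast_abs]

theorem one_le_abs_nform {k : ℤ × ℤ} (hk : k ≠ 0) : (1 : ℝ) ≤ |nform k| := by
  exact_mod_cast Int.one_le_abs (nform_ne_zero hk)

/-- The rate of exponential decay along the convergents. -/
def decayRate (r₁ r₂ : ℝ) : ℝ := (γ * r₁ + r₂) / (γ + γ⁻¹)

/-- The correction to the decay rate. -/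
def decayDefect (r₁ r₂ : ℝ) : ℝ := (γ⁻¹ * r₁ + r₂) / (γ + γ⁻¹)

theorem decayRate_pos {r₁ r₂ : ℝ} (h₁ : 0 < r₁) (h₂ : 0 < r₂) : 0 < decayRate r₁ r₂ :=
  div_pos (add_pos (mul_pos γ_pos h₁) h₂) γ_add_inv_pos

theorem decayDefect_pos {r₁ r₂ : ℝ} (h₁ : 0 < r₁) (h₂ : 0 < r₂) : 0 < decayDefect r₁ r₂ :=
  div_pos (add_pos (mul_pos (inv_pos.2 γ_pos) h₁) h₂) γ_add_inv_pos

/-- Solve for k₁ and k₂ in terms of the frequency and its conjugate, then apply the reverse triangle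
inequality to each. -/
theorem wnorm_ge {r₁ r₂ : ℝ} (h₁ : 0 < r₁) (h₂ : 0 < r₂) (k : ℤ × ℤ) :
    decayRate r₁ r₂ * |conjFreq k| - decayDefect r₁ r₂ * |freq k| ≤ wnorm r₁ r₂ k := by
  have e1 : (γ + γ⁻¹) * (k.1 : ℝ) = γ * conjFreq k + γ⁻¹ * freq k := by
    have h := γ_sq
    simp only [conjFreq, freq, inv_γ]
    generalize γ = g at *
    linear_combination 0 * h
  have e2 : (γ + γ⁻¹) * (k.2 : ℝ) = freq k - conjFreq k := by
    simp only [conjFreq, freq, inv_γ]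
    ring
  have hs := γ_add_inv_pos
  have hi : 0 < γ⁻¹ := inv_pos.2 γ_pos
  have hg := γ_pos
  have a1 : γ * |conjFreq k| - γ⁻¹ * |freq k| ≤ (γ + γ⁻¹) * |(k.1 : ℝ)| := by
    have := abs_sub_abs_le_abs_sub (γ * conjFreq k) (-(γ⁻¹ * freq k))
    rwa [abs_neg, sub_neg_eq_add, ← e1, abs_mul, abs_mul, abs_mul, abs_of_pos hs, abs_of_pos hg,
      abs_of_pos hi] at this
  have a2 : |conjFreq k| - |freq k| ≤ (γ + γ⁻¹) * |(k.2 : ℝ)| := by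
    rw [← abs_of_pos hs, ← abs_mul, e2, abs_sub_comm]
    exact abs_sub_abs_le_abs_sub _ _
  have : decayRate r₁ r₂ * |conjFreq k| - decayDefect r₁ r₂ * |freq k|
      = (r₁ * (γ * |conjFreq k| - γ⁻¹ * |freq k|) + r₂ * (|conjFreq k| - |freq k|))
        / (γ + γ⁻¹) := by
    simp only [decayRate, decayDefect]
    ring
  rw [this, div_le_iff₀ hs, wnorm]
  nlinarith [mul_le_mul_of_nonneg_left a1 h₁.le, mul_le_mul_of_nonneg_left a2 h₂.le]

/-- The indices of the convergents. -/
def fibIndex (n : ℕ) : ℤ × ℤ := ((Nat.fib (n + 1) : ℤ), -(Nat.fib n : ℤ))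

theorem abs_freq_fibIndex (n : ℕ) : |freq (fibIndex n)| = (γ ^ n)⁻¹ := by
  have h := Real.fib_succ_sub_goldenRatio_mul_fib n
  have : freq (fibIndex n) = Real.goldenConj ^ n := by
    rw [← h]; simp only [freq, fibIndex]; push_cast; ring
  rw [this, abs_pow, ← inv_pow, Real.inv_goldenRatio, abs_of_neg Real.goldenConj_neg]

theorem conjFreq_fibIndex (n : ℕ) : conjFreq (fibIndex n) = γ ^ n := by
  have h := Real.fib_succ_sub_goldenConj_mul_fib n
  rw [← h]
  simp only [conjFreq, fibIndex, Real.one_sub_goldenConj]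
  push_cast; ring

/-- The bound of `wnorm_ge` is sharp up to a constant here: the conjugate frequency is γⁿ, and the
frequency, at most 1 in modulus, only enters the error. -/
theorem wnorm_fibIndex_le {r₁ r₂ : ℝ} (h₁ : 0 < r₁) (h₂ : 0 < r₂) (n : ℕ) :
    wnorm r₁ r₂ (fibIndex n) ≤ decayRate r₁ r₂ * γ ^ n + decayDefect r₁ r₂ := by
  have hs := γ_add_inv_pos
  have hc := conjFreq_fibIndex n
  have hf := abs_freq_fibIndex n
  have hp : (1 : ℝ) ≤ γ ^ n := one_le_pow₀ one_lt_γ.le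
  have hf1 : |freq (fibIndex n)| ≤ 1 := by rw [hf]; exact inv_le_one_of_one_le₀ hp
  have hi : 0 < γ⁻¹ := inv_pos.2 γ_pos
  obtain ⟨hl, hu⟩ := abs_le.1 hf1
  have e1 : (γ + γ⁻¹) * |((fibIndex n).1 : ℝ)| = γ * γ ^ n + γ⁻¹ * freq (fibIndex n) := by
    rw [← hc]
    have h := γ_sq
    have : |((fibIndex n).1 : ℝ)| = (fibIndex n).1 := by simp [fibIndex]
    rw [this]
    simp only [conjFreq, freq, inv_γ]
    generalize γ = g at *
    linear_combination 0 * h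
  have e2 : (γ + γ⁻¹) * |((fibIndex n).2 : ℝ)| = γ ^ n - freq (fibIndex n) := by
    rw [← hc]
    have : |((fibIndex n).2 : ℝ)| = -(fibIndex n).2 := by simp [fibIndex]
    rw [this]
    simp only [conjFreq, freq, inv_γ]
    ring
  have : decayRate r₁ r₂ * γ ^ n + decayDefect r₁ r₂
      = (r₁ * (γ * γ ^ n + γ⁻¹) + r₂ * (γ ^ n + 1)) / (γ + γ⁻¹) := by
    simp only [decayRate, decayDefect]
    ring
  rw [this, le_div_iff₀ hs, wnorm]
  have a1 : (γ + γ⁻¹) * |((fibIndex n).1 : ℝ)| ≤ γ * γ ^ n + γ⁻¹ := by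
    rw [e1]; nlinarith
  have a2 : (γ + γ⁻¹) * |((fibIndex n).2 : ℝ)| ≤ γ ^ n + 1 := by
    rw [e2]; linarith
  nlinarith [mul_le_mul_of_nonneg_left a1 h₁.le, mul_le_mul_of_nonneg_left a2 h₂.le]

/-- Descent by the Euclidean step (p, q) ↦ (q, p - q), which preserves |p² - pq - q²| and undoes one
step of the Fibonacci recursion. -/
theorem fib_of_unit (q : ℕ) : ∀ p : ℕ, q ≤ p → p ≤ 2 * q ∨ q = 0 →
    |((p : ℤ)) ^ 2 - p * q - (q : ℤ) ^ 2| = 1 →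
    ∃ n, p = Nat.fib (n + 1) ∧ q = Nat.fib n := by
  induction q using Nat.strong_induction_on with
  | _ q ih =>
    intro p hqp hp2 h
    rcases Nat.eq_zero_or_pos q with rfl | hq
    · refine ⟨0, ?_, by simp⟩
      simp at h
      simpa using h
    · have hp2 : p ≤ 2 * q := hp2.resolve_right hq.ne'
      obtain ⟨m, rfl⟩ := Nat.exists_eq_add_of_le hqp
      have hm : m ≤ q := by omega
      have h' : |((q : ℤ)) ^ 2 - q * m - (m : ℤ) ^ 2| = 1 := by
        rw [← h, ← abs_neg]
        congr 1
        push_cast; ring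
      rcases hm.lt_or_eq with hlt | rfl
      · by_cases hm2 : q ≤ 2 * m ∨ m = 0
        · obtain ⟨n, h1, h2⟩ := ih m hlt q hm hm2 h'
          refine ⟨n + 1, ?_, h1⟩
          rw [Nat.fib_add_two, ← h1, ← h2, add_comm]
        -- For q > 2m with m ≥ 1 the form exceeds 1, so the pair obtained by descent cannot violate
        -- the size condition.
        · exfalso
          push Not at hm2
          obtain ⟨h3, h4⟩ := hm2
          have h3' : (2 * m + 1 : ℤ) ≤ q := by exact_mod_cast h3
          have h4' : (1 : ℤ) ≤ m := by omega
          have : (1 : ℤ) < (q : ℤ) ^ 2 - q * m - (m : ℤ) ^ 2 := by nlinarith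
          rw [abs_of_pos (by linarith)] at h'
          omega
      · have : m = 1 := by
          have h5 : ((m : ℤ)) ^ 2 = 1 := by
            have : |-((m : ℤ)) ^ 2| = 1 := by rw [← h']; congr 1; ring
            rwa [abs_neg, abs_of_nonneg (sq_nonneg _)] at this
          have h6 : (m : ℤ) ≤ 1 := by nlinarith
          omega
        subst this
        exact ⟨2, rfl, rfl⟩

/-- Put k = (p, -q). If q > p, or if p > 2q with q ≥ 1, then |p² - pq - q²| exceeds 1, so
`fib_of_unit` applies. -/
theorem eq_fibIndex_of_snd_nonpos {k : ℤ × ℤ} (hN : |nform k| = 1) (hf : |freq k| ≤ 1)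
    (h1 : 0 < k.1) (h2 : k.2 ≤ 0) : ∃ n, k = fibIndex n := by
  obtain ⟨a, b⟩ := k
  simp only at h1 h2
  obtain ⟨p, rfl⟩ := Int.eq_ofNat_of_zero_le h1.le
  obtain ⟨q, hq⟩ := Int.eq_ofNat_of_zero_le (neg_nonneg.2 h2)
  obtain rfl : b = -(q : ℤ) := by omega
  have hN' : |((p : ℤ)) ^ 2 - p * q - (q : ℤ) ^ 2| = 1 := by
    rw [← hN, nform]; congr 1; simp only; ring
  have hp : (1 : ℤ) ≤ p := h1
  have hqp : q ≤ p := by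
    by_contra hlt
    have hlt : (p + 1 : ℤ) ≤ q := by exact_mod_cast not_le.1 hlt
    have : (1 : ℤ) < (q : ℤ) ^ 2 + p * q - (p : ℤ) ^ 2 := by nlinarith
    rw [← abs_neg, abs_of_pos (by linarith)] at hN'
    omega
  have hpq : p ≤ 2 * q ∨ q = 0 := by
    by_contra hcon
    push Not at hcon
    have hlt : (2 * q + 1 : ℤ) ≤ p := by exact_mod_cast hcon.1
    have hq1 : (1 : ℤ) ≤ q := by omega
    have : (1 : ℤ) < (p : ℤ) ^ 2 - p * q - (q : ℤ) ^ 2 := by nlinarith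
    rw [abs_of_pos (by linarith)] at hN'
    omega
  obtain ⟨n, rfl, rfl⟩ := fib_of_unit q p hqp hpq hN'
  exact ⟨n, rfl⟩

/-- A frequency of modulus at most 1 forces k₁ and k₂ to have opposite signs unless k₂ = 0; a change
of sign then reduces to k₁ > 0 ≥ k₂. -/
theorem eq_fibIndex_or_neg {k : ℤ × ℤ} (hN : |nform k| = 1) (hf : |freq k| ≤ 1) :
    ∃ n, k = fibIndex n ∨ k = -fibIndex n := by
  have hN' : |nform (-k)| = 1 := by rw [← hN, nform, nform]; congr 1; simp
  have hf' : |freq (-k)| ≤ 1 := by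
    rw [← abs_neg] at hf
    have : freq (-k) = -freq k := by simp only [freq, Prod.fst_neg, Prod.snd_neg]; push_cast; ring
    rwa [this]
  have hg := one_lt_γ
  obtain ⟨hl, hu⟩ := abs_le.1 hf
  simp only [freq] at hl hu
  rcases lt_trichotomy k.2 0 with h | h | h
  · have h1 : (k.2 : ℝ) ≤ -1 := by exact_mod_cast Int.le_sub_one_of_lt h
    have : (0 : ℝ) < k.1 := by nlinarith
    obtain ⟨n, hn⟩ := eq_fibIndex_of_snd_nonpos hN hf (by exact_mod_cast this) h.le
    exact ⟨n, Or.inl hn⟩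
  · have h1 : k.1 ≠ 0 := by
      intro h0
      simp [nform, h0, h] at hN
    rcases h1.lt_or_gt with h1 | h1
    · obtain ⟨n, hn⟩ := eq_fibIndex_of_snd_nonpos hN' hf' (by simpa using h1) (by simp [h])
      exact ⟨n, Or.inr (by rw [← hn, neg_neg])⟩
    · obtain ⟨n, hn⟩ := eq_fibIndex_of_snd_nonpos hN hf h1 h.le
      exact ⟨n, Or.inl hn⟩
  · have h1 : (1 : ℝ) ≤ k.2 := by exact_mod_cast h
    have : (k.1 : ℝ) < 0 := by nlinarith
    have h3 : k.1 < 0 := by exact_mod_cast this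
    obtain ⟨n, hn⟩ := eq_fibIndex_of_snd_nonpos hN' hf' (by simpa using h3) (by simpa using h.le)
    exact ⟨n, Or.inr (by rw [← hn, neg_neg])⟩

theorem floor_γ : ⌊γ⌋ = 1 :=
  Int.floor_eq_iff.2 ⟨by simpa using one_lt_γ.le, by simpa [one_add_one_eq_two] using γ_lt_two⟩

theorem convs_γ (n : ℕ) :
    (GenContFract.of γ).convs n = (Nat.fib (n + 2) : ℝ) / Nat.fib (n + 1) := by
  induction n with
  | zero => rw [GenContFract.zeroth_conv_eq_h, GenContFract.of_h_eq_floor, floor_γ]; simp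
  | succ n ih =>
    have hfr : (Int.fract γ)⁻¹ = γ := by
      rw [Int.fract, floor_γ, Int.cast_one, ← inv_γ, inv_inv]
    rw [GenContFract.convs_succ, hfr, ih, floor_γ, Nat.fib_add_two (n := n + 1)]
    have h1 : (Nat.fib (n + 2) : ℝ) ≠ 0 := by exact_mod_cast (Nat.fib_pos.2 (by omega)).ne'
    push_cast
    field_simp
    ring

/-- The shift by one leaves out `fibIndex 0` = (1, 0), whose ratio has denominator zero. -/
theorem isConvergentIndex_fibIndex (n : ℕ) : IsConvergentIndex (fibIndex (n + 1)) := by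
  refine ⟨?_, n, ?_⟩
  · have := (Nat.fib_coprime_fib_succ (n + 1)).symm
    exact ((Nat.isCoprime_iff_coprime.2 this)).neg_right
  · rw [convs_γ]
    simp [fibIndex]

theorem abs_fibIndex_snd (n : ℕ) : |(fibIndex n).2| = Nat.fib n := by simp [fibIndex]

end
end MelnikovQP

/-! ### Exponents along the convergents and the function `c`. -/

namespace MelnikovQP

noncomputable section

theorem summable_exp_neg_mul_abs_int {r : ℝ} (hr : 0 < r) :
    Summable fun m : ℤ => Real.exp (-(r * |(m : ℝ)|)) := by
  have h : Summable fun n : ℕ => Real.exp (-(r * (n : ℝ))) := by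
    have := Real.summable_exp_nat_mul_iff.2 (neg_neg_of_pos hr)
    refine this.congr fun n => ?_
    congr 1; ring
  refine Summable.of_nat_of_neg ?_ ?_
  · simpa using h
  · simpa using h

theorem summable_exp_neg_wnorm {r₁ r₂ : ℝ} (h₁ : 0 < r₁) (h₂ : 0 < r₂) :
    Summable fun k : ℤ × ℤ => Real.exp (-wnorm r₁ r₂ k) := by
  have := (summable_exp_neg_mul_abs_int h₁).mul_of_nonneg (summable_exp_neg_mul_abs_int h₂)
    (fun _ => (Real.exp_pos _).le) (fun _ => (Real.exp_pos _).le)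
  refine this.congr fun k => ?_
  rw [← Real.exp_add, wnorm]
  congr 1; ring

theorem wnorm_nonneg {r₁ r₂ : ℝ} (h₁ : 0 < r₁) (h₂ : 0 < r₂) (k : ℤ × ℤ) : 0 ≤ wnorm r₁ r₂ k := by
  unfold wnorm; positivity

/-- The exponent attached to the `n`-th convergent. -/
def energy (L X : ℝ) (n : ℤ) : ℝ := L * γ ^ n + X ^ 2 * (γ ^ n)⁻¹

/-- With q = √L γⁿ / X the energy is X√L (q + 1/q) = 2X√L cosh(ln q). Reducing ln(1/X²) modulo 2 ln
γ picks the n for which 2 ln q lies within ln γ of 0. The two inequalities say that γ⁻¹ ≤ q² ≤ γ, so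
that the two parts of the energy are balanced up to the factor γ. -/
theorem c_attained {r₁ r₂ X : ℝ} (h₁ : 0 < r₁) (h₂ : 0 < r₂) (hX : 0 < X) :
    ∃ n : ℤ, c r₁ r₂ (Real.log (1 / X ^ 2)) * X = energy (decayRate r₁ r₂) X n ∧
      X ^ 2 ≤ γ * (decayRate r₁ r₂ * (γ ^ n) ^ 2) ∧
      decayRate r₁ r₂ * (γ ^ n) ^ 2 ≤ γ * X ^ 2 := by
  have hL := decayRate_pos h₁ h₂
  have hC : C₀ r₁ r₂ = 2 * Real.sqrt (decayRate r₁ r₂) := rfl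
  have hδ₀ : δ₀ r₁ r₂ = -(2 * Real.log γ) - Real.log (decayRate r₁ r₂) := by
    have : εstar r₁ r₂ = (γ ^ 2 * decayRate r₁ r₂)⁻¹ := by
      rw [εstar, decayRate]
      have := γ_add_inv_pos
      have h3 : 0 < γ * r₁ + r₂ := add_pos (mul_pos γ_pos h₁) h₂
      have h4 := γ_pos
      rw [mul_comm r₁]
      generalize γ = g at *
      field_simp
    rw [δ₀, this, Real.log_inv, Real.log_mul (pow_ne_zero _ γ_pos.ne') hL.ne', Real.log_pow]
    push_cast; ring
  set L := decayRate r₁ r₂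
  set t := toIcoMod two_log_gamma_pos (δ₀ r₁ r₂ - Real.log γ) (Real.log (1 / X ^ 2)) with ht
  have hmem := toIcoMod_mem_Ico two_log_gamma_pos (δ₀ r₁ r₂ - Real.log γ) (Real.log (1 / X ^ 2))
  rw [← ht] at hmem
  set m := toIcoDiv two_log_gamma_pos (δ₀ r₁ r₂ - Real.log γ) (Real.log (1 / X ^ 2))
  have htm : t = Real.log (1 / X ^ 2) - m * (2 * Real.log γ) := by
    rw [ht, ← self_sub_toIcoDiv_zsmul, zsmul_eq_mul]
  have hg : 0 < γ ^ (1 - m) := zpow_pos γ_pos _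
  have hsL : 0 < Real.sqrt L := Real.sqrt_pos.2 hL
  set q := Real.sqrt L * γ ^ (1 - m) / X with hq
  have hqpos : 0 < q := by positivity
  have hlog : (t - δ₀ r₁ r₂) / 2 = Real.log q := by
    rw [htm, hδ₀, hq, Real.log_div (by positivity) hX.ne', Real.log_mul hsL.ne' hg.ne',
      Real.log_sqrt hL.le, Real.log_zpow, one_div, Real.log_inv, Real.log_pow]
    push_cast; ring
  have hsq : Real.sqrt L ^ 2 = L := Real.sq_sqrt hL.le
  have hq2 : q ^ 2 * X ^ 2 = L * (γ ^ (1 - m)) ^ 2 := by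
    rw [hq, div_pow, mul_pow, hsq]; field_simp
  have hlg : Real.log (q ^ 2) = t - δ₀ r₁ r₂ := by rw [Real.log_pow, ← hlog]; push_cast; ring
  have u1 : q ^ 2 ≤ γ := by
    rw [← Real.log_le_log_iff (by positivity) γ_pos, hlg]; linarith [hmem.2]
  have u2 : γ⁻¹ ≤ q ^ 2 := by
    rw [← Real.log_le_log_iff (inv_pos.2 γ_pos) (by positivity), hlg, Real.log_inv]
    linarith [hmem.1]
  -- The shift by 1 comes from δ₀ = -2 ln γ - ln L.
  refine ⟨1 - m, ?_, ?_, ?_⟩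
  · rw [c, ← ht, hlog, Real.cosh_log hqpos, hC, energy, hq]
    generalize γ ^ (1 - m) = g at *
    field_simp
    rw [hsq]; ring
  · rw [← hq2]
    rw [inv_le_iff_one_le_mul₀ γ_pos] at u2
    nlinarith [sq_nonneg X]
  · rw [← hq2]
    exact mul_le_mul_of_nonneg_right u1 (sq_nonneg X)

/-- Equality holds at j = 0 because γ² = γ + 1, and every further step adds at least 1/2 to the
right side. -/
theorem γ_pow_convexity (j : ℕ) : γ ^ 2 + (j : ℝ) / 2 ≤ γ ^ (j + 1) + γ * (γ ^ (j + 1))⁻¹ := by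
  have h := γ_sq
  have h1 := one_lt_γ
  have h2 := γ_lt_two
  generalize γ = g at *
  have hg : 0 < g := by linarith
  induction j with
  | zero => simp [hg.ne', h, add_comm]
  | succ j ih =>
    have hp : g ≤ g ^ (j + 1) := le_self_pow₀ h1.le (by omega)
    have hinv : g⁻¹ = g - 1 := by field_simp; linarith
    have e : g ^ (j + 1 + 1) + g * (g ^ (j + 1 + 1))⁻¹
        = g ^ (j + 1) + g * (g ^ (j + 1))⁻¹
          + ((g - 1) * g ^ (j + 1) - g * (1 - g⁻¹) * (g ^ (j + 1))⁻¹) := by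
      rw [pow_succ g (j + 1), mul_inv]; ring
    rw [e]
    have hb : (g ^ (j + 1))⁻¹ ≤ g⁻¹ := inv_anti₀ hg hp
    have : 1 / 2 ≤ (g - 1) * g ^ (j + 1) - g * (1 - g⁻¹) * (g ^ (j + 1))⁻¹ := by
      have e2 : g * (1 - g⁻¹) = g - 1 := by field_simp
      rw [e2]
      rw [hinv] at hb
      have hgg : 1.5 < g := by nlinarith
      nlinarith [mul_le_mul_of_nonneg_left hb (by linarith : 0 ≤ g - 1),
        mul_le_mul_of_nonneg_left hp (by linarith : 0 ≤ g - 1)]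
    push_cast
    linarith

/-- The difference of the two sides decreases in B, so the worst case is B = γA, where A + B = γ²A
and `γ_pow_convexity` applies. -/
theorem add_le_of_γ_pow {A B : ℝ} (hA : 0 < A) (hBA : B ≤ γ * A) (j : ℕ) :
    A + B + A * ((j : ℝ) / 2) ≤ A * γ ^ (j + 1) + B * (γ ^ (j + 1))⁻¹ := by
  have h := γ_pow_convexity j
  have h1 := one_lt_γ
  have hsq := γ_sq
  have hp : (γ ^ (j + 1))⁻¹ ≤ 1 := inv_le_one_of_one_le₀ (one_le_pow₀ h1.le)
  have h3 := mul_le_mul_of_nonneg_right hBA (sub_nonneg.2 hp)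
  nlinarith [mul_le_mul_of_nonneg_left h hA.le]

/-- The energy grows at least linearly away from the balanced index n. With A, B its two parts at n,
`add_le_of_γ_pow` is applied with A and B in this order for j > 0 and exchanged for j < 0. -/
theorem energy_ge {L X : ℝ} {n : ℤ} (hL : 0 < L) (hX : 0 < X)
    (h₁ : X ^ 2 ≤ γ * (L * (γ ^ n) ^ 2)) (h₂ : L * (γ ^ n) ^ 2 ≤ γ * X ^ 2)
    (hlarge : 16 * γ ≤ L * X ^ 2) (j : ℤ) :
    energy L X n + 2 * (|(j : ℝ)| - 1) ≤ energy L X (n + j) := by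
  have hg : 0 < γ ^ n := zpow_pos γ_pos _
  have hγ := γ_pos
  simp only [energy, zpow_add₀ hγ.ne']
  set g := γ ^ n
  set A := L * g with hA
  set B := X ^ 2 * g⁻¹ with hB
  have hApos : 0 < A := by positivity
  have hBpos : 0 < B := by positivity
  have hAB : A * B = L * X ^ 2 := by rw [hA, hB]; field_simp
  have hBA : B ≤ γ * A := by
    rw [hA, hB, mul_inv_le_iff₀ hg]; linarith [h₁]
  have hAB' : A ≤ γ * B := by
    rw [hA, hB, ← mul_assoc, le_mul_inv_iff₀ hg]; linarith [h₂]
  -- The largeness of X enters here: 16γ ≤ AB ≤ γA², so A ≥ 4 and a growth of A/2 per step is at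
  -- least 2.
  have hA4 : 4 ≤ A := by
    by_contra hlt
    push Not at hlt
    have : A * B ≤ γ * A ^ 2 := by nlinarith
    have h3 : γ * A ^ 2 < γ * 16 := mul_lt_mul_of_pos_left (by nlinarith) hγ
    linarith
  have hB4 : 4 ≤ B := by
    by_contra hlt
    push Not at hlt
    have : A * B ≤ γ * B ^ 2 := by nlinarith
    have h3 : γ * B ^ 2 < γ * 16 := mul_lt_mul_of_pos_left (by nlinarith) hγ
    linarith
  have e : L * (g * γ ^ j) + X ^ 2 * (g * γ ^ j)⁻¹ = A * γ ^ j + B * (γ ^ j)⁻¹ := by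
    rw [hA, hB, mul_inv]; ring
  rw [e]
  obtain ⟨m, rfl | rfl⟩ := j.eq_nat_or_neg
  · rcases m with _ | m
    · simp
    · have := add_le_of_γ_pow hApos hBA m
      rw [zpow_natCast]
      have h5 : |(((m + 1 : ℕ) : ℤ) : ℝ)| = m + 1 := by
        rw [Int.cast_natCast, Nat.abs_cast]; push_cast; ring
      rw [h5]
      have hm : (0 : ℝ) ≤ m := m.cast_nonneg
      nlinarith
  · rcases m with _ | m
    · simp
    · have := add_le_of_γ_pow hBpos hAB' m
      rw [zpow_neg, zpow_natCast, inv_inv]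
      have h5 : |((-((m + 1 : ℕ) : ℤ) : ℤ) : ℝ)| = m + 1 := by
        rw [Int.cast_neg, abs_neg, Int.cast_natCast, Nat.abs_cast]; push_cast; ring
      rw [h5]
      have hm : (0 : ℝ) ≤ m := m.cast_nonneg
      nlinarith

/-- The parts A, B have ratio between γ⁻¹ and γ, so A/B + B/A ≤ γ + γ⁻¹ = 2γ - 1 and (A + B)² ≤ (2γ
+ 1)AB. This constant must stay below the 7 of `exponent_sq_ge`. -/
theorem energy_sq_le {L X : ℝ} {n : ℤ}
    (h₁ : X ^ 2 ≤ γ * (L * (γ ^ n) ^ 2)) (h₂ : L * (γ ^ n) ^ 2 ≤ γ * X ^ 2) :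
    energy L X n ^ 2 ≤ (2 * γ + 1) * (L * X ^ 2) := by
  have hg : 0 < γ ^ n := zpow_pos γ_pos _
  have hγ := γ_pos
  have hsq := γ_sq
  simp only [energy]
  set g := γ ^ n
  have hAB : (L * g) * (X ^ 2 * g⁻¹) = L * X ^ 2 := by field_simp
  have hBA : X ^ 2 * g⁻¹ ≤ γ * (L * g) := by
    rw [mul_inv_le_iff₀ hg]; linarith [h₁]
  have hAB' : L * g ≤ γ * (X ^ 2 * g⁻¹) := by
    rw [← mul_assoc, le_mul_inv_iff₀ hg]; linarith [h₂]
  rw [← hAB]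
  generalize L * g = A at *
  generalize X ^ 2 * g⁻¹ = B at *
  generalize γ = t at *
  have := mul_nonneg (sub_nonneg.2 hBA) (sub_nonneg.2 hAB')
  have h3 : t * (A ^ 2 + B ^ 2) ≤ t * ((2 * t - 1) * (A * B)) := by
    have : t * ((2 * t - 1) * (A * B)) = (t ^ 2 + 1) * (A * B) := by
      linear_combination (A * B) * hsq
    nlinarith
  have := le_of_mul_le_mul_left h3 hγ
  nlinarith

end
end MelnikovQP

/-! ### The exponential sum is dominated by the minimising convergent. -/

namespace MelnikovQP

noncomputable section

/-- The summand of the exponential sum bounding the Melnikov function. -/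
def expTerm (r₁ r₂ X : ℝ) (k : ℤ × ℤ) : ℝ :=
  ((X * |freq k|) ^ 2 + (X * |freq k|)⁻¹) *
    Real.exp (-(wnorm r₁ r₂ k + X ^ 2 * |freq k|))

theorem expTerm_nonneg (r₁ r₂ : ℝ) {X : ℝ} (hX : 0 < X) (k : ℤ × ℤ) : 0 ≤ expTerm r₁ r₂ X k := by
  unfold expTerm; positivity

/-- This relies on the convention `0⁻¹ = 0`; it agrees with the vanishing mean of `F`. -/
theorem expTerm_zero (r₁ r₂ X : ℝ) : expTerm r₁ r₂ X 0 = 0 := by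
  simp [expTerm, freq]

theorem sq_le_exp {x : ℝ} (hx : 0 ≤ x) : x ^ 2 ≤ 800 * Real.exp (x / 20) := by
  have := Real.quadratic_le_exp_of_nonneg (by positivity : 0 ≤ x / 20)
  nlinarith

theorem le_exp_div (x : ℝ) : x ≤ 20 * Real.exp (x / 20) := by
  have := Real.add_one_le_exp (x / 20)
  linarith

/-- Indices other than convergents have an exponent that is larger by a definite factor. -/
theorem exponent_sq_ge {r₁ r₂ X : ℝ} (h₁ : 0 < r₁) (h₂ : 0 < r₂)
    (hX₁ : 8 * decayDefect r₁ r₂ ≤ X ^ 2) (hX₂ : 7 * decayRate r₁ r₂ ≤ X ^ 2)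
    {k : ℤ × ℤ} (hk : 2 ≤ |nform k| ∨ 1 < |freq k|) :
    7 * (decayRate r₁ r₂ * X ^ 2) ≤ (wnorm r₁ r₂ k + X ^ 2 * |freq k|) ^ 2 := by
  have hw := wnorm_ge h₁ h₂ k
  have hw0 := wnorm_nonneg h₁ h₂ k
  have hL := decayRate_pos h₁ h₂
  have hD := decayDefect_pos h₁ h₂
  have hN := abs_freq_mul_abs_conjFreq k
  have hf := abs_nonneg (freq k)
  have hc := abs_nonneg (conjFreq k)
  rcases hk with hk | hk
  · have hk' : (2 : ℝ) ≤ |nform k| := by exact_mod_cast hk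
    have hE : decayRate r₁ r₂ * |conjFreq k| + (X ^ 2 - decayDefect r₁ r₂) * |freq k|
        ≤ wnorm r₁ r₂ k + X ^ 2 * |freq k| := by linarith
    have hXD : 0 ≤ X ^ 2 - decayDefect r₁ r₂ := by linarith
    have hpos : 0 ≤ decayRate r₁ r₂ * |conjFreq k| + (X ^ 2 - decayDefect r₁ r₂) * |freq k| := by
      positivity
    refine le_trans ?_ (pow_le_pow_left₀ hpos hE 2)
    -- By (a + b)² ≥ 4ab and |ωω'| ≥ 2 the square is at least 8L(X² - D), and D ≤ X²/8 leaves 7LX².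
    have hamgm := sq_nonneg (decayRate r₁ r₂ * |conjFreq k|
      - (X ^ 2 - decayDefect r₁ r₂) * |freq k|)
    have h4 : 2 * (decayRate r₁ r₂ * (X ^ 2 - decayDefect r₁ r₂)) ≤
        decayRate r₁ r₂ * (X ^ 2 - decayDefect r₁ r₂) * (|freq k| * |conjFreq k|) := by
      rw [hN, mul_comm]
      exact mul_le_mul_of_nonneg_left hk' (by positivity)
    nlinarith
  · have hE : X ^ 2 ≤ wnorm r₁ r₂ k + X ^ 2 * |freq k| := by nlinarith [sq_nonneg X]
    refine le_trans ?_ (pow_le_pow_left₀ (sq_nonneg X) hE 2)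
    nlinarith [sq_nonneg X]

/-- Since 2γ + 1 < 0.81 · 7, the minimal energy is at most 9/10 of the exponent E. Of the spare
tenth, one half absorbs the prefactor and the other half leaves a summable factor in k. -/
theorem expTerm_le_of_not_convergent {r₁ r₂ X : ℝ} (h₁ : 0 < r₁) (h₂ : 0 < r₂) (hX : 1 ≤ X)
    (hX₁ : 8 * decayDefect r₁ r₂ ≤ X ^ 2) (hX₂ : 7 * decayRate r₁ r₂ ≤ X ^ 2)
    {n : ℤ} (hn₁ : X ^ 2 ≤ γ * (decayRate r₁ r₂ * (γ ^ n) ^ 2))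
    (hn₂ : decayRate r₁ r₂ * (γ ^ n) ^ 2 ≤ γ * X ^ 2)
    {k : ℤ × ℤ} (hk₀ : k ≠ 0) (hk : 2 ≤ |nform k| ∨ 1 < |freq k|) :
    expTerm r₁ r₂ X k ≤ (800 + 20 * ((1 + decayDefect r₁ r₂) / decayRate r₁ r₂)) *
      Real.exp (-energy (decayRate r₁ r₂) X n) * Real.exp (-(wnorm r₁ r₂ k / 20)) := by
  have hE := exponent_sq_ge h₁ h₂ hX₁ hX₂ hk
  have he := energy_sq_le hn₁ hn₂
  have hw := wnorm_ge h₁ h₂ k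
  have hw0 := wnorm_nonneg h₁ h₂ k
  have hL := decayRate_pos h₁ h₂
  have hD := decayDefect_pos h₁ h₂
  have hN := abs_freq_mul_abs_conjFreq k
  have hN1 := one_le_abs_nform hk₀
  have hf : 0 < |freq k| := abs_pos.2 (freq_ne_zero hk₀)
  have hX0 : 0 < X := by linarith
  have hX2 : 1 ≤ X ^ 2 := one_le_pow₀ hX
  rw [expTerm]
  set E := wnorm r₁ r₂ k + X ^ 2 * |freq k| with hEdef
  have hE0 : 0 ≤ E := by positivity
  have hγ : γ < 1.63 := by
    have := γ_sq; have := one_lt_γ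
    generalize γ = g at *
    nlinarith
  have hle : energy (decayRate r₁ r₂) X n ≤ 9 / 10 * E := by
    refine le_of_sq_le_sq ?_ (by positivity)
    have : 0 ≤ decayRate r₁ r₂ * X ^ 2 := by positivity
    nlinarith
  have hfE : X ^ 2 * |freq k| ≤ E := by linarith
  have t1 : (X * |freq k|) ^ 2 ≤ 800 * Real.exp (E / 20) := by
    refine le_trans ?_ (sq_le_exp hE0)
    refine pow_le_pow_left₀ (by positivity) (le_trans ?_ hfE) 2
    exact mul_le_mul_of_nonneg_right (by nlinarith) hf.le
  have t2 : (X * |freq k|)⁻¹ ≤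
      20 * ((1 + decayDefect r₁ r₂) / decayRate r₁ r₂) * Real.exp (E / 20) := by
    -- The small divisor is controlled by |ωω'| ≥ 1: its inverse is at most |ω'|, which is linear in
    -- the exponent.
    have a1 : (X * |freq k|)⁻¹ ≤ |conjFreq k| := by
      rw [inv_le_iff_one_le_mul₀ (by positivity)]
      calc (1 : ℝ) ≤ |freq k| * |conjFreq k| := by rw [hN]; exact_mod_cast hN1
        _ ≤ X * (|freq k| * |conjFreq k|) :=
          le_mul_of_one_le_left (by positivity) hX
        _ = _ := by ring
    have a2 : |conjFreq k| ≤ (1 + decayDefect r₁ r₂) / decayRate r₁ r₂ * E := by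
      rw [div_mul_eq_mul_div, le_div_iff₀ hL]
      have : |freq k| ≤ X ^ 2 * |freq k| := le_mul_of_one_le_left hf.le hX2
      nlinarith
    refine a1.trans (a2.trans ?_)
    have := mul_le_mul_of_nonneg_left (le_exp_div E)
      (by positivity : 0 ≤ (1 + decayDefect r₁ r₂) / decayRate r₁ r₂)
    linarith
  have hexp : Real.exp (E / 20) * Real.exp (-E) ≤
      Real.exp (-energy (decayRate r₁ r₂) X n) * Real.exp (-(wnorm r₁ r₂ k / 20)) := by
    rw [← Real.exp_add, ← Real.exp_add, Real.exp_le_exp]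
    have : 0 ≤ X ^ 2 * |freq k| := by positivity
    linarith
  calc _ ≤ ((800 + 20 * ((1 + decayDefect r₁ r₂) / decayRate r₁ r₂)) * Real.exp (E / 20))
        * Real.exp (-E) := mul_le_mul_of_nonneg_right (by linarith) (Real.exp_pos _).le
    _ = (800 + 20 * ((1 + decayDefect r₁ r₂) / decayRate r₁ r₂)) *
        (Real.exp (E / 20) * Real.exp (-E)) := by ring
    _ ≤ _ := by
      rw [mul_assoc]
      exact mul_le_mul_of_nonneg_left hexp (by positivity)

theorem γ_zpow_sq_le (j : ℤ) : (γ ^ j) ^ 2 ≤ Real.exp |(j : ℝ)| := by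
  have h1 : γ ^ 2 ≤ Real.exp 1 := by
    have := Real.exp_one_gt_d9
    have h2 := γ_sq; have := one_lt_γ
    generalize γ = g at *
    nlinarith
  have h0 : (γ ^ j) ^ 2 ≤ (γ ^ 2) ^ (j.natAbs) := by
    rw [← pow_mul, mul_comm, pow_mul]
    refine pow_le_pow_left₀ (zpow_pos γ_pos _).le ?_ 2
    rw [← zpow_natCast]
    exact zpow_le_zpow_right₀ one_lt_γ.le Int.le_natAbs
  refine h0.trans ((pow_le_pow_left₀ (sq_nonneg _) h1 _).trans_eq ?_)
  rw [← Real.exp_nat_mul, mul_one]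
  congr 1
  rw [← Int.cast_abs, Int.abs_eq_natAbs, Int.cast_natCast]

/-- At distance |j| from the minimiser the prefactor costs at most a constant times e^{|j|}, because
γ² ≤ e, while the energy gains 2(|j| - 1). A factor e^{-|j|} remains. -/
theorem expTerm_fibIndex_le {r₁ r₂ X : ℝ} (h₁ : 0 < r₁) (h₂ : 0 < r₂) (hX : 0 < X)
    (hX₁ : 16 * γ ≤ decayRate r₁ r₂ * X ^ 2)
    {n : ℤ} (hn₁ : X ^ 2 ≤ γ * (decayRate r₁ r₂ * (γ ^ n) ^ 2))
    (hn₂ : decayRate r₁ r₂ * (γ ^ n) ^ 2 ≤ γ * X ^ 2)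
    {k : ℤ × ℤ} {m : ℕ} (hk : k = fibIndex m ∨ k = -fibIndex m) :
    expTerm r₁ r₂ X k ≤ (γ * decayRate r₁ r₂ + (1 + γ / decayRate r₁ r₂)) *
      Real.exp (decayDefect r₁ r₂ + 2) *
      Real.exp (-energy (decayRate r₁ r₂) X n) * Real.exp (-|((m : ℤ) - n : ℤ)|) := by
  have hL := decayRate_pos h₁ h₂
  have hD := decayDefect_pos h₁ h₂
  have hγ := γ_pos
  have hf : |freq k| = (γ ^ m)⁻¹ := by
    rw [← abs_freq_fibIndex]
    rcases hk with rfl | rfl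
    · rfl
    · rw [← abs_neg]; congr 1
      simp only [freq, Prod.fst_neg, Prod.snd_neg]; push_cast; ring
  have hc : |conjFreq k| = γ ^ m := by
    rw [← abs_of_pos (pow_pos hγ m), ← conjFreq_fibIndex]
    rcases hk with rfl | rfl
    · rfl
    · rw [← abs_neg]; congr 1
      simp only [conjFreq, Prod.fst_neg, Prod.snd_neg]; push_cast; ring
  have hw := wnorm_ge h₁ h₂ k
  set j : ℤ := (m : ℤ) - n with hj
  have hmj : (m : ℤ) = n + j := by omega
  have hen := energy_ge hL hX hn₁ hn₂ hX₁ j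
  rw [← hmj] at hen
  have hm1 : (γ ^ m)⁻¹ ≤ 1 := inv_le_one_of_one_le₀ (one_le_pow₀ one_lt_γ.le)
  have hE : energy (decayRate r₁ r₂) X m - decayDefect r₁ r₂ ≤
      wnorm r₁ r₂ k + X ^ 2 * |freq k| := by
    rw [hf, hc] at hw
    rw [hf, energy, zpow_natCast]
    nlinarith
  have hgm : γ ^ m = γ ^ n * γ ^ j := by rw [← zpow_add₀ hγ.ne', ← hmj, zpow_natCast]
  have hgn : 0 < γ ^ n := zpow_pos hγ _
  have hgj : 0 < γ ^ j := zpow_pos hγ _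
  have s1 := γ_zpow_sq_le j
  have s2 := γ_zpow_sq_le (-j)
  rw [Int.cast_neg, abs_neg, zpow_neg] at s2
  have t1 : (X * |freq k|) ^ 2 ≤ γ * decayRate r₁ r₂ * Real.exp |(j : ℝ)| := by
    have : (X * |freq k|) ^ 2 = X ^ 2 * ((γ ^ n) ^ 2)⁻¹ * ((γ ^ j)⁻¹) ^ 2 := by
      rw [hf, hgm]; field_simp
    rw [this]
    refine mul_le_mul ?_ s2 (sq_nonneg _) (by positivity)
    rw [mul_inv_le_iff₀ (by positivity)]
    linarith
  have t2 : (X * |freq k|)⁻¹ ≤ (1 + γ / decayRate r₁ r₂) * Real.exp |(j : ℝ)| := by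
    have : (X * |freq k|)⁻¹ = (γ ^ n / X) * γ ^ j := by
      rw [hf, hgm]; field_simp
    rw [this]
    have a1 : (γ ^ n / X) ^ 2 ≤ γ / decayRate r₁ r₂ := by
      rw [div_pow, div_le_div_iff₀ (by positivity) hL]; linarith
    have a2 : γ ^ n / X ≤ 1 + γ / decayRate r₁ r₂ := by nlinarith [sq_nonneg (γ ^ n / X - 1)]
    have a3 : γ ^ j ≤ Real.exp |(j : ℝ)| := by
      have : 1 ≤ Real.exp |(j : ℝ)| := Real.one_le_exp (abs_nonneg _)
      nlinarith
    exact mul_le_mul a2 a3 hgj.le (by positivity)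
  have t3 : Real.exp (-(wnorm r₁ r₂ k + X ^ 2 * |freq k|)) ≤
      Real.exp (decayDefect r₁ r₂ + 2) * Real.exp (-energy (decayRate r₁ r₂) X n) *
        Real.exp (-(2 * |(j : ℝ)|)) := by
    rw [← Real.exp_add, ← Real.exp_add, Real.exp_le_exp]
    linarith
  have ej : Real.exp |(j : ℝ)| * Real.exp (-(2 * |(j : ℝ)|)) = Real.exp (-|(j : ℝ)|) := by
    rw [← Real.exp_add]; congr 1; ring
  rw [expTerm]
  calc _ ≤ ((γ * decayRate r₁ r₂ + (1 + γ / decayRate r₁ r₂)) * Real.exp |(j : ℝ)|) *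
        (Real.exp (decayDefect r₁ r₂ + 2) * Real.exp (-energy (decayRate r₁ r₂) X n) *
          Real.exp (-(2 * |(j : ℝ)|))) :=
        mul_le_mul (by linarith) t3 (Real.exp_pos _).le (by positivity)
    _ = (γ * decayRate r₁ r₂ + (1 + γ / decayRate r₁ r₂)) *
      Real.exp (decayDefect r₁ r₂ + 2) * Real.exp (-energy (decayRate r₁ r₂) X n) *
        (Real.exp |(j : ℝ)| * Real.exp (-(2 * |(j : ℝ)|))) := by ring
    _ = _ := by rw [ej, Int.cast_abs]

theorem exists_expTerm_sum_le {r₁ r₂ : ℝ} (h₁ : 0 < r₁) (h₂ : 0 < r₂) :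
    ∃ C X₀ : ℝ, 0 < C ∧ 1 ≤ X₀ ∧ ∀ X, X₀ ≤ X → Summable (expTerm r₁ r₂ X) ∧
      ∑' k, expTerm r₁ r₂ X k ≤ C * Real.exp (-(c r₁ r₂ (Real.log (1 / X ^ 2)) * X)) := by
  have hL := decayRate_pos h₁ h₂
  have hD := decayDefect_pos h₁ h₂
  have hγ := γ_pos
  set L := decayRate r₁ r₂
  set D := decayDefect r₁ r₂
  set C₁ := 800 + 20 * ((1 + D) / L)
  set C₂ := (γ * L + (1 + γ / L)) * Real.exp (D + 2)
  have hC₁ : 0 < C₁ := by positivity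
  have hC₂ : 0 < C₂ := by positivity
  have hW : Summable fun k : ℤ × ℤ => Real.exp (-(wnorm r₁ r₂ k / 20)) := by
    refine (summable_exp_neg_wnorm (by positivity : 0 < r₁ / 20)
      (by positivity : 0 < r₂ / 20)).congr fun k => ?_
    congr 2; simp only [wnorm]; ring
  have hV : Summable fun j : ℤ => Real.exp (-|(j : ℝ)|) := by
    simpa using summable_exp_neg_mul_abs_int one_pos
  set W := ∑' k : ℤ × ℤ, Real.exp (-(wnorm r₁ r₂ k / 20))
  set V := ∑' j : ℤ, Real.exp (-|(j : ℝ)|)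
  have hW0 : 0 ≤ W := tsum_nonneg fun _ => (Real.exp_pos _).le
  have hV0 : 0 ≤ V := tsum_nonneg fun _ => (Real.exp_pos _).le
  refine ⟨C₁ * W + 2 * C₂ * V + 1, 1 + 8 * D + 7 * L + 16 * γ / L, by positivity, ?_, ?_⟩
  · have : 0 ≤ 8 * D + 7 * L + 16 * γ / L := by positivity
    linarith
  intro X hX
  have hX1 : 1 ≤ X := by
    have : 0 ≤ 8 * D + 7 * L + 16 * γ / L := by positivity
    linarith
  have hXX : X ≤ X ^ 2 := by nlinarith
  have hγL : 0 < 16 * γ / L := by positivity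
  have hX₁ : 8 * D ≤ X ^ 2 := by linarith
  have hX₂ : 7 * L ≤ X ^ 2 := by linarith
  have hX₃ : 16 * γ ≤ L * X ^ 2 := by
    have : 16 * γ / L ≤ X ^ 2 := by linarith
    rw [div_le_iff₀ hL] at this
    linarith
  have hX0 : 0 < X := by linarith
  obtain ⟨n, hcn, hn₁, hn₂⟩ := c_attained h₁ h₂ hX0
  rw [hcn]
  set e := Real.exp (-energy L X n)
  have he : 0 < e := Real.exp_pos _
  have hfin : ∀ s : Finset (ℤ × ℤ), ∑ k ∈ s, expTerm r₁ r₂ X k ≤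
      (C₁ * W + 2 * C₂ * V + 1) * e := by
    intro s
    classical
    set q : ℤ × ℤ → Prop := fun k => k ≠ 0 ∧ |nform k| = 1 ∧ |freq k| ≤ 1
    rw [← Finset.sum_filter_add_sum_filter_not s q]
    have p1 : ∑ k ∈ s.filter (fun k => ¬ q k), expTerm r₁ r₂ X k ≤ C₁ * W * e := by
      calc _ ≤ ∑ k ∈ s.filter (fun k => ¬ q k), C₁ * e * Real.exp (-(wnorm r₁ r₂ k / 20)) := by
            refine Finset.sum_le_sum fun k hk => ?_
            by_cases hk0 : k = 0
            · rw [hk0, expTerm_zero]; positivity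
            · refine expTerm_le_of_not_convergent h₁ h₂ hX1 hX₁ hX₂ hn₁ hn₂ hk0 ?_
              have hq := (Finset.mem_filter.1 hk).2
              by_contra hcon
              push Not at hcon
              refine hq ⟨hk0, ?_, hcon.2⟩
              have := Int.one_le_abs (nform_ne_zero hk0)
              omega
        _ = C₁ * e * ∑ k ∈ s.filter (fun k => ¬ q k), Real.exp (-(wnorm r₁ r₂ k / 20)) := by
            rw [Finset.mul_sum]
        _ ≤ C₁ * e * W := mul_le_mul_of_nonneg_left
            (hW.sum_le_tsum _ fun _ _ => (Real.exp_pos _).le) (by positivity)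
        _ = _ := by ring
    have p2 : ∑ k ∈ s.filter q, expTerm r₁ r₂ X k ≤ 2 * C₂ * V * e := by
      have hex : ∀ k : ℤ × ℤ, ∃ m : ℕ, q k → (k = fibIndex m ∨ k = -fibIndex m) := by
        intro k
        by_cases hq : q k
        · obtain ⟨m, hm⟩ := eq_fibIndex_or_neg hq.2.1 hq.2.2
          exact ⟨m, fun _ => hm⟩
        · exact ⟨0, fun h => absurd h hq⟩
      choose i hi using hex
      -- A convergent index is determined by its number and its sign; the boolean records the sign
      -- and accounts for the factor 2.
      have hinj : Set.InjOn (fun k => ((i k : ℤ) - n, decide (k = fibIndex (i k))))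
          (s.filter q) := by
        intro k hk k' hk' hkk'
        have hk := hi k (Finset.mem_filter.1 hk).2
        have hk' := hi k' (Finset.mem_filter.1 hk').2
        simp only [Prod.mk.injEq, decide_eq_decide] at hkk'
        obtain ⟨h3, h4⟩ := hkk'
        have h3 : i k = i k' := by omega
        by_cases h5 : k = fibIndex (i k)
        · rw [h5, h4.1 h5, ← h3]
        · rw [hk.resolve_left h5, hk'.resolve_left fun h => h5 (h4.2 h), h3]
      have hV2 : Summable fun p : ℤ × Bool => Real.exp (-|(p.1 : ℝ)|) := by
        refine (hV.mul_of_nonneg (g := fun _ : Bool => (1 : ℝ)) (Summable.of_finite)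
          (fun _ => (Real.exp_pos _).le) (fun _ => zero_le_one)).congr fun p => by simp
      have hV2' : ∑' p : ℤ × Bool, Real.exp (-|(p.1 : ℝ)|) = 2 * V := by
        rw [hV2.tsum_prod]
        simp [tsum_mul_left, V]
      calc _ ≤ ∑ k ∈ s.filter q, C₂ * e * Real.exp (-|(((i k : ℤ) - n : ℤ) : ℝ)|) := by
            refine Finset.sum_le_sum fun k hk => ?_
            have := expTerm_fibIndex_le h₁ h₂ hX0 hX₃ hn₁ hn₂ (hi k (Finset.mem_filter.1 hk).2)
            rwa [Int.cast_abs] at this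
        _ = C₂ * e * ∑ k ∈ s.filter q, Real.exp (-|(((i k : ℤ) - n : ℤ) : ℝ)|) := by
            rw [Finset.mul_sum]
        _ = C₂ * e * ∑ p ∈ (s.filter q).image
              (fun k => ((i k : ℤ) - n, decide (k = fibIndex (i k)))),
              Real.exp (-|(p.1 : ℝ)|) := by
            rw [Finset.sum_image hinj]
        _ ≤ C₂ * e * (2 * V) := by
            rw [← hV2']
            exact mul_le_mul_of_nonneg_left
              (hV2.sum_le_tsum _ fun _ _ => (Real.exp_pos _).le) (by positivity)
        _ = _ := by ring
    nlinarith
  have h0 := expTerm_nonneg r₁ r₂ hX0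
  exact ⟨summable_of_sum_le h0 hfin, Real.tsum_le_of_sum_le h0 hfin⟩

end
end MelnikovQP

/-! ### Hyperbolic functions and the residue theorem on a strip. -/

namespace MelnikovQP

noncomputable section

open Filter Topology MeasureTheory Complex

theorem norm_sinh_sq (z : ℂ) : ‖sinh z‖ ^ 2 = Real.sinh z.re ^ 2 + Real.sin z.im ^ 2 := by
  rw [sinh_parts, mul_comm I, Complex.sq_norm, Complex.normSq_add_mul_I, mul_pow, mul_pow,
    Real.cosh_sq, Real.cos_sq']
  ring

theorem norm_cosh_sq (z : ℂ) : ‖cosh z‖ ^ 2 = Real.sinh z.re ^ 2 + Real.cos z.im ^ 2 := by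
  have : cosh z = ((Real.cosh z.re * Real.cos z.im : ℝ) : ℂ)
      + ((Real.sinh z.re * Real.sin z.im : ℝ) : ℂ) * I := by
    conv_lhs => rw [← Complex.re_add_im z, Complex.cosh_add, Complex.sinh_mul_I,
      Complex.cosh_mul_I]
    push_cast
    ring
  rw [this, Complex.sq_norm, Complex.normSq_add_mul_I, mul_pow, mul_pow, Real.cosh_sq,
    Real.sin_sq]
  ring

theorem abs_sinh_re_le_norm_sinh (z : ℂ) : |Real.sinh z.re| ≤ ‖sinh z‖ := by
  refine abs_le_of_sq_le_sq ?_ (norm_nonneg _)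
  rw [norm_sinh_sq]; nlinarith [sq_nonneg (Real.sin z.im)]

theorem half_one_add_sq_le_cosh (x : ℝ) : (1 + x ^ 2) / 2 ≤ Real.cosh x := by
  have h : Real.cosh x = 1 + 2 * Real.sinh (x / 2) ^ 2 := by
    have h2 := Real.cosh_two_mul (x / 2)
    rw [mul_div_cancel₀ x (two_ne_zero)] at h2
    rw [h2, Real.cosh_sq]; ring
  have : (x / 2) ^ 2 ≤ Real.sinh (x / 2) ^ 2 := by
    rw [sq_le_sq, Real.abs_sinh]
    exact Real.self_le_sinh_iff.2 (abs_nonneg _)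
  rw [h]; nlinarith

theorem integrable_inv_cosh : Integrable fun x : ℝ => (Real.cosh x)⁻¹ := by
  refine (integrable_inv_one_add_sq.const_mul 2).mono'
    (Real.continuous_cosh.inv₀ fun x => (Real.cosh_pos x).ne').aestronglyMeasurable
    (Eventually.of_forall fun x => ?_)
  rw [Real.norm_of_nonneg (inv_nonneg.2 (Real.cosh_pos x).le), ← div_eq_mul_inv,
    le_div_iff₀ (by positivity), inv_mul_le_iff₀ (Real.cosh_pos x)]
  linarith [half_one_add_sq_le_cosh x]

theorem tendsto_sinh_atTop : Tendsto Real.sinh atTop atTop :=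
  tendsto_atTop_mono' atTop ((eventually_ge_atTop 0).mono fun _ => Real.self_le_sinh_iff.2) tendsto_id

theorem tendsto_sinh_atBot : Tendsto Real.sinh atBot atBot := by
  have := tendsto_neg_atTop_atBot.comp (tendsto_sinh_atTop.comp tendsto_neg_atBot_atTop)
  refine this.congr fun x => by simp

theorem sin_mul_cosh_le_norm_sinh {z : ℂ} : |Real.sin z.im| * Real.cosh z.re ≤ ‖sinh z‖ := by
  refine le_of_sq_le_sq ?_ (norm_nonneg _)
  rw [norm_sinh_sq, mul_pow, sq_abs, Real.cosh_sq]
  nlinarith [Real.sin_sq_le_one z.im, sq_nonneg (Real.sinh z.re)]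

theorem sinh_ne_zero_of_im {z : ℂ} (hz : Real.sin z.im ≠ 0) : sinh z ≠ 0 := by
  rw [← norm_pos_iff]
  exact lt_of_lt_of_le (mul_pos (abs_pos.2 hz) (Real.cosh_pos _)) sin_mul_cosh_le_norm_sinh

theorem integrable_inv_sinh_sub {p : ℂ} (hp : 0 < p.im) (hp' : p.im < Real.pi) :
    Integrable fun x : ℝ => (sinh (x - p))⁻¹ := by
  have hs : 0 < Real.sin p.im := Real.sin_pos_of_pos_of_lt_pi hp hp'
  have him : ∀ x : ℝ, ((x : ℂ) - p).im = -p.im := by intro x; simp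
  have hne : ∀ x : ℝ, sinh ((x : ℂ) - p) ≠ 0 := fun x =>
    sinh_ne_zero_of_im (by rw [him, Real.sin_neg]; exact neg_ne_zero.2 hs.ne')
  refine ((integrable_inv_cosh.comp_sub_right p.re).const_mul (Real.sin p.im)⁻¹).mono'
    (Continuous.aestronglyMeasurable ?_) (Eventually.of_forall fun x => ?_)
  · exact Continuous.inv₀ (by fun_prop) hne
  · rw [norm_inv, ← mul_inv]
    refine inv_anti₀ (mul_pos hs (Real.cosh_pos _)) ?_
    have := sin_mul_cosh_le_norm_sinh (z := (x : ℂ) - p)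
    rwa [him, Real.sin_neg, abs_neg, abs_of_pos hs, sub_re, ofReal_re] at this

/-- After translation to p = ib the real part is odd in x, and the imaginary part has the primitive
arctan(sinh x / sin b). -/
theorem integral_inv_sinh_sub {p : ℂ} (hp : 0 < p.im) (hp' : p.im < Real.pi) :
    ∫ x : ℝ, (sinh (x - p))⁻¹ = Real.pi * I := by
  have hs : 0 < Real.sin p.im := Real.sin_pos_of_pos_of_lt_pi hp hp'
  have hsub : ∫ x : ℝ, (sinh (x - p))⁻¹ = ∫ x : ℝ, (sinh (x - p.im * I))⁻¹ := by
    rw [← integral_sub_right_eq_self (fun x : ℝ => (sinh (x - p.im * I))⁻¹) p.re]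
    congr 1; ext x
    congr 2
    conv_lhs => rw [← re_add_im p]
    push_cast; ring
  have hint : Integrable fun x : ℝ => (sinh (x - p.im * I))⁻¹ :=
    integrable_inv_sinh_sub (p := p.im * I) (by simpa using hp) (by simpa using hp')
  rw [hsub]
  set b := p.im
  have hre : (∫ x : ℝ, (sinh (x - b * I))⁻¹).re = 0 := by
    have h1 : ∫ x : ℝ, (sinh (x - b * I))⁻¹ = -(starRingEnd ℂ) (∫ x : ℝ, (sinh (x - b * I))⁻¹) := by
      rw [← integral_conj, ← integral_neg, ← integral_neg_eq_self]
      congr 1; ext x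
      rw [map_inv₀, ← sinh_conj, ← inv_neg, ← sinh_neg]
      congr 2
      simp
      ring
    have := congrArg re h1
    rw [neg_re, conj_re] at this
    linarith
  have hden : ∀ x : ℝ, 0 < Real.sinh x ^ 2 + Real.sin b ^ 2 := fun x => by positivity
  have him : ∀ x : ℝ, ((sinh (x - b * I))⁻¹).im
      = Real.cosh x * Real.sin b / (Real.sinh x ^ 2 + Real.sin b ^ 2) := by
    intro x
    have hn := norm_sinh_sq ((x : ℂ) - b * I)
    have e1 : ((x : ℂ) - b * I).re = x := by simp
    have e2 : ((x : ℂ) - b * I).im = -b := by simp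
    have hp := sinh_parts ((x : ℂ) - b * I)
    rw [e1, e2] at hp hn
    rw [Complex.sq_norm, Real.sin_neg, neg_sq] at hn
    rw [inv_im, hn, hp, add_im, ofReal_im, I_mul_im, ofReal_re, Real.sin_neg]
    ring
  have hderiv : ∀ x : ℝ, HasDerivAt (fun x => Real.arctan (Real.sinh x / Real.sin b))
      (Real.cosh x * Real.sin b / (Real.sinh x ^ 2 + Real.sin b ^ 2)) x := by
    intro x
    have h := ((Real.hasDerivAt_sinh x).div_const (Real.sin b)).arctan
    convert h using 1
    have := hden x
    field_simp
    ring
  have hint_im : Integrable fun x : ℝ =>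
      Real.cosh x * Real.sin b / (Real.sinh x ^ 2 + Real.sin b ^ 2) := by
    refine hint.im.congr (Eventually.of_forall fun x => ?_)
    exact him x
  have hval : (∫ x : ℝ, (sinh (x - b * I))⁻¹).im = Real.pi := by
    have h1 : (∫ x : ℝ, (sinh (x - b * I))⁻¹).im = ∫ x : ℝ, ((sinh (x - b * I))⁻¹).im :=
      (integral_im hint).symm
    rw [h1]
    simp only [him]
    rw [integral_of_hasDerivAt_of_tendsto (m := -(Real.pi / 2)) (n := Real.pi / 2) hderiv hint_im]
    · ring
    · exact (Real.tendsto_arctan_atBot.mono_right nhdsWithin_le_nhds).comp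
        (tendsto_sinh_atBot.atBot_div_const hs)
    · exact (Real.tendsto_arctan_atTop.mono_right nhdsWithin_le_nhds).comp
        (tendsto_sinh_atTop.atTop_div_const hs)
  refine Complex.ext ?_ ?_
  · rw [hre]; simp
  · rw [hval]; simp

/-- Shift of the contour of integration across a strip free of singularities. -/
theorem integral_eq_integral_add_mul_I {h : ℂ → ℂ} {y : ℝ} (hy : 0 ≤ y)
    (hd : ∀ z : ℂ, 0 ≤ z.im → z.im ≤ y → DifferentiableAt ℂ h z)
    {b : ℝ → ℝ} (hb : Tendsto b atTop (𝓝 0))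
    (hhb : ∀ᶠ T in atTop, ∀ z : ℂ, 0 ≤ z.im → z.im ≤ y → |z.re| = T → ‖h z‖ ≤ b T)
    (h0 : Integrable fun x : ℝ => h x) (h1 : Integrable fun x : ℝ => h (x + y * I)) :
    ∫ x : ℝ, h x = ∫ x : ℝ, h (x + y * I) := by
  have hrect : ∀ T : ℝ, (∫ x : ℝ in (-T)..T, h x) - (∫ x : ℝ in (-T)..T, h (x + y * I)) =
      I • (∫ t : ℝ in (0:ℝ)..y, h ((-T : ℝ) + t * I)) - I • (∫ t : ℝ in (0:ℝ)..y, h (T + t * I)) := by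
    intro T
    have := integral_boundary_rect_eq_zero_of_differentiableOn h (((-T : ℝ) : ℂ))
      ((T : ℂ) + y * I) (fun z hz => ?_)
    · simp only [ofReal_re, ofReal_im, add_re, add_im, mul_re, mul_im, I_re, I_im, mul_zero,
        mul_one, sub_zero, add_zero, zero_add, ofReal_zero, zero_mul] at this
      linear_combination this
    · have him := hz.2
      simp only [ofReal_im, add_im, mul_im, I_re, I_im, mul_zero, mul_one, ofReal_re, add_zero,
        zero_add, Set.mem_preimage, Set.uIcc_of_le hy] at him
      exact (hd z him.1 him.2).differentiableWithinAt
  have hside : ∀ σ : ℝ, |σ| = 1 →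
      Tendsto (fun T : ℝ => ∫ t : ℝ in (0:ℝ)..y, h ((σ * T : ℝ) + t * I)) atTop (𝓝 0) := by
    intro σ hσ
    refine squeeze_zero_norm' (a := fun T => b T * |y - 0|) ?_ (by simpa using hb.mul_const |y - 0|)
    filter_upwards [hhb, eventually_ge_atTop 0] with T hT hT0
    refine intervalIntegral.norm_integral_le_of_norm_le_const fun t ht => ?_
    rw [Set.uIoc_of_le hy] at ht
    refine hT _ ?_ ?_ ?_
    · simpa using ht.1.le
    · simpa using ht.2
    · simp [abs_mul, hσ, abs_of_nonneg hT0]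
  have l0 := intervalIntegral_tendsto_integral h0 tendsto_neg_atTop_atBot tendsto_id
  have l1 := intervalIntegral_tendsto_integral h1 tendsto_neg_atTop_atBot tendsto_id
  have l2 := l0.sub l1
  have l3 := ((hside (-1) (by simp)).const_smul I).sub ((hside 1 (by simp)).const_smul I)
  have l4 := tendsto_nhds_unique l2 (l3.congr fun T => ?_)
  · rwa [smul_zero, sub_zero, sub_eq_zero] at l4
  · rw [id, hrect T]; simp

/-- Riemann's removable singularity theorem, in the form needed after the principal parts are
subtracted. -/
theorem exists_differentiableAt_update {g : ℂ → ℂ} {p : ℂ}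
    (hd : ∀ᶠ z in 𝓝[≠] p, DifferentiableAt ℂ g z)
    (h0 : Tendsto (fun z => (z - p) * g z) (𝓝[≠] p) (𝓝 0)) :
    ∃ l, DifferentiableAt ℂ (Function.update g p l) p := by
  have ho : (fun z => g z - g p) =o[𝓝[≠] p] fun z => (z - p)⁻¹ := by
    refine (Asymptotics.isLittleO_iff_tendsto' ?_).2 ?_
    · filter_upwards [self_mem_nhdsWithin] with z hz h
      exact absurd h (inv_ne_zero (sub_ne_zero.2 hz))
    · have h1 : Tendsto (fun z => (z - p) * g p) (𝓝[≠] p) (𝓝 0) := by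
        have : Tendsto (fun z => (z - p) * g p) (𝓝 p) (𝓝 ((p - p) * g p)) :=
          Continuous.tendsto (by fun_prop) p
        rw [sub_self, zero_mul] at this
        exact this.mono_left nhdsWithin_le_nhds
      have h2 := h0.sub h1
      rw [sub_zero] at h2
      refine h2.congr fun z => ?_
      rw [div_inv_eq_mul]; ring
  have ht := tendsto_limUnder_of_differentiable_on_punctured_nhds_of_isLittleO hd ho
  refine ⟨limUnder (𝓝[≠] p) g, ?_⟩
  refine (analyticAt_of_differentiable_on_punctured_nhds_of_continuousAt ?_
    (continuousAt_update_same.2 ht)).differentiableAt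
  filter_upwards [hd, self_mem_nhdsWithin] with z hz hzp
  refine hz.congr_of_eventuallyEq ?_
  filter_upwards [isOpen_ne.mem_nhds hzp] with w hw
  exact Function.update_of_ne hw _ _

theorem tendsto_sub_mul_inv_sinh_sub (p : ℂ) :
    Tendsto (fun z => (z - p) * (sinh (z - p))⁻¹) (𝓝[≠] p) (𝓝 1) := by
  have hd : HasDerivAt (fun z : ℂ => sinh (z - p)) 1 p := by
    have := ((hasDerivAt_id p).sub_const p).csinh
    simpa using this
  have := (hd.tendsto_slope).inv₀ one_ne_zero
  rw [inv_one] at this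
  refine this.congr fun z => ?_
  rw [slope_def_field, sub_self, sinh_zero, sub_zero, inv_div, div_eq_mul_inv]

theorem sinh_sub_ne_zero {z p : ℂ} (hz : 0 ≤ z.im) (hz' : z.im ≤ Real.pi)
    (hp : 0 < p.im) (hp' : p.im < Real.pi) (hzp : z ≠ p) : sinh (z - p) ≠ 0 := by
  intro h
  have hn := norm_sinh_sq (z - p)
  rw [h, norm_zero, sub_im, sub_re] at hn
  have h1 : Real.sinh (z.re - p.re) = 0 := by
    nlinarith [sq_nonneg (Real.sin (z.im - p.im)),
      sq_nonneg (Real.sinh (z.re - p.re))]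
  have h2 : Real.sin (z.im - p.im) = 0 := by
    nlinarith [sq_nonneg (Real.sin (z.im - p.im)),
      sq_nonneg (Real.sinh (z.re - p.re))]
  have h3 := (Real.sin_eq_zero_iff_of_lt_of_lt (by linarith) (by linarith)).1 h2
  have h4 := Real.sinh_eq_zero.1 h1
  exact hzp (Complex.ext (by linarith) (by linarith))

theorem norm_inv_sinh_sub_le {z p : ℂ} (h : |p.re| < |z.re|) :
    ‖(sinh (z - p))⁻¹‖ ≤ (Real.sinh (|z.re| - |p.re|))⁻¹ := by
  rw [norm_inv]
  refine inv_anti₀ (Real.sinh_pos_iff.2 (by linarith)) ?_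
  refine le_trans ?_ (abs_sinh_re_le_norm_sinh _)
  rw [Real.abs_sinh, Real.sinh_le_sinh, sub_re]
  exact abs_sub_abs_le_abs_sub _ _

/-- The residue theorem on the strip `0 ≤ Im z ≤ π`, for two simple poles. -/
theorem integral_sub_integral_add_pi_mul_I {f : ℂ → ℂ} {p₁ p₂ c₁ c₂ : ℂ}
    (hp₁ : 0 < p₁.im) (hp₁' : p₁.im < Real.pi) (hp₂ : 0 < p₂.im) (hp₂' : p₂.im < Real.pi)
    (hne : p₁ ≠ p₂)
    (hd : ∀ z : ℂ, 0 ≤ z.im → z.im ≤ Real.pi → z ≠ p₁ → z ≠ p₂ → DifferentiableAt ℂ f z)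
    (h₁ : Tendsto (fun z => (z - p₁) * f z) (𝓝[≠] p₁) (𝓝 c₁))
    (h₂ : Tendsto (fun z => (z - p₂) * f z) (𝓝[≠] p₂) (𝓝 c₂))
    {b : ℝ → ℝ} (hb : Tendsto b atTop (𝓝 0))
    (hfb : ∀ᶠ T in atTop, ∀ z : ℂ, 0 ≤ z.im → z.im ≤ Real.pi → |z.re| = T → ‖f z‖ ≤ b T)
    (hi₀ : Integrable fun x : ℝ => f x) (hi₁ : Integrable fun x : ℝ => f (x + Real.pi * I)) :
    (∫ x : ℝ, f x) - ∫ x : ℝ, f (x + Real.pi * I) = 2 * Real.pi * I * (c₁ + c₂) := by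
  -- The functions 1/sinh(z - pᵢ) carry the poles: each has residue 1, no other pole in the strip,
  -- decay at both ends, and a known integral.
  set g : ℂ → ℂ := fun z => f z - (c₁ * (sinh (z - p₁))⁻¹ + c₂ * (sinh (z - p₂))⁻¹) with hg
  have hgd : ∀ z : ℂ, 0 ≤ z.im → z.im ≤ Real.pi → z ≠ p₁ → z ≠ p₂ → DifferentiableAt ℂ g z := by
    intro z hz hz' hz1 hz2
    have s1 := sinh_sub_ne_zero hz hz' hp₁ hp₁' hz1
    have s2 := sinh_sub_ne_zero hz hz' hp₂ hp₂' hz2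
    have d1 : DifferentiableAt ℂ (fun z => (sinh (z - p₁))⁻¹) z :=
      DifferentiableAt.inv (by fun_prop) s1
    have d2 : DifferentiableAt ℂ (fun z => (sinh (z - p₂))⁻¹) z :=
      DifferentiableAt.inv (by fun_prop) s2
    exact (hd z hz hz' hz1 hz2).sub ((d1.const_mul c₁).add (d2.const_mul c₂))
  have hstrip : ∀ p : ℂ, 0 < p.im → p.im < Real.pi →
      ∀ᶠ z in 𝓝 p, 0 ≤ z.im ∧ z.im ≤ Real.pi := by
    intro p hp hp'
    have := (continuous_im.tendsto p).eventually (Ioo_mem_nhds hp hp')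
    exact this.mono fun z hz => ⟨hz.1.le, hz.2.le⟩
  have hpunct : ∀ p q : ℂ, 0 < p.im → p.im < Real.pi → p ≠ q →
      ∀ᶠ z in 𝓝[≠] p, (0 ≤ z.im ∧ z.im ≤ Real.pi) ∧ z ≠ p ∧ z ≠ q := by
    intro p q hp hp' hpq
    filter_upwards [nhdsWithin_le_nhds (hstrip p hp hp'), self_mem_nhdsWithin,
      nhdsWithin_le_nhds (isOpen_ne.mem_nhds hpq)] with z hz hz1 hz2
    exact ⟨hz, hz1, hz2⟩
  have hother : ∀ (p q : ℂ), 0 < p.im → p.im < Real.pi → 0 < q.im → q.im < Real.pi → p ≠ q →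
      Tendsto (fun z => (z - p) * (sinh (z - q))⁻¹) (𝓝[≠] p) (𝓝 0) := by
    intro p q hp hp' hq hq' hpq
    have hc : ContinuousAt (fun z => (z - p) * (sinh (z - q))⁻¹) p :=
      ContinuousAt.mul (by fun_prop) (ContinuousAt.inv₀ (by fun_prop)
        (sinh_sub_ne_zero hp.le hp'.le hq hq' hpq))
    have := hc.tendsto
    rw [sub_self, zero_mul] at this
    exact this.mono_left nhdsWithin_le_nhds
  have t₁ : Tendsto (fun z => (z - p₁) * g z) (𝓝[≠] p₁) (𝓝 0) := by
    have := h₁.sub (((tendsto_sub_mul_inv_sinh_sub p₁).const_mul c₁).add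
      ((hother p₁ p₂ hp₁ hp₁' hp₂ hp₂' hne).const_mul c₂))
    rw [mul_one, mul_zero, add_zero, sub_self] at this
    refine this.congr fun z => ?_
    simp only [hg]; ring
  have t₂ : Tendsto (fun z => (z - p₂) * g z) (𝓝[≠] p₂) (𝓝 0) := by
    have := h₂.sub (((hother p₂ p₁ hp₂ hp₂' hp₁ hp₁' hne.symm).const_mul c₁).add
      ((tendsto_sub_mul_inv_sinh_sub p₂).const_mul c₂))
    rw [mul_one, mul_zero, zero_add, sub_self] at this
    refine this.congr fun z => ?_
    simp only [hg]; ring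
  obtain ⟨l₁, hl₁⟩ := exists_differentiableAt_update (g := g) (p := p₁)
    ((hpunct p₁ p₂ hp₁ hp₁' hne).mono fun z hz => hgd z hz.1.1 hz.1.2 hz.2.1 hz.2.2) t₁
  obtain ⟨l₂, hl₂⟩ := exists_differentiableAt_update (g := g) (p := p₂)
    ((hpunct p₂ p₁ hp₂ hp₂' hne.symm).mono fun z hz => hgd z hz.1.1 hz.1.2 hz.2.2 hz.2.1) t₂
  set h : ℂ → ℂ := Function.update (Function.update g p₁ l₁) p₂ l₂ with hh
  have hhg : ∀ z, z ≠ p₁ → z ≠ p₂ → h z = g z := fun z hz1 hz2 => by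
    rw [hh, Function.update_of_ne hz2, Function.update_of_ne hz1]
  have hhd : ∀ z : ℂ, 0 ≤ z.im → z.im ≤ Real.pi → DifferentiableAt ℂ h z := by
    intro z hz hz'
    by_cases hz1 : z = p₁
    · rw [hz1]
      refine hl₁.congr_of_eventuallyEq ?_
      filter_upwards [isOpen_ne.mem_nhds hne] with w hw
      rw [hh, Function.update_of_ne hw]
    by_cases hz2 : z = p₂
    · rw [hz2]
      refine hl₂.congr_of_eventuallyEq ?_
      filter_upwards [isOpen_ne.mem_nhds hne.symm] with w hw
      by_cases hw2 : w = p₂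
      · rw [hh, hw2, Function.update_self, Function.update_self]
      · rw [hhg w hw hw2, Function.update_of_ne hw2]
    · refine (hgd z hz hz' hz1 hz2).congr_of_eventuallyEq ?_
      filter_upwards [isOpen_ne.mem_nhds hz1, isOpen_ne.mem_nhds hz2] with w hw1 hw2
      exact hhg w hw1 hw2
  have hreal : ∀ (x : ℝ), h x = f x - (c₁ * (sinh (x - p₁))⁻¹ + c₂ * (sinh (x - p₂))⁻¹) := by
    intro x
    refine hhg x ?_ ?_
    · rintro rfl; simp at hp₁
    · rintro rfl; simp at hp₂
  -- By this antiperiodicity the two sides of the strip contribute πi each, so every pole yields 2πi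
  -- times its residue.
  have hsh : ∀ (x : ℝ) (p : ℂ), sinh ((x + Real.pi * I : ℂ) - p) = -sinh (x - p) := by
    intro x p
    rw [show (x + Real.pi * I : ℂ) - p = (x - p) + Real.pi * I by ring, sinh_add, cosh_mul_I,
      sinh_mul_I]
    simp
  have hreal' : ∀ (x : ℝ), h (x + Real.pi * I) = f (x + Real.pi * I)
      + (c₁ * (sinh (x - p₁))⁻¹ + c₂ * (sinh (x - p₂))⁻¹) := by
    intro x
    rw [hhg]
    · simp only [hg, hsh, inv_neg]; ring
    · rintro rfl; simp at hp₁'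
    · rintro rfl; simp at hp₂'
  have i₁ := (integrable_inv_sinh_sub hp₁ hp₁').const_mul c₁
  have i₂ := (integrable_inv_sinh_sub hp₂ hp₂').const_mul c₂
  have i₁₂ : Integrable fun x : ℝ => c₁ * (sinh (x - p₁))⁻¹ + c₂ * (sinh (x - p₂))⁻¹ := i₁.add i₂
  have hinv : ∀ p : ℂ, Tendsto (fun T : ℝ => (Real.sinh (T - |p.re|))⁻¹) atTop (𝓝 0) := fun p =>
    tendsto_inv_atTop_zero.comp (tendsto_sinh_atTop.comp (tendsto_atTop_add_const_right _ _
      tendsto_id))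
  have key := integral_eq_integral_add_mul_I (h := h) Real.pi_pos.le hhd
    (b := fun T => b T + (‖c₁‖ * (Real.sinh (T - |p₁.re|))⁻¹ + ‖c₂‖ * (Real.sinh (T - |p₂.re|))⁻¹))
    (by simpa using hb.add (((hinv p₁).const_mul ‖c₁‖).add ((hinv p₂).const_mul ‖c₂‖))) ?_ ?_ ?_
  · simp only [hreal, hreal'] at key
    rw [integral_sub hi₀ i₁₂, integral_add hi₁ i₁₂, integral_add i₁ i₂,
      integral_const_mul, integral_const_mul, integral_inv_sinh_sub hp₁ hp₁',
      integral_inv_sinh_sub hp₂ hp₂'] at key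
    linear_combination key
  · filter_upwards [hfb, eventually_gt_atTop |p₁.re|, eventually_gt_atTop |p₂.re|]
      with T hT hT1 hT2 z hz hz' hzT
    rw [hhg z]
    · refine (norm_sub_le _ _).trans (add_le_add (hT z hz hz' hzT) ((norm_add_le _ _).trans ?_))
      rw [norm_mul, norm_mul]
      have n1 := norm_inv_sinh_sub_le (z := z) (p := p₁) (by rw [hzT]; exact hT1)
      have n2 := norm_inv_sinh_sub_le (z := z) (p := p₂) (by rw [hzT]; exact hT2)
      rw [hzT] at n1 n2
      gcongr
    · rintro rfl; exact hT1.ne hzT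
    · rintro rfl; exact hT2.ne hzT
  · simp only [hreal]; exact hi₀.sub i₁₂
  · simp only [hreal']; exact hi₁.add i₁₂

end
end MelnikovQP

/-! ### Singularities of `β` and integration by parts in its Fourier transform. -/

namespace MelnikovQP

noncomputable section

open Filter Topology MeasureTheory Complex

theorem norm_sinh_rhoMinus {α : ℝ} {ρ : ℂ} (h0 : 0 < α) (h1 : α < 1) (hρ : IsRhoMinus α ρ) :
    ‖sinh ρ‖ = 1 := by
  have hs : 0 ≤ 1 - α ^ 2 := by nlinarith
  have : ‖sinh ρ‖ ^ 2 = 1 := by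
    rw [hρ.1, mul_comm I, Complex.sq_norm, normSq_add_mul_I, Real.sq_sqrt hs]; ring
  nlinarith [norm_nonneg (sinh ρ)]

theorem cosh_rhoMinus_sq {α : ℝ} {ρ : ℂ} (h0 : 0 < α) (h1 : α < 1) (hρ : IsRhoMinus α ρ) :
    cosh ρ ^ 2 = 2 * α * sinh ρ := by
  have hs : 0 ≤ 1 - α ^ 2 := by nlinarith
  have h2 : ((Real.sqrt (1 - α ^ 2) : ℝ) : ℂ) ^ 2 = 1 - (α : ℂ) ^ 2 := by
    rw [← ofReal_pow, Real.sq_sqrt hs]; push_cast; ring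
  rw [cosh_sq, hρ.1]
  linear_combination I ^ 2 * h2 + (1 - (α : ℂ) ^ 2) * I_sq

theorem norm_cosh_rhoMinus_sq {α : ℝ} {ρ : ℂ} (h0 : 0 < α) (h1 : α < 1) (hρ : IsRhoMinus α ρ) :
    ‖cosh ρ‖ ^ 2 = 2 * α := by
  rw [← norm_pow, cosh_rhoMinus_sq h0 h1 hρ, norm_mul, norm_sinh_rhoMinus h0 h1 hρ, norm_mul,
    norm_real, Real.norm_of_nonneg h0.le]
  simp

theorem sin_im_rhoMinus_sq {α : ℝ} {ρ : ℂ} (h0 : 0 < α) (h1 : α < 1) (hρ : IsRhoMinus α ρ) :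
    Real.sin ρ.im ^ 2 = 1 - α := by
  have a := norm_cosh_sq ρ
  have b := norm_sinh_sq ρ
  rw [norm_cosh_rhoMinus_sq h0 h1 hρ] at a
  rw [norm_sinh_rhoMinus h0 h1 hρ] at b
  have := Real.sin_sq_add_cos_sq ρ.im
  linarith

theorem sinh_re_rhoMinus_sq {α : ℝ} {ρ : ℂ} (h0 : 0 < α) (h1 : α < 1) (hρ : IsRhoMinus α ρ) :
    Real.sinh ρ.re ^ 2 = α := by
  have b := norm_sinh_sq ρ
  rw [norm_sinh_rhoMinus h0 h1 hρ, sin_im_rhoMinus_sq h0 h1 hρ] at b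
  linarith

/-- The right side still makes sense at α = 0, where it equals π/2; the bounds for small α are
stated with it. -/
theorem im_rhoMinus {α : ℝ} {ρ : ℂ} (h0 : 0 < α) (h1 : α < 1) (hρ : IsRhoMinus α ρ) :
    ρ.im = Real.arcsin (Real.sqrt (1 - α)) := by
  have hpos : 0 < Real.sin ρ.im :=
    Real.sin_pos_of_pos_of_lt_pi hρ.2.1 (by linarith [hρ.2.2, Real.pi_pos])
  rw [← sin_im_rhoMinus_sq h0 h1 hρ, Real.sqrt_sq hpos.le,
    Real.arcsin_sin (by linarith [hρ.2.1, Real.pi_pos]) hρ.2.2.le]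

/-- The denominator of `β`, squared in `β`. -/
def den (α : ℝ) (z : ℂ) : ℂ := cosh z ^ 2 - 2 * α * sinh z

/-- As a polynomial in sinh z, `den` has the roots α ± i√(1 - α²). On the strip Im sinh z ≥ 0
excludes the lower one, and sinh z = sinh ρ is solved with sinh z - sinh ρ = 2 sinh((z - ρ)/2)
cosh((z + ρ)/2). -/
theorem den_eq_zero_iff {α : ℝ} {ρ : ℂ} (h0 : 0 < α) (h1 : α < 1) (hρ : IsRhoMinus α ρ)
    {z : ℂ} (hz : 0 ≤ z.im) (hz' : z.im ≤ Real.pi) (h : den α z = 0) :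
    z = ρ ∨ z = Real.pi * I - ρ := by
  have hs : 0 < 1 - α ^ 2 := by nlinarith
  have hs' := Real.sqrt_pos.2 hs
  have h2 : ((Real.sqrt (1 - α ^ 2) : ℝ) : ℂ) ^ 2 = 1 - (α : ℂ) ^ 2 := by
    rw [← ofReal_pow, Real.sq_sqrt hs.le]; push_cast; ring
  have hfac : (sinh z - sinh ρ) * (sinh z - (α - I * (Real.sqrt (1 - α ^ 2) : ℝ))) = 0 := by
    rw [hρ.1, ← h, den, cosh_sq]
    linear_combination (-I ^ 2) * h2 - (1 - (α : ℂ) ^ 2) * I_sq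
  have him : 0 ≤ (sinh z).im := by
    rw [sinh_parts]
    simp only [add_im, ofReal_im, I_mul_im, ofReal_re, zero_add]
    exact mul_nonneg (Real.cosh_pos _).le (Real.sin_nonneg_of_nonneg_of_le_pi hz hz')
  rcases mul_eq_zero.1 hfac with h3 | h3
  · have h4 : sinh ((z - ρ) / 2) * cosh ((z + ρ) / 2) = 0 := by
      have e1 : z = (z - ρ) / 2 + (z + ρ) / 2 := by ring
      have e2 : ρ = (z + ρ) / 2 - (z - ρ) / 2 := by ring
      have e3 : sinh z - sinh ρ = 2 * (sinh ((z - ρ) / 2) * cosh ((z + ρ) / 2)) := by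
        have e4 := sinh_add ((z - ρ) / 2) ((z + ρ) / 2)
        have e5 := sinh_sub ((z + ρ) / 2) ((z - ρ) / 2)
        rw [← e1] at e4
        rw [← e2] at e5
        rw [e4, e5]; ring
      rw [e3] at h3
      simpa using h3
    have hre : ∀ w : ℂ, (w / 2).re = w.re / 2 := fun w => by
      rw [show w / 2 = w / ((2 : ℝ) : ℂ) by norm_num, div_ofReal_re]
    have him2 : ∀ w : ℂ, (w / 2).im = w.im / 2 := fun w => by
      rw [show w / 2 = w / ((2 : ℝ) : ℂ) by norm_num, div_ofReal_im]
    have hpi := Real.pi_pos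
    obtain ⟨-, hρ0, hρ1⟩ := hρ
    rcases mul_eq_zero.1 h4 with h5 | h5
    · left
      have hn := norm_sinh_sq ((z - ρ) / 2)
      rw [h5, norm_zero, hre, him2] at hn
      have q1 : Real.sinh ((z - ρ).re / 2) = 0 := by
        nlinarith [sq_nonneg (Real.sinh ((z - ρ).re / 2)), sq_nonneg (Real.sin ((z - ρ).im / 2))]
      have q2 : Real.sin ((z - ρ).im / 2) = 0 := by
        nlinarith [sq_nonneg (Real.sinh ((z - ρ).re / 2)), sq_nonneg (Real.sin ((z - ρ).im / 2))]
      rw [sub_im] at q2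
      rw [sub_re] at q1
      have q3 := (Real.sin_eq_zero_iff_of_lt_of_lt (by linarith) (by linarith)).1 q2
      have q4 := Real.sinh_eq_zero.1 q1
      exact Complex.ext (by linarith) (by linarith)
    · right
      have hn := norm_cosh_sq ((z + ρ) / 2)
      rw [h5, norm_zero, hre, him2] at hn
      have q1 : Real.sinh ((z + ρ).re / 2) = 0 := by
        nlinarith [sq_nonneg (Real.sinh ((z + ρ).re / 2)), sq_nonneg (Real.cos ((z + ρ).im / 2))]
      have q2 : Real.cos ((z + ρ).im / 2) = 0 := by
        nlinarith [sq_nonneg (Real.sinh ((z + ρ).re / 2)), sq_nonneg (Real.cos ((z + ρ).im / 2))]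
      rw [add_im, ← Real.sin_pi_div_two_sub] at q2
      rw [add_re] at q1
      have q3 := (Real.sin_eq_zero_iff_of_lt_of_lt (by linarith) (by linarith)).1 q2
      have q4 := Real.sinh_eq_zero.1 q1
      refine Complex.ext ?_ ?_
      · simp; linarith
      · simp; linarith
  · exfalso
    rw [sub_eq_zero.1 h3] at him
    simp at him
    linarith

theorem den_ofReal (α x : ℝ) :
    den α x = ((Real.cosh x ^ 2 - 2 * α * Real.sinh x : ℝ) : ℂ) := by
  rw [den]; push_cast; rfl

/-- The difference of the two sides is α (sinh x - 1)². -/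
theorem den_real_ge {α : ℝ} (h0 : 0 ≤ α) (x : ℝ) :
    (1 - α) * Real.cosh x ^ 2 ≤ Real.cosh x ^ 2 - 2 * α * Real.sinh x := by
  have := Real.cosh_sq x
  nlinarith [sq_nonneg (Real.sinh x - 1)]

theorem den_real_pos {α : ℝ} (h0 : 0 ≤ α) (h1 : α < 1) (x : ℝ) :
    0 < Real.cosh x ^ 2 - 2 * α * Real.sinh x :=
  lt_of_lt_of_le (mul_pos (by linarith) (pow_pos (Real.cosh_pos x) 2)) (den_real_ge h0 x)

theorem abs_sinh_le_cosh (x : ℝ) : |Real.sinh x| ≤ Real.cosh x := by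
  refine abs_le_of_sq_le_sq ?_ (Real.cosh_pos x).le
  rw [Real.cosh_sq]; linarith

theorem continuous_β {α : ℝ} (h0 : 0 ≤ α) (h1 : α < 1) : Continuous (β α) := by
  unfold β
  refine Continuous.div (by fun_prop) (by fun_prop) fun x => ?_
  exact pow_ne_zero _ (den_real_pos h0 h1 x).ne'

theorem abs_β_le {α : ℝ} (h0 : 0 ≤ α) (h1 : α < 1) (x : ℝ) :
    |β α x| ≤ ((1 - α) ^ 2)⁻¹ * (Real.cosh x)⁻¹ := by
  have hc := Real.one_le_cosh x
  have hcp := Real.cosh_pos x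
  have h1' : 0 < 1 - α := by linarith
  have hd := den_real_ge h0 x
  have hdp := den_real_pos h0 h1 x
  rw [β, abs_div, abs_mul, abs_of_pos hcp, abs_of_pos (pow_pos hdp 2), ← mul_inv,
    div_le_iff₀ (pow_pos hdp 2), ← div_eq_inv_mul, le_div_iff₀ (by positivity)]
  calc |Real.sinh x| * Real.cosh x * ((1 - α) ^ 2 * Real.cosh x)
      ≤ Real.cosh x * Real.cosh x * ((1 - α) ^ 2 * Real.cosh x) := by
        gcongr; exact abs_sinh_le_cosh x
    _ ≤ Real.cosh x * Real.cosh x * ((1 - α) ^ 2 * (Real.cosh x * Real.cosh x)) := by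
        gcongr; nlinarith
    _ = ((1 - α) * Real.cosh x ^ 2) ^ 2 := by ring
    _ ≤ _ := by gcongr

theorem integrable_β {α : ℝ} (h0 : 0 ≤ α) (h1 : α < 1) : Integrable (β α) :=
  (integrable_inv_cosh.const_mul _).mono' (continuous_β h0 h1).aestronglyMeasurable
    (Eventually.of_forall fun x => abs_β_le h0 h1 x)

/-- The Fourier transform of `β`. -/
def bhat (α w : ℝ) : ℂ := ∫ x : ℝ, (β α x : ℂ) * exp (I * (w * x))

theorem norm_exp_I_mul_mul (w x : ℝ) : ‖exp (I * (w * x))‖ = 1 := by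
  rw [mul_comm, ← ofReal_mul, norm_exp_ofReal_mul_I]

theorem integrable_β_mul_exp {α : ℝ} (h0 : 0 ≤ α) (h1 : α < 1) (w : ℝ) :
    Integrable fun x : ℝ => (β α x : ℂ) * exp (I * (w * x)) := by
  refine (integrable_β h0 h1).ofReal.mul_bdd (c := 1) (Continuous.aestronglyMeasurable (by fun_prop))
    (Eventually.of_forall fun x => ?_)
  rw [norm_exp_I_mul_mul]

theorem bhat_neg (α w : ℝ) : bhat α (-w) = (starRingEnd ℂ) (bhat α w) := by
  rw [bhat, bhat, ← integral_conj]
  congr 1; ext x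
  rw [map_mul, conj_ofReal, ← exp_conj]
  simp

theorem norm_bhat_abs (α w : ℝ) : ‖bhat α |w|‖ = ‖bhat α w‖ := by
  rcases abs_choice w with h | h
  · rw [h]
  · rw [h, bhat_neg, norm_conj]

/-- The integrand obtained from `β` by integration by parts. -/
def kernel (α w : ℝ) (z : ℂ) : ℂ :=
  (-(I * w) * (α * sinh z - 1) + α * cosh z) / (2 * (1 - α ^ 2) * den α z) * exp (I * (w * z))

theorem norm_kernel_ofReal_le {α : ℝ} (h0 : 0 ≤ α) (h1 : α < 1) (w x : ℝ) :
    ‖kernel α w x‖ ≤ (2 * |w| + 1) / (2 * (1 - α ^ 2) * (1 - α)) * (Real.cosh x)⁻¹ := by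
  have hs : 0 < 1 - α ^ 2 := by nlinarith
  have h1' : 0 < 1 - α := by linarith
  have hc := Real.one_le_cosh x
  have hcp := Real.cosh_pos x
  have hd := den_real_ge h0 x
  have hdp := den_real_pos h0 h1 x
  rw [kernel, norm_mul, norm_exp_I_mul_mul, mul_one, norm_div, den_ofReal]
  have e : (2 * (1 - (α : ℂ) ^ 2) * ((Real.cosh x ^ 2 - 2 * α * Real.sinh x : ℝ) : ℂ))
      = ((2 * (1 - α ^ 2) * (Real.cosh x ^ 2 - 2 * α * Real.sinh x) : ℝ) : ℂ) := by push_cast; rfl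
  have hnum : ‖(-(I * w) * (α * sinh (x : ℂ) - 1) + α * cosh (x : ℂ))‖
      ≤ (2 * |w| + 1) * Real.cosh x := by
    refine (norm_add_le _ _).trans ?_
    have e1 : (α * sinh (x : ℂ) - 1 : ℂ) = ((α * Real.sinh x - 1 : ℝ) : ℂ) := by push_cast; rfl
    have e2 : (α * cosh (x : ℂ) : ℂ) = ((α * Real.cosh x : ℝ) : ℂ) := by push_cast; rfl
    rw [e1, e2, norm_mul, norm_neg, norm_mul, norm_I, norm_real, norm_real, norm_real,
      Real.norm_eq_abs, Real.norm_eq_abs, Real.norm_eq_abs, abs_of_nonneg (mul_nonneg h0 hcp.le)]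
    have a1 : |α * Real.sinh x - 1| ≤ 2 * Real.cosh x := by
      refine (abs_sub _ _).trans ?_
      rw [abs_mul, abs_of_nonneg h0, abs_one]
      have := abs_sinh_le_cosh x
      nlinarith [abs_nonneg (Real.sinh x)]
    nlinarith [mul_le_mul_of_nonneg_left a1 (abs_nonneg w)]
  rw [e, norm_real, Real.norm_of_nonneg (by positivity)]
  calc _ ≤ (2 * |w| + 1) * Real.cosh x / (2 * (1 - α ^ 2) * ((1 - α) * Real.cosh x ^ 2)) := by
        gcongr
    _ = _ := by field_simp

theorem continuous_kernel_ofReal {α : ℝ} (h0 : 0 ≤ α) (h1 : α < 1) (w : ℝ) :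
    Continuous fun x : ℝ => kernel α w x := by
  have hs : (1 - (α : ℂ) ^ 2) ≠ 0 := by
    rw [← ofReal_pow, ← ofReal_one, ← ofReal_sub]
    exact ofReal_ne_zero.2 (by nlinarith)
  unfold kernel
  refine Continuous.mul (Continuous.div (by fun_prop) ?_ fun x => ?_) (by fun_prop)
  · unfold den; fun_prop
  · rw [den_ofReal]
    exact mul_ne_zero (mul_ne_zero two_ne_zero hs) (ofReal_ne_zero.2 (den_real_pos h0 h1 x).ne')

theorem integrable_kernel_ofReal {α : ℝ} (h0 : 0 ≤ α) (h1 : α < 1) (w : ℝ) :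
    Integrable fun x : ℝ => kernel α w x :=
  (integrable_inv_cosh.const_mul _).mono' (continuous_kernel_ofReal h0 h1 w).aestronglyMeasurable
    (Eventually.of_forall fun x => norm_kernel_ofReal_le h0 h1 w x)

/-- The function u below satisfies β = u' + α cosh / (2(1 - α²) den). Integrating u' by parts leaves
an integrand with only the first power of `den`, so its poles are simple when 0 < α < 1. -/
theorem bhat_eq_integral_kernel {α : ℝ} (h0 : 0 ≤ α) (h1 : α < 1) (w : ℝ) :
    bhat α w = ∫ x : ℝ, kernel α w x := by
  have hs : 0 < 1 - α ^ 2 := by nlinarith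
  set u : ℝ → ℝ := fun x => (α * Real.sinh x - 1) / (2 * (1 - α ^ 2) *
    (Real.cosh x ^ 2 - 2 * α * Real.sinh x)) with hu
  set u' : ℝ → ℝ := fun x => β α x - α * Real.cosh x / (2 * (1 - α ^ 2) *
    (Real.cosh x ^ 2 - 2 * α * Real.sinh x)) with hu'
  have hdu : ∀ x, HasDerivAt u (u' x) x := by
    intro x
    have hdp := den_real_pos h0 h1 x
    have hn : HasDerivAt (fun x => α * Real.sinh x - 1) (α * Real.cosh x) x :=
      ((Real.hasDerivAt_sinh x).const_mul α).sub_const 1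
    have hd : HasDerivAt (fun x => 2 * (1 - α ^ 2) * (Real.cosh x ^ 2 - 2 * α * Real.sinh x))
        (2 * (1 - α ^ 2) * (2 * Real.cosh x * Real.sinh x - 2 * α * Real.cosh x)) x := by
      have := (((Real.hasDerivAt_cosh x).pow 2).sub ((Real.hasDerivAt_sinh x).const_mul
        (2 * α))).const_mul (2 * (1 - α ^ 2))
      exact this.congr_deriv (by norm_num)
    have := hn.div hd (by positivity)
    refine this.congr_deriv ?_
    rw [hu']
    simp only [β]
    have hc2 := Real.cosh_sq x
    field_simp
    rw [hc2]
    ring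
  have hexp : ∀ x : ℝ, HasDerivAt (fun x : ℝ => exp (I * (w * x))) (exp (I * (w * x)) * (I * w)) x := by
    intro x
    have : HasDerivAt (fun x : ℝ => I * ((w : ℂ) * (x : ℂ))) (I * w) x := by
      have := ((hasDerivAt_id x).ofReal_comp.const_mul (w : ℂ)).const_mul I
      simpa using this
    exact this.cexp
  have hduv : ∀ x : ℝ, HasDerivAt (fun x : ℝ => (u x : ℂ) * exp (I * (w * x)))
      ((β α x : ℂ) * exp (I * (w * x)) - kernel α w x) x := by
    intro x
    have := (hdu x).ofReal_comp.mul (hexp x)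
    refine this.congr_deriv ?_
    rw [hu, hu', kernel, den_ofReal]
    push_cast
    ring
  have hint : Integrable fun x : ℝ => (u x : ℂ) * exp (I * (w * x)) := by
    -- Integrability of u comes from the kernels at w = 1 and w = 0: once the phase is removed from
    -- the first, their difference is -iu.
    have hk := integrable_kernel_ofReal h0 h1 0
    have hk1 := integrable_kernel_ofReal h0 h1 1
    have hu1 : Integrable fun x : ℝ => (u x : ℂ) := by
      have hk2 : Integrable fun x : ℝ => kernel α 1 x * exp (-(I * ((1 : ℝ) * x))) := by
        refine hk1.mul_bdd (c := 1) (Continuous.aestronglyMeasurable (by fun_prop))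
          (Eventually.of_forall fun x => ?_)
        rw [← mul_neg, ← mul_neg, ← ofReal_neg, norm_exp_I_mul_mul]
      refine ((hk2.sub hk).const_mul I).congr (Eventually.of_forall fun x => ?_)
      · simp only [kernel, den_ofReal, hu]
        have : exp (I * ((1 : ℝ) * x)) * exp (-(I * ((1 : ℝ) * x))) = 1 := by
          rw [← exp_add, add_neg_cancel, exp_zero]
        simp only [Pi.sub_apply]
        rw [mul_assoc (_ / _), this]
        push_cast
        simp only [zero_mul, mul_zero, exp_zero, mul_one]
        linear_combination (-((α : ℂ) * sinh x - 1) / (2 * (1 - (α : ℂ) ^ 2) *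
          (cosh (x : ℂ) ^ 2 - 2 * α * sinh x))) * I_sq
    refine hu1.mul_bdd (c := 1) (Continuous.aestronglyMeasurable (by fun_prop))
      (Eventually.of_forall fun x => ?_)
    rw [norm_exp_I_mul_mul]
  have h3 := integral_eq_zero_of_hasDerivAt_of_integrable hduv
    ((integrable_β_mul_exp h0 h1 w).sub (integrable_kernel_ofReal h0 h1 w)) hint
  rw [integral_sub (integrable_β_mul_exp h0 h1 w) (integrable_kernel_ofReal h0 h1 w)] at h3
  exact sub_eq_zero.1 h3

end
end MelnikovQP

/-! ### The residue formula for the transform of `β`. -/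

namespace MelnikovQP

noncomputable section

open Filter Topology MeasureTheory Complex

theorem sinh_pi_mul_I_sub (z : ℂ) : sinh (Real.pi * I - z) = sinh z := by
  rw [sinh_sub, sinh_mul_I, cosh_mul_I]; simp

theorem cosh_pi_mul_I_sub (z : ℂ) : cosh (Real.pi * I - z) = -cosh z := by
  rw [cosh_sub, sinh_mul_I, cosh_mul_I]; simp

theorem den_pi_mul_I_sub (α : ℝ) (z : ℂ) : den α (Real.pi * I - z) = den α z := by
  rw [den, den, sinh_pi_mul_I_sub, cosh_pi_mul_I_sub, neg_sq]

theorem hasDerivAt_den (α : ℝ) (z : ℂ) :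
    HasDerivAt (den α) (2 * (sinh z - α) * cosh z) z := by
  have h := ((hasDerivAt_cosh z).pow 2).sub ((hasDerivAt_sinh z).const_mul (2 * α : ℂ))
  have h2 : HasDerivAt (den α) _ z := h
  refine h2.congr_deriv ?_
  push_cast; ring

theorem one_sub_sq_ne_zero {α : ℝ} (h0 : 0 ≤ α) (h1 : α < 1) : (1 - (α : ℂ) ^ 2) ≠ 0 := by
  rw [← ofReal_pow, ← ofReal_one, ← ofReal_sub]
  exact ofReal_ne_zero.2 (by nlinarith)

/-- Since x + πi = πi - (-x), the reflection z ↦ πi - z fixes sinh and `den` and negates cosh. Up to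
a sign this is the effect of complex conjugation on the numerator. -/
theorem kernel_add_pi_mul_I (α w x : ℝ) :
    kernel α w (x + Real.pi * I) =
      -((Real.exp (-(Real.pi * w)) : ℝ) : ℂ) * (starRingEnd ℂ) (kernel α w ((-x : ℝ) : ℂ)) := by
  have e1 : (x + Real.pi * I : ℂ) = Real.pi * I - ((-x : ℝ) : ℂ) := by push_cast; ring
  have e2 : exp (I * (w * (Real.pi * I - ((-x : ℝ) : ℂ)))) =
      ((Real.exp (-(Real.pi * w)) : ℝ) : ℂ) * exp (-I * (w * ((-x : ℝ) : ℂ))) := by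
    rw [ofReal_exp, ← exp_add]
    congr 1
    push_cast
    linear_combination ((w : ℂ) * Real.pi) * I_sq
  have e3 : (starRingEnd ℂ) (exp (I * (w * ((-x : ℝ) : ℂ)))) = exp (-I * (w * ((-x : ℝ) : ℂ))) := by
    rw [← exp_conj, map_mul, map_mul, conj_I, conj_ofReal, conj_ofReal]
  rw [e1, kernel, den_pi_mul_I_sub, sinh_pi_mul_I_sub, cosh_pi_mul_I_sub, e2, kernel, map_mul, e3,
    map_div₀, map_add, den_ofReal, ← ofReal_sinh, ← ofReal_cosh]
  simp only [map_mul, map_neg, map_sub, conj_I, conj_ofReal, map_one, map_pow, map_ofNat]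
  ring

theorem differentiableAt_kernel {α w : ℝ} (h0 : 0 ≤ α) (h1 : α < 1) {z : ℂ} (hz : den α z ≠ 0) :
    DifferentiableAt ℂ (kernel α w) z := by
  unfold kernel
  have := (hasDerivAt_den α z).differentiableAt
  refine DifferentiableAt.mul (DifferentiableAt.div (by fun_prop) (by fun_prop) ?_) (by fun_prop)
  exact mul_ne_zero (mul_ne_zero two_ne_zero (one_sub_sq_ne_zero h0 h1)) hz

/-- The residue at a simple zero of `den`, whose derivative is 2(sinh z - α) cosh z. -/
theorem tendsto_sub_mul_kernel {α w : ℝ} {p : ℂ} (hp : den α p = 0)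
    (hp' : 2 * (sinh p - α) * cosh p ≠ 0) :
    Tendsto (fun z => (z - p) * kernel α w z) (𝓝[≠] p)
      (𝓝 ((-(I * w) * (α * sinh p - 1) + α * cosh p) / (2 * (1 - α ^ 2)) * exp (I * (w * p)) *
        (2 * (sinh p - α) * cosh p)⁻¹)) := by
  have h1 := ((hasDerivAt_den α p).tendsto_slope).inv₀ hp'
  have h2 : Tendsto (fun z : ℂ => (-(I * w) * (α * sinh z - 1) + α * cosh z) / (2 * (1 - α ^ 2)) *
      exp (I * (w * z))) (𝓝[≠] p) (𝓝 ((-(I * w) * (α * sinh p - 1) + α * cosh p) /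
        (2 * (1 - α ^ 2)) * exp (I * (w * p)))) :=
    (Continuous.tendsto (by fun_prop) p).mono_left nhdsWithin_le_nhds
  refine (h2.mul h1).congr fun z => ?_
  rw [slope_def_field, hp, sub_zero, inv_div, kernel,
    div_mul_eq_div_div _ (2 * (1 - (α : ℂ) ^ 2)) (den α z)]
  ring

theorem norm_kernel_le {α w : ℝ} (h0 : 0 ≤ α) (h1 : α < 1) (hw : 0 ≤ w) {z : ℂ} (hz : 0 ≤ z.im)
    (hT : 3 ≤ Real.sinh |z.re|) :
    ‖kernel α w z‖ ≤ (w + 1) / (1 - α ^ 2) * (Real.sinh |z.re| - 1)⁻¹ := by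
  have hs : 0 < 1 - α ^ 2 := by nlinarith
  have hxT : Real.sinh |z.re| ≤ ‖sinh z‖ := by
    rw [← Real.abs_sinh]; exact abs_sinh_re_le_norm_sinh z
  set y := ‖sinh z‖ with hy
  have hch : ‖cosh z‖ ≤ y + 1 := by
    refine le_of_sq_le_sq ?_ (by positivity)
    have a := norm_cosh_sq z
    have b := norm_sinh_sq z
    rw [← hy] at b
    have : 0 ≤ y := norm_nonneg _
    nlinarith [Real.cos_sq_le_one z.im, sq_nonneg (Real.sin z.im)]
  have hα : ‖(α : ℂ)‖ = α := by rw [norm_real, Real.norm_of_nonneg h0]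
  have hden : (y - 1) ^ 2 ≤ ‖den α z‖ := by
    have e : den α z = (sinh z - α) ^ 2 + ((1 - α ^ 2 : ℝ) : ℂ) := by
      rw [den, cosh_sq]; push_cast; ring
    have a1 : y - α ≤ ‖sinh z - α‖ := by
      have := norm_sub_norm_le (sinh z) (α : ℂ)
      rwa [hα] at this
    have a2 : (y - α) ^ 2 ≤ ‖sinh z - α‖ ^ 2 := pow_le_pow_left₀ (by linarith) a1 2
    have a3 := norm_sub_norm_le ((sinh z - α) ^ 2) (-((1 - α ^ 2 : ℝ) : ℂ))
    rw [sub_neg_eq_add, ← e, norm_neg, norm_real, Real.norm_of_nonneg hs.le, norm_pow] at a3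
    nlinarith
  have hexp : ‖exp (I * (w * z))‖ ≤ 1 := by
    rw [norm_exp, Real.exp_le_one_iff]
    simp only [mul_re, mul_im, I_re, I_im, ofReal_re, ofReal_im]
    nlinarith [mul_nonneg hw hz]
  have hnum : ‖(-(I * w) * (α * sinh z - 1) + α * cosh z : ℂ)‖ ≤ (w + 1) * (y + 1) := by
    refine (norm_add_le _ _).trans ?_
    rw [norm_mul, norm_mul, hα, norm_neg, norm_mul, norm_I, norm_real, Real.norm_of_nonneg hw]
    have a1 : ‖(α * sinh z - 1 : ℂ)‖ ≤ y + 1 := by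
      refine (norm_sub_le _ _).trans ?_
      rw [norm_mul, hα, norm_one, ← hy]
      nlinarith [norm_nonneg (sinh z)]
    nlinarith [mul_le_mul_of_nonneg_left a1 hw, norm_nonneg (cosh z)]
  have hs2 : ‖(2 * (1 - (α : ℂ) ^ 2))‖ = 2 * (1 - α ^ 2) := by
    have : (2 * (1 - (α : ℂ) ^ 2)) = ((2 * (1 - α ^ 2) : ℝ) : ℂ) := by push_cast; rfl
    rw [this, norm_real, Real.norm_of_nonneg (by positivity)]
  have hy1 : 0 < y - 1 := by linarith
  calc ‖kernel α w z‖ ≤ (w + 1) * (y + 1) / (2 * (1 - α ^ 2) * (y - 1) ^ 2) * 1 := by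
        rw [kernel, norm_mul, norm_div, norm_mul _ (den α z), hs2]
        gcongr
    _ ≤ (w + 1) * (2 * (y - 1)) / (2 * (1 - α ^ 2) * (y - 1) ^ 2) * 1 := by
        gcongr; linarith
    _ = (w + 1) / (1 - α ^ 2) * (y - 1)⁻¹ := by field_simp
    _ ≤ _ := by
        gcongr
        linarith

/-- The sum of the two residues in the strip, up to a factor. -/
def residueSum (α w : ℝ) (ρ : ℂ) : ℂ :=
  ((Real.pi / (2 * (1 - α ^ 2)) : ℝ) : ℂ) *
    ((w * sinh ρ / cosh ρ) * (exp (I * (w * ρ)) - exp (I * (w * (Real.pi * I - ρ)))) +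
      ((α / Real.sqrt (1 - α ^ 2) : ℝ) : ℂ) *
        (exp (I * (w * ρ)) + exp (I * (w * (Real.pi * I - ρ)))))

/-- The residue theorem for `kernel`. By `kernel_add_pi_mul_I` the integral over the upper side is
-e^{-πw} conj(bhat w), so it does not have to be estimated. -/
theorem bhat_add_conj {α w : ℝ} {ρ : ℂ} (h0 : 0 < α) (h1 : α < 1) (hw : 0 ≤ w)
    (hρ : IsRhoMinus α ρ) :
    bhat α w + ((Real.exp (-(Real.pi * w)) : ℝ) : ℂ) * (starRingEnd ℂ) (bhat α w) =
      residueSum α w ρ := by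
  have hs : 0 < 1 - α ^ 2 := by nlinarith
  have hs' := Real.sqrt_pos.2 hs
  obtain ⟨hsinh, him0, him1⟩ := id hρ
  have hpi := Real.pi_pos
  have hcosh : cosh ρ ≠ 0 := by
    rw [← norm_pos_iff]
    have := norm_cosh_rhoMinus_sq h0 h1 hρ
    by_contra hcon
    have h3 : ‖cosh ρ‖ = 0 := le_antisymm (not_lt.1 hcon) (norm_nonneg _)
    rw [h3] at this; linarith
  have hden : den α ρ = 0 := by
    rw [den, cosh_rhoMinus_sq h0 h1 hρ, sub_self]
  have hsα : sinh ρ - α = I * (Real.sqrt (1 - α ^ 2) : ℝ) := by rw [hsinh]; ring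
  have hsqC : ((Real.sqrt (1 - α ^ 2) : ℝ) : ℂ) ≠ 0 := ofReal_ne_zero.2 hs'.ne'
  have hd1 : 2 * (sinh ρ - α) * cosh ρ ≠ 0 := by
    rw [hsα]
    exact mul_ne_zero (mul_ne_zero two_ne_zero (mul_ne_zero I_ne_zero hsqC)) hcosh
  have hne : ρ ≠ Real.pi * I - ρ := by
    intro h
    have := congrArg im h
    simp at this
    linarith
  have him2 : (Real.pi * I - ρ : ℂ).im = Real.pi - ρ.im := by simp
  have hd2 : 2 * (sinh (Real.pi * I - ρ) - α) * cosh (Real.pi * I - ρ) ≠ 0 := by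
    rw [sinh_pi_mul_I_sub, cosh_pi_mul_I_sub, mul_neg]
    exact neg_ne_zero.2 hd1
  have t1 := tendsto_sub_mul_kernel (w := w) hden hd1
  have t2 := tendsto_sub_mul_kernel (w := w) (by rw [den_pi_mul_I_sub]; exact hden) hd2
  have hshift : ∀ x : ℝ, kernel α w (x + Real.pi * I) = _ := kernel_add_pi_mul_I α w
  have hconj : Integrable fun x : ℝ => (starRingEnd ℂ) (kernel α w ((-x : ℝ) : ℂ)) := by
    have h3 : Integrable fun x : ℝ => kernel α w ((-x : ℝ) : ℂ) :=
      (integrable_kernel_ofReal h0.le h1 w).comp_neg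
    exact (conjCLE.toContinuousLinearMap.integrable_comp h3)
  have hb : Tendsto (fun T : ℝ => (w + 1) / (1 - α ^ 2) * (Real.sinh T - 1)⁻¹) atTop (𝓝 0) := by
    have : Tendsto (fun T : ℝ => (Real.sinh T - 1)⁻¹) atTop (𝓝 0) :=
      tendsto_inv_atTop_zero.comp (tendsto_atTop_add_const_right _ _ tendsto_sinh_atTop)
    simpa using this.const_mul ((w + 1) / (1 - α ^ 2))
  have key := integral_sub_integral_add_pi_mul_I him0 (by linarith) (by rw [him2]; linarith)
    (by rw [him2]; linarith) hne
    (fun z hz hz' hz1 hz2 => differentiableAt_kernel (w := w) h0.le h1 fun h =>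
      (den_eq_zero_iff h0 h1 hρ hz hz' h).elim hz1 hz2) t1 t2 hb
    (by
      filter_upwards [tendsto_sinh_atTop.eventually_ge_atTop 3] with T hT z hz _ hzT
      have := norm_kernel_le (α := α) (w := w) h0.le h1 hw hz (by rw [hzT]; exact hT)
      rwa [hzT] at this)
    (integrable_kernel_ofReal h0.le h1 w)
    (by simp only [hshift]; exact hconj.const_mul _)
  simp only [hshift] at key
  rw [integral_const_mul, integral_neg_eq_self (fun x : ℝ => (starRingEnd ℂ) (kernel α w x)),
    integral_conj, ← bhat_eq_integral_kernel h0.le h1 w] at key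
  have hpi' : bhat α w + ((Real.exp (-(Real.pi * w)) : ℝ) : ℂ) * (starRingEnd ℂ) (bhat α w) =
      bhat α w - -((Real.exp (-(Real.pi * w)) : ℝ) : ℂ) * (starRingEnd ℂ) (bhat α w) := by ring
  rw [hpi', key, sinh_pi_mul_I_sub, cosh_pi_mul_I_sub, residueSum]
  -- This is the product of the roots, (α + i√(1 - α²))(α - i√(1 - α²)) = 1, rearranged.
  have hnum : (α * sinh ρ - 1 : ℂ) = I * (Real.sqrt (1 - α ^ 2) : ℝ) * sinh ρ := by
    have h2 : ((Real.sqrt (1 - α ^ 2) : ℝ) : ℂ) ^ 2 = 1 - (α : ℂ) ^ 2 := by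
      rw [← ofReal_pow, Real.sq_sqrt hs.le]; push_cast; ring
    rw [hsinh]
    linear_combination (-I ^ 2) * h2 - (1 - (α : ℂ) ^ 2) * I_sq
  rw [hnum, hsα]
  have hsC := one_sub_sq_ne_zero h0.le h1
  push_cast
  generalize ((Real.sqrt (1 - α ^ 2) : ℝ) : ℂ) = s at *
  generalize exp (I * (w * ρ)) = E₁
  generalize exp (I * (w * (Real.pi * I - ρ))) = E₂
  have hI : I ≠ 0 := I_ne_zero
  have hI2 := I_sq
  field_simp
  rw [hI2]
  ring

end
end MelnikovQP

/-! ### Upper and lower bounds for the transform of `β`. -/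

namespace MelnikovQP

noncomputable section

open Filter Topology MeasureTheory Complex

theorem norm_residueSum_le {α w : ℝ} {ρ : ℂ} (h0 : 0 < α) (h1 : α < 1) (hw : 0 ≤ w)
    (hρ : IsRhoMinus α ρ) :
    ‖residueSum α w ρ‖ ≤ (1 + Real.exp (-(Real.pi * w))) * ‖bhat α w‖ := by
  rw [← bhat_add_conj h0 h1 hw hρ]
  refine (norm_add_le _ _).trans_eq ?_
  rw [norm_mul, norm_conj, norm_real, Real.norm_of_nonneg (Real.exp_pos _).le]
  ring

theorem norm_bhat_ge {α w : ℝ} {ρ : ℂ} (h0 : 0 < α) (h1 : α < 1) (hw : 0 ≤ w)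
    (hρ : IsRhoMinus α ρ) : ‖residueSum α w ρ‖ / 2 ≤ ‖bhat α w‖ := by
  have h := norm_residueSum_le h0 h1 hw hρ
  have : Real.exp (-(Real.pi * w)) ≤ 1 := by
    rw [Real.exp_le_one_iff]; have := Real.pi_pos; nlinarith
  nlinarith [norm_nonneg (bhat α w)]

/-- The factor comes from 1 - e^{-πw} ≥ w/(1 + w). -/
theorem norm_bhat_le {α w : ℝ} {ρ : ℂ} (h0 : 0 < α) (h1 : α < 1) (hw : 0 < w)
    (hρ : IsRhoMinus α ρ) : ‖bhat α w‖ ≤ (1 + w⁻¹) * ‖residueSum α w ρ‖ := by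
  have h : (1 - Real.exp (-(Real.pi * w))) * ‖bhat α w‖ ≤ ‖residueSum α w ρ‖ := by
    rw [← bhat_add_conj h0 h1 hw.le hρ]
    have := norm_sub_norm_le (bhat α w)
      (-(((Real.exp (-(Real.pi * w)) : ℝ) : ℂ) * (starRingEnd ℂ) (bhat α w)))
    rw [sub_neg_eq_add, norm_neg, norm_mul, norm_conj, norm_real,
      Real.norm_of_nonneg (Real.exp_pos _).le] at this
    linarith
  have he : Real.exp (-(Real.pi * w)) ≤ (1 + w)⁻¹ := by
    rw [Real.exp_neg]
    refine inv_anti₀ (by positivity) ?_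
    have := Real.add_one_le_exp (Real.pi * w)
    have := Real.pi_gt_three
    nlinarith
  have h2 : w / (1 + w) * ‖bhat α w‖ ≤ ‖residueSum α w ρ‖ := by
    refine le_trans (mul_le_mul_of_nonneg_right ?_ (norm_nonneg _)) h
    have : w / (1 + w) = 1 - (1 + w)⁻¹ := by field_simp; ring
    linarith
  have h3 : (1 + w⁻¹) * (w / (1 + w) * ‖bhat α w‖) = ‖bhat α w‖ := by field_simp; ring
  rw [← h3]
  exact mul_le_mul_of_nonneg_left h2 (by positivity)

theorem norm_exp_I_mul_mul_complex (w : ℝ) (z : ℂ) :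
    ‖exp (I * (w * z))‖ = Real.exp (-(w * z.im)) := by
  rw [norm_exp]; simp

/-- The distance of `Im ρ₋` to `π / 2`. -/
theorem pi_div_two_sub_im_bounds {α : ℝ} {ρ : ℂ} (h0 : 0 < α) (h1 : α < 1) (hρ : IsRhoMinus α ρ) :
    Real.sqrt α ≤ Real.pi / 2 - ρ.im ∧ Real.pi / 2 - ρ.im ≤ 2 * Real.sqrt α := by
  have hs := sin_im_rhoMinus_sq h0 h1 hρ
  have hpi := Real.pi_lt_four
  have hcos : 0 ≤ Real.cos ρ.im :=
    Real.cos_nonneg_of_neg_pi_div_two_le_of_le (by linarith [hρ.2.1, Real.pi_pos]) hρ.2.2.le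
  have hc : Real.sin (Real.pi / 2 - ρ.im) = Real.sqrt α := by
    rw [Real.sin_pi_div_two_sub, ← Real.sqrt_sq hcos, Real.cos_sq', hs]
    congr 1; ring
  have ht : 0 ≤ Real.pi / 2 - ρ.im := by linarith [hρ.2.2]
  refine ⟨hc ▸ Real.sin_le ht, ?_⟩
  have := Real.mul_le_sin ht (by linarith [hρ.2.1])
  rw [hc, div_mul_eq_mul_div, div_le_iff₀ Real.pi_pos] at this
  nlinarith [Real.sqrt_nonneg α]

theorem norm_residueSum_upper {α w : ℝ} {ρ : ℂ} (h0 : 0 < α) (h1 : α < 1) (hw : 0 ≤ w)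
    (hρ : IsRhoMinus α ρ) :
    ‖residueSum α w ρ‖ ≤ Real.pi / (2 * (1 - α ^ 2)) *
      (w / Real.sqrt (2 * α) * ‖exp (I * (w * ρ)) - exp (I * (w * (Real.pi * I - ρ)))‖ +
        α / Real.sqrt (1 - α ^ 2) * (2 * Real.exp (-(w * ρ.im)))) := by
  have hs : 0 < 1 - α ^ 2 := by nlinarith
  have hs' := Real.sqrt_pos.2 hs
  have hpi := Real.pi_pos
  have hcosh : ‖cosh ρ‖ = Real.sqrt (2 * α) := by
    rw [← norm_cosh_rhoMinus_sq h0 h1 hρ, Real.sqrt_sq (norm_nonneg _)]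
  rw [residueSum, norm_mul, norm_real, Real.norm_of_nonneg (by positivity)]
  refine mul_le_mul_of_nonneg_left ((norm_add_le _ _).trans ?_) (by positivity)
  rw [norm_mul, norm_div, norm_mul, norm_real, Real.norm_of_nonneg hw,
    norm_sinh_rhoMinus h0 h1 hρ, hcosh, mul_one, norm_mul, norm_real,
    Real.norm_of_nonneg (by positivity)]
  refine add_le_add le_rfl (mul_le_mul_of_nonneg_left ((norm_add_le _ _).trans ?_) (by positivity))
  rw [norm_exp_I_mul_mul_complex, norm_exp_I_mul_mul_complex, two_mul]
  refine add_le_add le_rfl (Real.exp_le_exp.2 ?_)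
  have : ((Real.pi : ℂ) * I - ρ).im = Real.pi - ρ.im := by simp
  rw [this]
  nlinarith [hρ.2.2]

theorem norm_residueSum_lower {α w : ℝ} {ρ : ℂ} (h0 : 0 < α) (h1 : α < 1) (hw : 0 ≤ w)
    (hρ : IsRhoMinus α ρ) :
    Real.pi / (2 * (1 - α ^ 2)) *
      (w / Real.sqrt (2 * α) * (Real.exp (-(w * ρ.im)) - Real.exp (-(w * (Real.pi - ρ.im)))) -
        α / Real.sqrt (1 - α ^ 2) * (2 * Real.exp (-(w * ρ.im)))) ≤ ‖residueSum α w ρ‖ := by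
  have hs : 0 < 1 - α ^ 2 := by nlinarith
  have hs' := Real.sqrt_pos.2 hs
  have hpi := Real.pi_pos
  have hcosh : ‖cosh ρ‖ = Real.sqrt (2 * α) := by
    rw [← norm_cosh_rhoMinus_sq h0 h1 hρ, Real.sqrt_sq (norm_nonneg _)]
  have him : ((Real.pi : ℂ) * I - ρ).im = Real.pi - ρ.im := by simp
  rw [residueSum, norm_mul, norm_real, Real.norm_of_nonneg (by positivity)]
  refine mul_le_mul_of_nonneg_left ?_ (by positivity)
  set E₁ := exp (I * (w * ρ)) with hE₁
  set E₂ := exp (I * (w * (Real.pi * I - ρ))) with hE₂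
  have n1 : ‖E₁‖ = Real.exp (-(w * ρ.im)) := norm_exp_I_mul_mul_complex _ _
  have n2 : ‖E₂‖ = Real.exp (-(w * (Real.pi - ρ.im))) := by
    rw [hE₂, norm_exp_I_mul_mul_complex, him]
  have n21 : ‖E₂‖ ≤ ‖E₁‖ := by
    rw [n1, n2, Real.exp_le_exp]; nlinarith [hρ.2.2]
  rw [← n2, ← n1]
  have t := norm_sub_norm_le (w * sinh ρ / cosh ρ * (E₁ - E₂))
    (-(((α / Real.sqrt (1 - α ^ 2) : ℝ) : ℂ) * (E₁ + E₂)))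
  rw [sub_neg_eq_add, norm_neg] at t
  refine le_trans ?_ t
  rw [norm_mul, norm_div, norm_mul, norm_real, Real.norm_of_nonneg hw,
    norm_sinh_rhoMinus h0 h1 hρ, hcosh, mul_one, norm_mul, norm_real,
    Real.norm_of_nonneg (by positivity)]
  have a1 := mul_le_mul_of_nonneg_left (norm_sub_norm_le E₁ E₂)
    (by positivity : 0 ≤ w / Real.sqrt (2 * α))
  have a2 := mul_le_mul_of_nonneg_left ((norm_add_le E₁ E₂).trans (by linarith : _ ≤ 2 * ‖E₁‖))
    (by positivity : 0 ≤ α / Real.sqrt (1 - α ^ 2))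
  linarith

/-- Upper bound for the Fourier transform of `β`, useful when `α` is not too small. -/
theorem norm_bhat_le_of_large {α w : ℝ} {ρ : ℂ} (h0 : 0 < α) (h1 : α < 1) (hw : 0 < w)
    (hρ : IsRhoMinus α ρ) :
    ‖bhat α w‖ ≤ (1 + w⁻¹) * (Real.pi / (1 - α) *
      (w / Real.sqrt α + α / Real.sqrt (1 - α)) * Real.exp (-(w * ρ.im))) := by
  refine (norm_bhat_le h0 h1 hw hρ).trans (mul_le_mul_of_nonneg_left
    ((norm_residueSum_upper h0 h1 hw.le hρ).trans ?_) (by positivity))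
  have hs : 0 < 1 - α := by linarith
  have hs2 : 1 - α ≤ 1 - α ^ 2 := by nlinarith
  have hpi := Real.pi_pos
  have him : ((Real.pi : ℂ) * I - ρ).im = Real.pi - ρ.im := by simp
  have hE : ‖exp (I * (w * ρ)) - exp (I * (w * (Real.pi * I - ρ)))‖ ≤
      2 * Real.exp (-(w * ρ.im)) := by
    refine (norm_sub_le _ _).trans ?_
    rw [norm_exp_I_mul_mul_complex, norm_exp_I_mul_mul_complex, two_mul, him]
    refine add_le_add le_rfl (Real.exp_le_exp.2 ?_)
    nlinarith [hρ.2.2]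
  have hsq : Real.sqrt α ≤ Real.sqrt (2 * α) := Real.sqrt_le_sqrt (by linarith)
  have hsa := Real.sqrt_pos.2 h0
  have hsb := Real.sqrt_pos.2 hs
  calc _ ≤ Real.pi / (2 * (1 - α)) * (w / Real.sqrt α * (2 * Real.exp (-(w * ρ.im))) +
        α / Real.sqrt (1 - α) * (2 * Real.exp (-(w * ρ.im)))) := by
        gcongr
    _ = _ := by field_simp

theorem norm_exp_sub_exp_le {c : ℝ} {z₁ z₂ : ℂ} (h₁ : z₁.re ≤ c) (h₂ : z₂.re ≤ c) :
    ‖exp z₁ - exp z₂‖ ≤ Real.exp c * ‖z₁ - z₂‖ := by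
  refine Convex.norm_image_sub_le_of_norm_hasDerivWithin_le (s := {z : ℂ | z.re ≤ c})
    (f' := exp) (fun z _ => (hasDerivAt_exp z).hasDerivWithinAt) (fun z hz => ?_)
    (convex_halfSpace_re_le c) h₂ h₁
  rw [norm_exp]
  exact Real.exp_le_exp.2 hz

/-- The factor 1/√(2α) from 1/cosh ρ is cancelled: both poles lie within O(√α) of πi/2, so the two
exponentials differ by O(w√α) e^{-w Im ρ}. -/
theorem norm_bhat_le_of_pos_small {α w : ℝ} {ρ : ℂ} (h0 : 0 < α) (h1 : α ≤ 1 / 2) (hw : 0 < w)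
    (hρ : IsRhoMinus α ρ) :
    ‖bhat α w‖ ≤ 200 * (w ^ 2 + w⁻¹) * Real.exp (-(w * ρ.im)) := by
  have h1' : α < 1 := by linarith
  have hsa := Real.sqrt_pos.2 h0
  have hsa2 := Real.sq_sqrt h0.le
  obtain ⟨b1, b2⟩ := pi_div_two_sub_im_bounds h0 h1' hρ
  have hpi := Real.pi_lt_four
  have him : ((Real.pi : ℂ) * I - ρ).im = Real.pi - ρ.im := by simp
  have hre : |ρ.re| ≤ Real.sqrt α := by
    have h3 := sinh_re_rhoMinus_sq h0 h1' hρ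
    have h4 : |ρ.re| ≤ |Real.sinh ρ.re| := by
      rw [Real.abs_sinh]; exact Real.self_le_sinh_iff.2 (abs_nonneg _)
    rwa [← Real.sqrt_sq_eq_abs (Real.sinh ρ.re), h3] at h4
  have hE : ‖exp (I * (w * ρ)) - exp (I * (w * (Real.pi * I - ρ)))‖ ≤
      Real.exp (-(w * ρ.im)) * (6 * w * Real.sqrt α) := by
    refine (norm_exp_sub_exp_le (c := -(w * ρ.im)) (by simp) ?_).trans ?_
    · simp; nlinarith [hρ.2.2]
    · refine mul_le_mul_of_nonneg_left ?_ (Real.exp_pos _).le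
      have e : I * (w * ρ) - I * (w * (Real.pi * I - ρ)) = I * w * (2 * ρ - Real.pi * I) := by ring
      rw [e, norm_mul, norm_mul, norm_I, norm_real, Real.norm_of_nonneg hw.le, one_mul]
      have h5 : ‖2 * ρ - Real.pi * I‖ ≤ 6 * Real.sqrt α := by
        refine (norm_le_abs_re_add_abs_im _).trans ?_
        have e1 : (2 * ρ - Real.pi * I).re = 2 * ρ.re := by simp
        have e2 : (2 * ρ - Real.pi * I).im = -(2 * (Real.pi / 2 - ρ.im)) := by simp; ring
        rw [e1, e2, abs_neg, abs_mul, abs_mul, abs_two, abs_of_nonneg (by linarith : 0 ≤ Real.pi / 2 - ρ.im)]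
        linarith
      calc w * ‖2 * ρ - Real.pi * I‖ ≤ w * (6 * Real.sqrt α) := by gcongr
        _ = _ := by ring
  have hs2 : 1 / 2 ≤ 1 - α ^ 2 := by nlinarith
  have hss : 1 / 2 ≤ Real.sqrt (1 - α ^ 2) := by
    rw [Real.le_sqrt' (by norm_num)]; linarith
  have hsq : Real.sqrt α ≤ Real.sqrt (2 * α) := Real.sqrt_le_sqrt (by linarith)
  have hJ : ‖residueSum α w ρ‖ ≤ 4 * (6 * w ^ 2 + 2) * Real.exp (-(w * ρ.im)) := by
    refine (norm_residueSum_upper h0 h1' hw.le hρ).trans ?_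
    calc _ ≤ 4 / (2 * (1 / 2)) * (w / Real.sqrt α * (Real.exp (-(w * ρ.im)) * (6 * w * Real.sqrt α))
          + (1 / 2) / (1 / 2) * (2 * Real.exp (-(w * ρ.im)))) := by
          gcongr
      _ = _ := by field_simp
  refine (norm_bhat_le h0 h1' hw hρ).trans ((mul_le_mul_of_nonneg_left hJ (by positivity)).trans ?_)
  rw [← mul_assoc]
  refine mul_le_mul_of_nonneg_right ?_ (Real.exp_pos _).le
  have hwi : 0 < w⁻¹ := inv_pos.2 hw
  have hww : w * w⁻¹ = 1 := mul_inv_cancel₀ hw.ne'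
  have k1 : w ≤ w ^ 2 + w⁻¹ := by
    rcases le_total w 1 with h | h
    · have : 1 ≤ w⁻¹ := (one_le_inv₀ hw).2 h
      nlinarith
    · nlinarith
  have k2 : 1 ≤ w ^ 2 + w⁻¹ := by
    rcases le_total w 1 with h | h
    · have : 1 ≤ w⁻¹ := (one_le_inv₀ hw).2 h
      nlinarith
    · nlinarith
  have e : (1 + w⁻¹) * (4 * (6 * w ^ 2 + 2)) = 24 * w ^ 2 + 8 + 24 * w * (w * w⁻¹) + 8 * w⁻¹ := by ring
  rw [e, hww]
  nlinarith

/-- With t = π/2 - Im ρ ≥ √α, the moduli of the two exponentials differ by 2 e^{-wπ/2} sinh(wt) ≥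
2w√α e^{-wπ/2}. This beats 1/√(2α) and yields w²; the subtracted term bounds the other part of the
residues. -/
theorem norm_bhat_ge_of_pos_small {α w : ℝ} {ρ : ℂ} (h0 : 0 < α) (h1 : α ≤ 1 / 2) (hw : 0 < w)
    (hρ : IsRhoMinus α ρ) :
    (w ^ 2 - 8 * α * Real.exp (2 * w * Real.sqrt α)) * Real.exp (-(w * (Real.pi / 2)))
      ≤ ‖bhat α w‖ := by
  have h1' : α < 1 := by linarith
  have hsa := Real.sqrt_pos.2 h0
  have hsa2 := Real.sq_sqrt h0.le
  obtain ⟨b1, b2⟩ := pi_div_two_sub_im_bounds h0 h1' hρ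
  have hpi := Real.pi_lt_four
  have hpi3 := Real.pi_gt_three
  have hs : 0 < 1 - α ^ 2 := by nlinarith
  have hs2 : 1 / 2 ≤ 1 - α ^ 2 := by nlinarith
  have hss : 1 / 2 ≤ Real.sqrt (1 - α ^ 2) := by
    rw [Real.le_sqrt' (by norm_num)]; linarith
  refine le_trans ?_ (norm_bhat_ge h0 h1' hw.le hρ)
  have hl := norm_residueSum_lower h0 h1' hw.le hρ
  set t := Real.pi / 2 - ρ.im with ht
  set e := Real.exp (-(w * (Real.pi / 2))) with he
  have hepos : 0 < e := Real.exp_pos _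
  have E1 : Real.exp (-(w * ρ.im)) = e * Real.exp (w * t) := by
    rw [he, ← Real.exp_add]; congr 1; rw [ht]; ring
  have E2 : Real.exp (-(w * (Real.pi - ρ.im))) = e * Real.exp (-(w * t)) := by
    rw [he, ← Real.exp_add]; congr 1; rw [ht]; ring
  have hsinh : 2 * (w * Real.sqrt α) ≤ Real.exp (w * t) - Real.exp (-(w * t)) := by
    have ht0 : 0 ≤ t := hsa.le.trans b1
    have h3 := Real.self_le_sinh_iff.2 (by positivity : 0 ≤ w * t)
    rw [Real.sinh_eq] at h3
    have h4 : w * Real.sqrt α ≤ w * t := by gcongr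
    linarith
  have hex : Real.exp (w * t) ≤ Real.exp (2 * w * Real.sqrt α) := by
    rw [Real.exp_le_exp]; nlinarith
  have hs2α : Real.sqrt (2 * α) ≤ 3 / 2 * Real.sqrt α := by
    rw [Real.sqrt_le_left (by positivity), mul_pow, hsa2]; linarith
  have hs2α0 : 0 < Real.sqrt (2 * α) := Real.sqrt_pos.2 (by linarith)
  have A : 4 / 3 * w ^ 2 * e ≤
      w / Real.sqrt (2 * α) * (Real.exp (-(w * ρ.im)) - Real.exp (-(w * (Real.pi - ρ.im)))) := by
    rw [E1, E2, ← mul_sub]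
    calc 4 / 3 * w ^ 2 * e = w / (3 / 2 * Real.sqrt α) * (e * (2 * (w * Real.sqrt α))) := by
          field_simp; ring
      _ ≤ _ := by gcongr
  have B : α / Real.sqrt (1 - α ^ 2) * (2 * Real.exp (-(w * ρ.im))) ≤
      4 * α * Real.exp (2 * w * Real.sqrt α) * e := by
    rw [E1]
    calc _ ≤ α / (1 / 2) * (2 * (e * Real.exp (2 * w * Real.sqrt α))) := by gcongr
      _ = _ := by ring
  have hw2 : 0 ≤ w ^ 2 * e := by positivity
  have hα2 : 0 ≤ α * Real.exp (2 * w * Real.sqrt α) * e := by positivity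
  set q := Real.pi / (2 * (1 - α ^ 2)) with hq
  -- With 3/2 ≤ q ≤ 4, the constants 4/3 and 4 of `A` and `B`, multiplied by q/2, give 1 and 8.
  have q1 : 3 / 2 ≤ q := by
    rw [hq, le_div_iff₀ (by positivity)]; nlinarith
  have q2 : q ≤ 4 := by
    rw [hq, div_le_iff₀ (by positivity)]; linarith
  have hl' := le_trans (mul_le_mul_of_nonneg_left (sub_le_sub A B) (by linarith : 0 ≤ q)) hl
  nlinarith

/-- Lower bound for the Fourier transform of `β`, useful when `α` is not too small. -/
theorem norm_bhat_ge_of_large {α w : ℝ} {ρ : ℂ} (h0 : 0 < α) (h1 : α < 1) (hw : 0 < w)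
    (hρ : IsRhoMinus α ρ) (hpos : 2 * α / Real.sqrt (1 - α) ≤
      w / Real.sqrt (2 * α) * (1 - Real.exp (-(2 * w * Real.sqrt α)))) :
    (4 * (1 - α))⁻¹ * (w / Real.sqrt (2 * α) * (1 - Real.exp (-(2 * w * Real.sqrt α))) -
      2 * α / Real.sqrt (1 - α)) * Real.exp (-(w * ρ.im)) ≤ ‖bhat α w‖ := by
  refine le_trans ?_ (norm_bhat_ge h0 h1 hw.le hρ)
  have hl := norm_residueSum_lower h0 h1 hw.le hρ
  obtain ⟨b1, b2⟩ := pi_div_two_sub_im_bounds h0 h1 hρ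
  have hs : 0 < 1 - α := by linarith
  have hs1 : 0 < 1 - α ^ 2 := by nlinarith
  have hs2 : 1 - α ≤ 1 - α ^ 2 := by nlinarith
  have hs3 : 1 - α ^ 2 ≤ 2 * (1 - α) := by nlinarith
  have hpi3 := Real.pi_gt_three
  have hsb := Real.sqrt_pos.2 hs
  have hs2α0 : 0 < Real.sqrt (2 * α) := Real.sqrt_pos.2 (by linarith)
  set e := Real.exp (-(w * ρ.im)) with he
  have hepos : 0 < e := Real.exp_pos _
  have E2 : Real.exp (-(w * (Real.pi - ρ.im))) ≤ e * Real.exp (-(2 * w * Real.sqrt α)) := by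
    rw [he, ← Real.exp_add, Real.exp_le_exp]
    nlinarith
  set m := w / Real.sqrt (2 * α) * (1 - Real.exp (-(2 * w * Real.sqrt α))) -
      2 * α / Real.sqrt (1 - α) with hm
  have hm0 : 0 ≤ m := by rw [hm]; linarith
  have A : w / Real.sqrt (2 * α) * ((1 - Real.exp (-(2 * w * Real.sqrt α))) * e) ≤
      w / Real.sqrt (2 * α) * (e - Real.exp (-(w * (Real.pi - ρ.im)))) := by
    gcongr
    linarith
  have B : α / Real.sqrt (1 - α ^ 2) * (2 * e) ≤ α / Real.sqrt (1 - α) * (2 * e) := by gcongr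
  have C : m * e ≤ w / Real.sqrt (2 * α) * (e - Real.exp (-(w * (Real.pi - ρ.im)))) -
      α / Real.sqrt (1 - α ^ 2) * (2 * e) := by
    have : m * e = w / Real.sqrt (2 * α) * ((1 - Real.exp (-(2 * w * Real.sqrt α))) * e) -
      α / Real.sqrt (1 - α) * (2 * e) := by rw [hm]; ring
    linarith
  have q1 : 2 * (4 * (1 - α))⁻¹ ≤ Real.pi / (2 * (1 - α ^ 2)) := by
    rw [mul_inv_le_iff₀ (by positivity), div_mul_eq_mul_div, le_div_iff₀ (by positivity)]
    nlinarith
  have h5 : 2 * (4 * (1 - α))⁻¹ * (m * e) ≤ Real.pi / (2 * (1 - α ^ 2)) *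
      (w / Real.sqrt (2 * α) * (e - Real.exp (-(w * (Real.pi - ρ.im)))) -
      α / Real.sqrt (1 - α ^ 2) * (2 * e)) := by
    refine mul_le_mul q1 C (by positivity) ?_
    positivity
  linarith

/-- At α = 0 the two poles coincide at πi/2 and the residue formula is unavailable; the bounds pass
to the limit instead. -/
theorem continuousWithinAt_bhat (w : ℝ) : ContinuousWithinAt (fun α => bhat α w) (Set.Ioi 0) 0 := by
  unfold bhat
  have hev : ∀ᶠ α in 𝓝[>] (0 : ℝ), 0 < α ∧ α < 1 / 2 :=
    Ioo_mem_nhdsGT (by norm_num)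
  refine tendsto_integral_filter_of_dominated_convergence (fun x => 4 * (Real.cosh x)⁻¹) ?_ ?_
    (integrable_inv_cosh.const_mul 4) ?_
  · filter_upwards [hev] with α hα
    exact (integrable_β_mul_exp hα.1.le (by linarith [hα.2]) w).aestronglyMeasurable
  · filter_upwards [hev] with α hα
    refine Eventually.of_forall fun x => ?_
    rw [norm_mul, norm_exp_I_mul_mul, mul_one, norm_real, Real.norm_eq_abs]
    refine (abs_β_le hα.1.le (by linarith [hα.2]) x).trans ?_
    refine mul_le_mul_of_nonneg_right ?_ (inv_nonneg.2 (Real.cosh_pos x).le)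
    rw [inv_le_comm₀ (pow_pos (by linarith [hα.2]) 2) (by norm_num)]
    nlinarith [hα.2]
  · refine Eventually.of_forall fun x => ?_
    refine Tendsto.mul_const _ ?_
    refine (continuous_ofReal.tendsto _).comp ?_
    refine Tendsto.mono_left (ContinuousAt.tendsto ?_) nhdsWithin_le_nhds
    unfold β
    refine ContinuousAt.div (by fun_prop) (by fun_prop) ?_
    have := Real.cosh_pos x
    simp [this.ne']

theorem norm_bhat_le_of_small {α w : ℝ} (h0 : 0 ≤ α) (h1 : α ≤ 1 / 2) (hw : 0 < w) :
    ‖bhat α w‖ ≤ 200 * (w ^ 2 + w⁻¹) *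
      Real.exp (-(w * Real.arcsin (Real.sqrt (1 - α)))) := by
  have hpos : ∀ α : ℝ, 0 < α → α ≤ 1 / 2 → ‖bhat α w‖ ≤ 200 * (w ^ 2 + w⁻¹) *
      Real.exp (-(w * Real.arcsin (Real.sqrt (1 - α)))) := by
    intro α h0 h1
    obtain ⟨ρ, hρ, -⟩ := existsUnique_rhoMinus h0 (by linarith : α < 1)
    rw [← im_rhoMinus h0 (by linarith) hρ]
    exact norm_bhat_le_of_pos_small h0 h1 hw hρ
  rcases h0.eq_or_lt with rfl | h0
  · refine le_of_tendsto_of_tendsto (continuousWithinAt_bhat w).norm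
      (Tendsto.mono_left (ContinuousAt.tendsto ?_) nhdsWithin_le_nhds)
      (g := fun α => 200 * (w ^ 2 + w⁻¹) * Real.exp (-(w * Real.arcsin (Real.sqrt (1 - α))))) ?_
    · exact Continuous.continuousAt (by
        have := Real.continuous_arcsin
        fun_prop)
    · filter_upwards [Ioo_mem_nhdsGT (by norm_num : (0 : ℝ) < 1 / 2)] with α hα
      exact hpos α hα.1 hα.2.le
  · exact hpos α h0 h1

theorem norm_bhat_ge_of_small {α w : ℝ} (h0 : 0 ≤ α) (h1 : α ≤ 1 / 2) (hw : 0 < w) :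
    (w ^ 2 - 8 * α * Real.exp (2 * w * Real.sqrt α)) * Real.exp (-(w * (Real.pi / 2)))
      ≤ ‖bhat α w‖ := by
  have hpos : ∀ α : ℝ, 0 < α → α ≤ 1 / 2 →
      (w ^ 2 - 8 * α * Real.exp (2 * w * Real.sqrt α)) * Real.exp (-(w * (Real.pi / 2)))
      ≤ ‖bhat α w‖ := by
    intro α h0 h1
    obtain ⟨ρ, hρ, -⟩ := existsUnique_rhoMinus h0 (by linarith : α < 1)
    exact norm_bhat_ge_of_pos_small h0 h1 hw hρ
  rcases h0.eq_or_lt with rfl | h0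
  · refine le_of_tendsto_of_tendsto
      (f := fun α => (w ^ 2 - 8 * α * Real.exp (2 * w * Real.sqrt α)) *
        Real.exp (-(w * (Real.pi / 2))))
      (Tendsto.mono_left (ContinuousAt.tendsto ?_) nhdsWithin_le_nhds)
      (continuousWithinAt_bhat w).norm ?_
    · exact Continuous.continuousAt (by fun_prop)
    · filter_upwards [Ioo_mem_nhdsGT (by norm_num : (0 : ℝ) < 1 / 2)] with α hα
      exact hpos α hα.1 hα.2.le
  · exact hpos α h0 h1

end
end MelnikovQP

/-! ### The Fourier series of the Melnikov function. -/

namespace MelnikovQP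

noncomputable section

open Filter Topology MeasureTheory Complex

theorem integral_exp_int_mul (m : ℤ) :
    ∫ θ : ℝ in (0 : ℝ)..(2 * Real.pi), exp (I * (m * θ)) = if m = 0 then 2 * Real.pi else 0 := by
  split_ifs with h
  · simp [h]
  · have hm : I * m ≠ 0 := mul_ne_zero I_ne_zero (Int.cast_ne_zero.2 h)
    have := integral_exp_mul_complex (a := 0) (b := 2 * Real.pi) hm
    simp only [mul_assoc] at this
    rw [this]
    have e : I * (m * ((2 * Real.pi : ℝ) : ℂ)) = m * (2 * Real.pi * I) := by push_cast; ring
    rw [e, exp_int_mul_two_pi_mul_I]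
    simp

theorem norm_exp_int_phase (m : ℤ) (θ : ℝ) : ‖exp (I * (m * θ))‖ = 1 := by
  have := norm_exp_I_mul_mul (m : ℝ) θ
  push_cast at this
  exact this

/-- The Fourier coefficients of an absolutely convergent trigonometric series are bounded by its
supremum. -/
theorem norm_tsum_ite_le {ι : Type*} [Countable ι] {a : ι → ℂ} (n : ι → ℤ)
    (ha : Summable fun i => ‖a i‖) {S : ℝ}
    (h : ∀ θ : ℝ, ‖∑' i, a i * exp (I * (n i * θ))‖ ≤ S) (N : ℤ) :
    ‖∑' i, if n i = N then a i else 0‖ ≤ S := by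
  have hpi := Real.pi_pos
  have hsum : ∀ θ : ℝ, Summable fun i => a i * exp (I * (n i * θ)) := fun θ =>
    Summable.of_norm (ha.congr fun i => by rw [norm_mul, norm_exp_int_phase, mul_one])
  have key : HasSum (fun i => ∫ θ : ℝ in (0 : ℝ)..(2 * Real.pi), a i * exp (I * ((n i - N : ℤ) * θ)))
      (∫ θ : ℝ in (0 : ℝ)..(2 * Real.pi),
        (∑' i, a i * exp (I * (n i * θ))) * exp (I * ((-N : ℤ) * θ))) := by
    refine intervalIntegral.hasSum_integral_of_dominated_convergence (fun i _ => ‖a i‖) ?_ ?_ ?_ ?_ ?_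
    · intro i
      exact Continuous.aestronglyMeasurable (by fun_prop)
    · refine fun i => Eventually.of_forall fun θ _ => ?_
      rw [norm_mul, norm_exp_int_phase, mul_one]
    · exact Eventually.of_forall fun θ _ => ha
    · exact intervalIntegrable_const
    · refine Eventually.of_forall fun θ _ => ?_
      refine ((hsum θ).hasSum.mul_right (exp (I * ((-N : ℤ) * θ)))).congr_fun ?_
      intro i
      rw [mul_assoc, ← exp_add]
      congr 2
      push_cast; ring
  have h2 : ∀ i, ∫ θ : ℝ in (0 : ℝ)..(2 * Real.pi), a i * exp (I * ((n i - N : ℤ) * θ)) =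
      (2 * Real.pi) * if n i = N then a i else 0 := by
    intro i
    rw [intervalIntegral.integral_const_mul, integral_exp_int_mul]
    simp only [sub_eq_zero]
    split_ifs <;> push_cast <;> ring
  simp only [h2] at key
  have h3 := key.tsum_eq
  rw [tsum_mul_left] at h3
  have h4 : ‖∫ θ : ℝ in (0 : ℝ)..(2 * Real.pi),
        (∑' i, a i * exp (I * (n i * θ))) * exp (I * ((-N : ℤ) * θ))‖ ≤ S * |2 * Real.pi - 0| := by
    refine intervalIntegral.norm_integral_le_of_norm_le_const fun θ _ => ?_
    rw [norm_mul, norm_exp_int_phase, mul_one]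
    exact h θ
  rw [← h3, sub_zero, abs_of_pos (by positivity), norm_mul] at h4
  have h5 : ‖(2 * Real.pi : ℂ)‖ = 2 * Real.pi := by
    rw [norm_mul, norm_real, Real.norm_of_nonneg hpi.le]; simp
  rw [h5, mul_comm S] at h4
  exact le_of_mul_le_mul_left h4 (by positivity)

/-- The one-variable projection is applied twice, first in θ₁ and then in θ₂. -/
theorem norm_coeff_le_of_forall_norm_tsum_le {a : ℤ × ℤ → ℂ} (ha : Summable fun k => ‖a k‖) {S : ℝ}
    (h : ∀ θ₁ θ₂ : ℝ, ‖∑' k, a k * exp (I * (k.1 * θ₁ + k.2 * θ₂))‖ ≤ S) (K : ℤ × ℤ) :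
    ‖a K‖ ≤ S := by
  classical
  have s1 : ∀ θ₂ : ℝ, ‖∑' k : ℤ × ℤ, if k.1 = K.1 then a k * exp (I * (k.2 * θ₂)) else 0‖ ≤ S := by
    intro θ₂
    refine norm_tsum_ite_le (a := fun k => a k * exp (I * (k.2 * θ₂))) (fun k => k.1) ?_ ?_ K.1
    · exact ha.congr fun k => by rw [norm_mul, norm_exp_int_phase, mul_one]
    · intro θ₁
      refine le_of_eq_of_le ?_ (h θ₁ θ₂)
      congr 2; ext k
      rw [mul_assoc, ← exp_add]
      congr 2; ring
  have s2 := norm_tsum_ite_le (a := fun k : ℤ × ℤ => if k.1 = K.1 then a k else 0) (fun k => k.2)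
    (S := S) (ha.of_nonneg_of_le (fun _ => norm_nonneg _) fun k => by
      split_ifs
      · exact le_rfl
      · rw [norm_zero]; exact norm_nonneg _) (fun θ => by
      refine le_of_eq_of_le ?_ (s1 θ)
      congr 2; ext k
      split_ifs <;> simp) K.2
  rw [tsum_eq_single K] at s2
  · simpa using s2
  · intro k hk
    by_cases h2 : k.2 = K.2
    · rw [if_pos h2, if_neg fun h1 => hk (Prod.ext h1 h2)]
    · rw [if_neg h2]

variable {F : ℝ → ℝ → ℝ} {Fhat : ℤ × ℤ → ℂ} {r₁ r₂ : ℝ}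

theorem FourierUpper.exists_norm_le (h : FourierUpper r₁ r₂ Fhat) :
    ∃ M : ℝ, 0 < M ∧ ∀ k, ‖Fhat k‖ ≤ M * Real.exp (-wnorm r₁ r₂ k) := by
  obtain ⟨M, hM⟩ := h
  refine ⟨max M 1, by positivity, fun k => ?_⟩
  have := hM ⟨k, rfl⟩
  simp only [norm_mul, norm_real, Real.norm_of_nonneg (Real.exp_pos _).le] at this
  rw [Real.exp_neg, ← div_eq_mul_inv, le_div_iff₀ (Real.exp_pos _)]
  exact this.trans (le_max_left _ _)

theorem FourierUpper.summable (h₁ : 0 < r₁) (h₂ : 0 < r₂) (h : FourierUpper r₁ r₂ Fhat) :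
    Summable fun k => ‖Fhat k‖ := by
  obtain ⟨M, -, hM⟩ := h.exists_norm_le
  exact ((summable_exp_neg_wnorm h₁ h₂).mul_left M).of_nonneg_of_le (fun _ => norm_nonneg _) hM

theorem norm_exp_phase (k : ℤ × ℤ) (θ₁ θ₂ : ℝ) : ‖exp (I * (k.1 * θ₁ + k.2 * θ₂))‖ = 1 := by
  rw [mul_add, exp_add, norm_mul, norm_exp_int_phase, norm_exp_int_phase, mul_one]

theorem HasFourierExpansion.continuous_comp (hs : Summable fun k => ‖Fhat k‖)
    (hF : HasFourierExpansion F Fhat) {f g : ℝ → ℝ} (hf : Continuous f) (hg : Continuous g) :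
    Continuous fun s => F (f s) (g s) := by
  have h : Continuous fun s : ℝ => ∑' k : ℤ × ℤ, Fhat k * exp (I * (k.1 * (f s : ℂ) + k.2 * (g s : ℂ))) := by
    refine continuous_tsum (fun k => by fun_prop) hs fun k s => ?_
    rw [norm_mul, norm_exp_phase, mul_one]
  have h2 : (fun s => F (f s) (g s)) = fun s : ℝ =>
      (∑' k : ℤ × ℤ, Fhat k * exp (I * (k.1 * (f s : ℂ) + k.2 * (g s : ℂ)))).re := by
    ext s
    rw [(hF (f s) (g s)).tsum_eq, ofReal_re]
  rw [h2]
  exact continuous_re.comp h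

theorem HasFourierExpansion.abs_le (hs : Summable fun k => ‖Fhat k‖)
    (hF : HasFourierExpansion F Fhat) (θ₁ θ₂ : ℝ) : |F θ₁ θ₂| ≤ ∑' k, ‖Fhat k‖ := by
  have h := hF θ₁ θ₂
  rw [← Real.norm_eq_abs, ← norm_real, ← h.tsum_eq]
  refine tsum_of_norm_bounded hs.hasSum fun k => ?_
  rw [norm_mul, norm_exp_phase, mul_one]

theorem integrable_melnikovIntegrand (hs : Summable fun k => ‖Fhat k‖)
    (hF : HasFourierExpansion F Fhat) {ε α : ℝ} (h0 : 0 ≤ α) (h1 : α < 1) (u θ₁ θ₂ : ℝ) :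
    Integrable (melnikovIntegrand F ε α u θ₁ θ₂) := by
  have hβ : Integrable fun s => β α (u + s) := (integrable_β h0 h1).comp_add_left u
  refine hβ.mul_bdd (c := ∑' k, ‖Fhat k‖) (Continuous.aestronglyMeasurable ?_)
    (Eventually.of_forall fun s => hF.abs_le hs _ _)
  exact hF.continuous_comp hs (by fun_prop) (by fun_prop)

/-- The Fourier coefficients of the Melnikov function. -/
def melnikovCoeff (Fhat : ℤ × ℤ → ℂ) (ε α u : ℝ) (k : ℤ × ℤ) : ℂ :=
  4 * (Fhat k * exp (-(I * ((freq k / ε : ℝ) * u))) * bhat α (freq k / ε))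

theorem norm_melnikovCoeff (ε α u : ℝ) (k : ℤ × ℤ) :
    ‖melnikovCoeff Fhat ε α u k‖ = 4 * (‖Fhat k‖ * ‖bhat α (freq k / ε)‖) := by
  rw [melnikovCoeff, norm_mul, norm_mul, norm_mul, ← mul_neg, ← mul_neg, ← ofReal_neg,
    norm_exp_I_mul_mul]
  simp

/-- Sum and integral are exchanged by absolute convergence. The substitution u + s ↦ s turns each
integral into `bhat` and leaves u only in a phase. -/
theorem hasSum_melnikov (hs : Summable fun k => ‖Fhat k‖) (hF : HasFourierExpansion F Fhat)
    {ε α : ℝ} (h0 : 0 ≤ α) (h1 : α < 1) (u θ₁ θ₂ : ℝ) :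
    HasSum (fun k : ℤ × ℤ => melnikovCoeff Fhat ε α u k * exp (I * (k.1 * θ₁ + k.2 * θ₂)))
      ((melnikov F ε α u θ₁ θ₂ : ℝ) : ℂ) := by
  have hβ : Integrable fun s => β α (u + s) := (integrable_β h0 h1).comp_add_left u
  set f : ℤ × ℤ → ℝ → ℂ := fun k s => (β α (u + s) : ℂ) *
    (Fhat k * exp (I * (k.1 * ((θ₁ + s / ε : ℝ) : ℂ) + k.2 * ((θ₂ + γ * s / ε : ℝ) : ℂ)))) with hf
  have hfn : ∀ k s, ‖f k s‖ = |β α (u + s)| * ‖Fhat k‖ := fun k s => by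
    rw [hf, norm_mul, norm_mul, norm_exp_phase, mul_one, norm_real, Real.norm_eq_abs]
  have hfi : ∀ k, Integrable (f k) := fun k => by
    refine hβ.ofReal.mul_bdd (c := ‖Fhat k‖) (Continuous.aestronglyMeasurable (by fun_prop))
      (Eventually.of_forall fun s => ?_)
    rw [norm_mul, norm_exp_phase, mul_one]
  have hfs : Summable fun k => ∫ s, ‖f k s‖ := by
    simp only [hfn, integral_mul_const]
    exact hs.mul_left _
  have key := hasSum_integral_of_summable_integral_norm hfi hfs
  have hval : ∀ s, ∑' k, f k s = ((melnikovIntegrand F ε α u θ₁ θ₂ s : ℝ) : ℂ) := fun s => by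
    rw [melnikovIntegrand, ofReal_mul, ← (hF (θ₁ + s / ε) (θ₂ + γ * s / ε)).tsum_eq, ← tsum_mul_left]
  simp only [hval] at key
  rw [integral_complex_ofReal] at key
  have key2 := key.mul_left 4
  rw [melnikov, ofReal_mul, ofReal_ofNat]
  refine key2.congr_fun ?_
  intro k
  have hshift : ∫ s, f k s = ∫ s : ℝ, ((β α s : ℂ) * exp (I * ((freq k / ε : ℝ) * s))) *
      (Fhat k * exp (-(I * ((freq k / ε : ℝ) * u))) * exp (I * (k.1 * θ₁ + k.2 * θ₂))) := by
    rw [← integral_add_left_eq_self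
      (fun s : ℝ => ((β α s : ℂ) * exp (I * ((freq k / ε : ℝ) * s))) * (Fhat k *
        exp (-(I * ((freq k / ε : ℝ) * u))) * exp (I * (k.1 * θ₁ + k.2 * θ₂)))) u]
    congr 1; ext s
    rw [hf]
    have e : exp (I * (k.1 * ((θ₁ + s / ε : ℝ) : ℂ) + k.2 * ((θ₂ + γ * s / ε : ℝ) : ℂ))) =
        exp (I * ((freq k / ε : ℝ) * ((u + s : ℝ) : ℂ))) * (exp (-(I * ((freq k / ε : ℝ) * u))) *
          exp (I * (k.1 * θ₁ + k.2 * θ₂))) := by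
      rw [← exp_add, ← exp_add, freq]
      congr 1
      push_cast; ring
    simp only [e]
    ring
  rw [hshift, integral_mul_const, ← bhat, melnikovCoeff]
  ring

theorem summable_melnikovCoeff (hs : Summable fun k => ‖Fhat k‖) {ε α : ℝ} (u : ℝ) :
    Summable fun k => ‖melnikovCoeff Fhat ε α u k‖ := by
  simp only [norm_melnikovCoeff]
  refine ((hs.mul_right (∫ x, ‖(β α x : ℂ)‖)).of_nonneg_of_le (fun k => by positivity)
    fun k => ?_).mul_left 4
  refine mul_le_mul_of_nonneg_left ?_ (norm_nonneg _)
  refine (norm_integral_le_integral_norm _).trans_eq ?_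
  congr 1; ext x
  rw [norm_mul, norm_exp_I_mul_mul, mul_one]

theorem abs_melnikov_le (hs : Summable fun k => ‖Fhat k‖) (hF : HasFourierExpansion F Fhat)
    {ε α : ℝ} (h0 : 0 ≤ α) (h1 : α < 1) (u θ₁ θ₂ : ℝ) :
    |melnikov F ε α u θ₁ θ₂| ≤ ∑' k, 4 * (‖Fhat k‖ * ‖bhat α (freq k / ε)‖) := by
  have h := hasSum_melnikov hs hF (ε := ε) h0 h1 u θ₁ θ₂
  have hsum := summable_melnikovCoeff hs (ε := ε) (α := α) u
  simp only [norm_melnikovCoeff] at hsum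
  rw [← Real.norm_eq_abs, ← norm_real, ← h.tsum_eq]
  refine tsum_of_norm_bounded hsum.hasSum fun k => ?_
  rw [norm_mul, norm_exp_phase, mul_one, norm_melnikovCoeff]

theorem bddAbove_melnikovValues (hs : Summable fun k => ‖Fhat k‖) (hF : HasFourierExpansion F Fhat)
    {ε α : ℝ} (h0 : 0 ≤ α) (h1 : α < 1) (u₀ : ℝ) : BddAbove (melnikovValues F ε α u₀) := by
  refine ⟨∑' k, 4 * (‖Fhat k‖ * ‖bhat α (freq k / ε)‖), ?_⟩
  rintro m ⟨u, θ₁, θ₂, -, rfl⟩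
  exact abs_melnikov_le hs hF h0 h1 u θ₁ θ₂

theorem melnikovSup_le (hs : Summable fun k => ‖Fhat k‖) (hF : HasFourierExpansion F Fhat)
    {ε α u₀ : ℝ} (h0 : 0 ≤ α) (h1 : α < 1) (hu : 0 < u₀) :
    melnikovSup F ε α u₀ ≤ ∑' k, 4 * (‖Fhat k‖ * ‖bhat α (freq k / ε)‖) := by
  refine csSup_le ⟨_, 0, 0, 0, ⟨by linarith, hu⟩, rfl⟩ ?_
  rintro m ⟨u, θ₁, θ₂, -, rfl⟩
  exact abs_melnikov_le hs hF h0 h1 u θ₁ θ₂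

theorem norm_coeff_le_melnikovSup (hs : Summable fun k => ‖Fhat k‖)
    (hF : HasFourierExpansion F Fhat) {ε α u₀ : ℝ} (h0 : 0 ≤ α) (h1 : α < 1) (hu : 0 < u₀)
    (k : ℤ × ℤ) : 4 * (‖Fhat k‖ * ‖bhat α (freq k / ε)‖) ≤ melnikovSup F ε α u₀ := by
  rw [← norm_melnikovCoeff ε α 0]
  refine norm_coeff_le_of_forall_norm_tsum_le (summable_melnikovCoeff hs 0) (fun θ₁ θ₂ => ?_) k
  rw [(hasSum_melnikov hs hF h0 h1 0 θ₁ θ₂).tsum_eq, norm_real, Real.norm_eq_abs]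
  exact le_csSup (bddAbove_melnikovValues hs hF h0 h1 u₀) ⟨0, θ₁, θ₂, ⟨by linarith, hu⟩, rfl⟩

end
end MelnikovQP

/-! ### From the transform to the supremum; the case of small `α`. -/

namespace MelnikovQP

noncomputable section

open Filter Topology

variable {F : ℝ → ℝ → ℝ} {Fhat : ℤ × ℤ → ℂ} {r₁ r₂ : ℝ}

/-- A bound for `bhat` gives a bound for the Melnikov function. -/
theorem exists_melnikovSup_le (hr₁ : 0 < r₁) (hr₂ : 0 < r₂) (hF : HasFourierExpansion F Fhat)
    (hmean : Fhat (0, 0) = 0) (hupper : FourierUpper r₁ r₂ Fhat) {u₀ : ℝ} (hu₀ : 0 < u₀) :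
    ∃ C X₀ : ℝ, 0 < C ∧ 1 ≤ X₀ ∧ ∀ ε α y P : ℝ, 0 < ε → 0 ≤ α → α < 1 → 0 < y → 0 ≤ P →
      X₀ ≤ Real.sqrt (y / ε) →
      (∀ w, 0 < w → ‖bhat α w‖ ≤ P * ((Real.sqrt (y * ε) * w) ^ 2 + (Real.sqrt (y * ε) * w)⁻¹) *
        Real.exp (-(w * y))) →
      melnikovSup F ε α u₀ ≤
        C * P * Real.exp (-(c r₁ r₂ (Real.log (ε / y)) * Real.sqrt (y / ε))) := by
  obtain ⟨C, X₀, hC, hX₀, hsum⟩ := exists_expTerm_sum_le hr₁ hr₂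
  obtain ⟨M, hM, hFM⟩ := hupper.exists_norm_le
  have hs := hupper.summable hr₁ hr₂
  refine ⟨4 * M * C, X₀, by positivity, hX₀, ?_⟩
  intro ε α y P hε h0 h1 hy hP hX hb
  obtain ⟨hS, hle⟩ := hsum _ hX
  set X := Real.sqrt (y / ε) with hXdef
  have hX2 : X ^ 2 = y / ε := Real.sq_sqrt (by positivity)
  have e1 : 1 / X ^ 2 = ε / y := by rw [hX2, one_div_div]
  rw [e1] at hle
  -- This explains the scaling √(yε) w in the hypothesis: at w = |ω|/ε it becomes X|ω|, the variable
  -- of `expTerm`.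
  have hscale : ∀ x : ℝ, Real.sqrt (y * ε) * (x / ε) = X * x := fun x => by
    have : y * ε = y / ε * ε ^ 2 := by field_simp
    rw [this, Real.sqrt_mul (by positivity), Real.sqrt_sq hε.le, ← hXdef]
    field_simp
  have hterm : ∀ k, 4 * (‖Fhat k‖ * ‖bhat α (freq k / ε)‖) ≤ 4 * M * P * expTerm r₁ r₂ X k := by
    intro k
    by_cases hk : k = 0
    · have : Fhat k = 0 := by rw [hk]; exact hmean
      rw [this, hk, expTerm_zero]; simp
    · have hf : 0 < |freq k| := abs_pos.2 (freq_ne_zero hk)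
      have hb' := hb (|freq k| / ε) (by positivity)
      rw [hscale] at hb'
      have e2 : |freq k| / ε = |freq k / ε| := by rw [abs_div, abs_of_pos hε]
      have e3 : |freq k| / ε * y = X ^ 2 * |freq k| := by rw [hX2]; field_simp
      rw [e3, e2, norm_bhat_abs] at hb'
      have h3 := mul_le_mul (hFM k) hb' (norm_nonneg _) (by positivity)
      rw [expTerm, neg_add, Real.exp_add]
      linarith
  calc melnikovSup F ε α u₀ ≤ ∑' k, 4 * (‖Fhat k‖ * ‖bhat α (freq k / ε)‖) :=
        melnikovSup_le hs hF h0 h1 hu₀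
    _ ≤ ∑' k, 4 * M * P * expTerm r₁ r₂ X k := by
        refine Summable.tsum_le_tsum hterm ?_ (hS.mul_left _)
        exact (hS.mul_left _).of_nonneg_of_le (fun _ => by positivity) hterm
    _ = 4 * M * P * ∑' k, expTerm r₁ r₂ X k := tsum_mul_left
    _ ≤ 4 * M * P * (C * Real.exp (-(c r₁ r₂ (Real.log (ε / y)) * X))) :=
        mul_le_mul_of_nonneg_left hle (by positivity)
    _ = _ := by ring

/-- The dominant Fourier coefficient gives a lower bound for the Melnikov function. -/
theorem exists_le_melnikovSup (hr₁ : 0 < r₁) (hr₂ : 0 < r₂) (hF : HasFourierExpansion F Fhat)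
    (hupper : FourierUpper r₁ r₂ Fhat) (hlower : FourierLower r₁ r₂ Fhat)
    {u₀ : ℝ} (hu₀ : 0 < u₀) :
    ∃ C X₀ : ℝ, 0 < C ∧ ∀ ε α y : ℝ, 0 < ε → 0 ≤ α → α < 1 → 0 < y →
      X₀ ≤ Real.sqrt (y / ε) →
      ∃ w, 0 < w ∧ decayRate r₁ r₂ / γ ≤ y * ε * w ^ 2 ∧ y * ε * w ^ 2 ≤ γ * decayRate r₁ r₂ ∧
        C * Real.exp (-(c r₁ r₂ (Real.log (ε / y)) * Real.sqrt (y / ε))) *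
          (Real.exp (w * y) * ‖bhat α w‖) ≤ melnikovSup F ε α u₀ := by
  obtain ⟨a, ha, k₀, hk₀⟩ := hlower
  have hs := hupper.summable hr₁ hr₂
  have hL := decayRate_pos hr₁ hr₂
  have hγ := γ_pos
  set L := decayRate r₁ r₂ with hLdef
  -- The margin 6 makes the minimising index m at least 5, so that m ≤ fib m and hence |k₂| = fib m
  -- > k₀.
  set N : ℕ := k₀ + 6
  refine ⟨4 * a * Real.exp (-decayDefect r₁ r₂), γ * L * (γ ^ N) ^ 2 + 1, by positivity, ?_⟩
  intro ε α y hε h0 h1 hy hX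
  set X := Real.sqrt (y / ε) with hXdef
  have hX2 : X ^ 2 = y / ε := Real.sq_sqrt (by positivity)
  have hN0 : 0 ≤ γ * L * (γ ^ N) ^ 2 := by positivity
  have hX0 : 0 < X := by linarith
  have hX1 : 1 ≤ X := by linarith
  obtain ⟨n, hc, hn₁, hn₂⟩ := c_attained hr₁ hr₂ hX0
  rw [hX2, one_div_div, ← hLdef] at hc
  rw [← hLdef] at hn₁ hn₂
  have hgn : 0 < γ ^ n := zpow_pos hγ n
  have hnN : (N : ℤ) < n := by
    have h3 : (γ ^ N) ^ 2 < (γ ^ n) ^ 2 := by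
      have : γ * L * (γ ^ N) ^ 2 < γ * L * (γ ^ n) ^ 2 := by nlinarith
      exact lt_of_mul_lt_mul_left this (by positivity)
    have h4 : γ ^ (N : ℤ) < γ ^ n := by
      rw [zpow_natCast]
      exact lt_of_pow_lt_pow_left₀ 2 hgn.le h3
    exact (zpow_lt_zpow_iff_right₀ one_lt_γ).1 h4
  obtain ⟨m, rfl⟩ := Int.eq_ofNat_of_zero_le (by omega : 0 ≤ n)
  simp only [zpow_natCast, energy] at *
  have hmN : N < m := by exact_mod_cast hnN
  refine ⟨(γ ^ m)⁻¹ / ε, by positivity, ?_, ?_, ?_⟩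
  · have : y * ε * ((γ ^ m)⁻¹ / ε) ^ 2 = X ^ 2 / (γ ^ m) ^ 2 := by rw [hX2]; field_simp
    rw [this, div_le_div_iff₀ hγ (by positivity)]
    linarith
  · have : y * ε * ((γ ^ m)⁻¹ / ε) ^ 2 = X ^ 2 / (γ ^ m) ^ 2 := by rw [hX2]; field_simp
    rw [this, div_le_iff₀ (by positivity)]
    linarith
  · obtain ⟨m', rfl⟩ := Nat.exists_eq_succ_of_ne_zero (by omega : m ≠ 0)
    have hconv := isConvergentIndex_fibIndex m'
    have hfib : (k₀ : ℤ) < |(fibIndex (m' + 1)).2| := by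
      rw [abs_fibIndex_snd]
      have := Nat.le_fib_self (n := m' + 1) (by omega)
      exact_mod_cast (by omega : k₀ < Nat.fib (m' + 1))
    have hre := (hk₀ _ hconv hfib).2
    have hw := wnorm_fibIndex_le hr₁ hr₂ (m' + 1)
    have hnorm : a * Real.exp (-wnorm r₁ r₂ (fibIndex (m' + 1))) ≤ ‖Fhat (fibIndex (m' + 1))‖ := by
      refine le_trans ?_ (hre.le.trans (Complex.re_le_norm _))
      refine le_of_eq ?_
      congr 2
      rw [wnorm]; ring
    have hb : ‖bhat α (freq (fibIndex (m' + 1)) / ε)‖ = ‖bhat α ((γ ^ (m' + 1))⁻¹ / ε)‖ := by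
      rw [← norm_bhat_abs, abs_div, abs_of_pos hε, abs_freq_fibIndex]
    refine le_trans ?_ (norm_coeff_le_melnikovSup hs hF h0 h1 hu₀ (fibIndex (m' + 1)))
    rw [hb, hc]
    have e3 : (γ ^ (m' + 1))⁻¹ / ε * y = X ^ 2 * (γ ^ (m' + 1))⁻¹ := by rw [hX2]; field_simp
    rw [e3]
    have h5 : Real.exp (-decayDefect r₁ r₂) *
        Real.exp (-(L * γ ^ (m' + 1) + X ^ 2 * (γ ^ (m' + 1))⁻¹)) *
        Real.exp (X ^ 2 * (γ ^ (m' + 1))⁻¹) ≤ Real.exp (-wnorm r₁ r₂ (fibIndex (m' + 1))) := by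
      rw [← Real.exp_add, ← Real.exp_add, Real.exp_le_exp]
      linarith
    have h6 := mul_le_mul_of_nonneg_right ((mul_le_mul_of_nonneg_left h5 ha.le).trans hnorm)
      (norm_nonneg (bhat α ((γ ^ (m' + 1))⁻¹ / ε)))
    simp only [Nat.succ_eq_add_one]
    linarith

theorem exists_pos_of_eventually {P : ℝ → Prop} (h : ∀ᶠ ε in 𝓝[>] (0 : ℝ), P ε) :
    ∃ ε₀ : ℝ, 0 < ε₀ ∧ ∀ ε, 0 < ε → ε < ε₀ → P ε := by
  obtain ⟨ε₀, hε₀, hsub⟩ := mem_nhdsGT_iff_exists_Ioo_subset.1 h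
  exact ⟨ε₀, hε₀, fun ε h1 h2 => hsub ⟨h1, h2⟩⟩

theorem eventually_le_nhdsGT_zero {z : ℝ} (hz : 0 < z) : ∀ᶠ ε in 𝓝[>] (0 : ℝ), 0 < ε ∧ ε ≤ z := by
  filter_upwards [Ioo_mem_nhdsGT hz] with ε hε
  exact ⟨hε.1, hε.2.le⟩

theorem eventually_mul_rpow_le {p z : ℝ} (K : ℝ) (hp : 0 < p) (hz : 0 < z) :
    ∀ᶠ ε in 𝓝[>] (0 : ℝ), K * ε ^ p ≤ z := by
  have h : Tendsto (fun ε : ℝ => K * ε ^ p) (𝓝[>] 0) (𝓝 (K * 0)) := by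
    refine Tendsto.const_mul K ?_
    have := (Real.continuousAt_rpow_const 0 p (Or.inr hp.le)).tendsto
    rw [Real.zero_rpow hp.ne'] at this
    exact this.mono_left nhdsWithin_le_nhds
  rw [mul_zero] at h
  exact h.eventually (eventually_le_nhds hz)

theorem le_sqrt_div_of_le {X₀ y ε : ℝ} (hX₀ : 0 < X₀) (hε : 0 < ε)
    (h : X₀ ^ 2 * ε ≤ y) : X₀ ≤ Real.sqrt (y / ε) := by
  rw [Real.le_sqrt' hX₀, le_div_iff₀ hε]
  exact h

theorem c_mul_le_energy {X : ℝ} (h₁ : 0 < r₁) (h₂ : 0 < r₂) (hX : 0 < X)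
    (hlarge : 16 * γ ≤ decayRate r₁ r₂ * X ^ 2) (m : ℤ) :
    c r₁ r₂ (Real.log (1 / X ^ 2)) * X ≤ energy (decayRate r₁ r₂) X m := by
  obtain ⟨n, hc, hn₁, hn₂⟩ := c_attained h₁ h₂ hX
  rw [hc]
  have h := energy_ge (decayRate_pos h₁ h₂) hX hn₁ hn₂ hlarge (m - n)
  rw [add_sub_cancel] at h
  by_cases hmn : m = n
  · rw [hmn]
  · have : (1 : ℝ) ≤ |((m - n : ℤ) : ℝ)| := by
      exact_mod_cast Int.one_le_abs (sub_ne_zero.2 hmn)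
    linarith

theorem arcsin_sqrt_bounds {α : ℝ} (h0 : 0 ≤ α) (h1 : α ≤ 1 / 2) :
    1 / 2 ≤ Real.arcsin (Real.sqrt (1 - α)) ∧ Real.arcsin (Real.sqrt (1 - α)) ≤ Real.pi / 2 ∧
      Real.pi / 2 - Real.arcsin (Real.sqrt (1 - α)) ≤ 2 * Real.sqrt α := by
  refine ⟨?_, Real.arcsin_le_pi_div_two _, ?_⟩
  · have h2 : 1 / 2 ≤ Real.sqrt (1 - α) := by
      rw [Real.le_sqrt' (by norm_num)]; linarith
    have h3 : Real.sqrt (1 - α) ≤ 1 := Real.sqrt_le_one.2 (by linarith)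
    have h4 := Real.sin_le (Real.arcsin_nonneg.2 (Real.sqrt_nonneg (1 - α)))
    rw [Real.sin_arcsin (by linarith) h3] at h4
    linarith
  · rcases h0.eq_or_lt with rfl | h0
    · simp
    · obtain ⟨ρ, hρ, -⟩ := existsUnique_rhoMinus h0 (by linarith : α < 1)
      rw [← im_rhoMinus h0 (by linarith) hρ]
      exact (pi_div_two_sub_im_bounds h0 (by linarith) hρ).2

/-- The exponent is stable under perturbations of `y` near `π / 2`. -/
theorem c_mul_sqrt_le {ε y K : ℝ} (hr₁ : 0 < r₁) (hr₂ : 0 < r₂) (hε : 0 < ε) (hK : 0 ≤ K)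
    (hy1 : 1 / 2 ≤ y) (hy4 : (Real.pi / 2 - y) ^ 2 ≤ 4 * (K * ε))
    (hε4 : 16 * γ / decayRate r₁ r₂ * ε ≤ 1) :
    c r₁ r₂ (Real.log (2 * ε / Real.pi)) * Real.sqrt (Real.pi / (2 * ε)) ≤
      c r₁ r₂ (Real.log (ε / y)) * Real.sqrt (y / ε) + (1 + 8 * K * γ * decayRate r₁ r₂) := by
  have hL := decayRate_pos hr₁ hr₂
  have hγ := γ_pos
  have hpi3 := Real.pi_gt_three
  set L := decayRate r₁ r₂ with hLdef
  have hy0 : 0 < y := by linarith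
  set X := Real.sqrt (y / ε) with hX
  set X' := Real.sqrt (Real.pi / (2 * ε)) with hX'
  have hXsq : X ^ 2 = y / ε := Real.sq_sqrt (by positivity)
  have hXsq' : X' ^ 2 = Real.pi / (2 * ε) := Real.sq_sqrt (by positivity)
  have hXpos : 0 < X := Real.sqrt_pos.2 (by positivity)
  have hXpos' : 0 < X' := Real.sqrt_pos.2 (by positivity)
  -- The minimiser n for y serves as a competitor for π/2, so only the energy difference (π/2 - y)
  -- γ⁻ⁿ / ε has to be bounded. Here π/2 - y = O(√ε) and γ⁻ⁿ = O(√ε).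
  obtain ⟨n, hn, hn₁, hn₂⟩ := c_attained hr₁ hr₂ hXpos
  rw [← hLdef] at hn hn₁ hn₂
  have hlarge : 16 * γ ≤ L * X' ^ 2 := by
    have e : L * (Real.pi / (2 * ε)) = L * Real.pi / (2 * ε) := by ring
    rw [hXsq', e, le_div_iff₀ (by positivity)]
    rw [div_mul_eq_mul_div, div_le_iff₀ hL] at hε4
    nlinarith
  have hmin := c_mul_le_energy hr₁ hr₂ hXpos' hlarge n
  rw [hXsq, one_div_div] at hn
  rw [hXsq', one_div_div, ← hLdef] at hmin
  have hgn : 0 < γ ^ n := zpow_pos hγ n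
  rw [hn]
  suffices hd : X' ^ 2 * (γ ^ n)⁻¹ - X ^ 2 * (γ ^ n)⁻¹ ≤ 1 + 8 * K * γ * L by
    simp only [energy] at hmin ⊢
    linarith
  set d := X' ^ 2 * (γ ^ n)⁻¹ - X ^ 2 * (γ ^ n)⁻¹ with hd
  have hd1 : d = (Real.pi / 2 - y) / ε * (γ ^ n)⁻¹ := by
    rw [hd, hXsq, hXsq']; field_simp
  have hinv : ((γ ^ n)⁻¹) ^ 2 ≤ 2 * γ * L * ε := by
    have h3 : ((γ ^ n)⁻¹) ^ 2 * X ^ 2 ≤ γ * L := by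
      rw [inv_pow, inv_mul_le_iff₀ (by positivity)]; linarith
    rw [hXsq] at h3
    have h4 : ((γ ^ n)⁻¹) ^ 2 * y ≤ γ * L * ε := by
      have : ((γ ^ n)⁻¹) ^ 2 * y = ((γ ^ n)⁻¹) ^ 2 * (y / ε) * ε := by field_simp
      rw [this]; exact mul_le_mul_of_nonneg_right h3 hε.le
    nlinarith [sq_nonneg ((γ ^ n)⁻¹)]
  have hd2 : d ^ 2 ≤ 8 * K * γ * L := by
    have h8 := mul_le_mul hy4 hinv (sq_nonneg _) (by positivity)
    have e : d ^ 2 = (Real.pi / 2 - y) ^ 2 * ((γ ^ n)⁻¹) ^ 2 / ε ^ 2 := by rw [hd1]; ring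
    rw [e, div_le_iff₀ (by positivity)]
    linarith
  nlinarith [sq_nonneg (d - 1)]

/-- Upper bound when `α = O(ε)`. -/
theorem exists_upper_of_small (hr₁ : 0 < r₁) (hr₂ : 0 < r₂) (hF : HasFourierExpansion F Fhat)
    (hmean : Fhat (0, 0) = 0) (hupper : FourierUpper r₁ r₂ Fhat) {u₀ : ℝ} (hu₀ : 0 < u₀)
    {K : ℝ} (hK : 0 ≤ K) :
    ∃ ε₀ C₂ : ℝ, 0 < ε₀ ∧ 0 < C₂ ∧ ∀ ε α : ℝ, 0 < ε → ε < ε₀ → 0 ≤ α → α ≤ K * ε →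
      melnikovSup F ε α u₀ ≤
        C₂ / ε * Real.exp (-(c r₁ r₂ (Real.log (2 * ε / Real.pi)) *
          Real.sqrt (Real.pi / (2 * ε)))) := by
  obtain ⟨C, X₀, hC, hX₀, hsup⟩ := exists_melnikovSup_le hr₁ hr₂ hF hmean hupper hu₀
  have hL := decayRate_pos hr₁ hr₂
  have hγ := γ_pos
  have hpi3 := Real.pi_gt_three
  have hpi4 := Real.pi_lt_four
  set L := decayRate r₁ r₂ with hLdef
  obtain ⟨ε₀, hε₀, hev⟩ := exists_pos_of_eventually
    ((eventually_le_nhdsGT_zero one_pos).and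
      ((eventually_mul_rpow_le K one_pos (by norm_num : (0 : ℝ) < 1 / 2)).and
        ((eventually_mul_rpow_le (X₀ ^ 2) one_pos (by norm_num : (0 : ℝ) < 1 / 2)).and
          (eventually_mul_rpow_le (16 * γ / L) one_pos one_pos))))
  refine ⟨ε₀, C * 400 * Real.exp (1 + 8 * K * γ * L), hε₀, by positivity, ?_⟩
  intro ε α hε hε' h0 hα
  obtain ⟨⟨-, hε1⟩, hε2, hε3, hε4⟩ := hev ε hε hε'
  rw [Real.rpow_one] at hε2 hε3 hε4
  have hα2 : α ≤ 1 / 2 := by linarith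
  obtain ⟨hy1, hy2, hy3⟩ := arcsin_sqrt_bounds h0 hα2
  set y := Real.arcsin (Real.sqrt (1 - α)) with hy
  have hy0 : 0 < y := by linarith
  have hb : ∀ w, 0 < w → ‖bhat α w‖ ≤ 400 / ε *
      ((Real.sqrt (y * ε) * w) ^ 2 + (Real.sqrt (y * ε) * w)⁻¹) * Real.exp (-(w * y)) := by
    intro w hw
    refine (norm_bhat_le_of_small h0 hα2 hw).trans ?_
    refine mul_le_mul_of_nonneg_right ?_ (Real.exp_pos _).le
    set η := Real.sqrt (y * ε)
    have hη0 : 0 < η := Real.sqrt_pos.2 (by positivity)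
    have hη2 : η ^ 2 = y * ε := Real.sq_sqrt (by positivity)
    have a1 : w ^ 2 ≤ 2 / ε * (η * w) ^ 2 := by
      rw [mul_pow, hη2]
      have : 2 / ε * (y * ε * w ^ 2) = 2 * y * w ^ 2 := by field_simp
      rw [this]; nlinarith [sq_nonneg w]
    have a2 : w⁻¹ ≤ 2 / ε * (η * w)⁻¹ := by
      rw [mul_inv]
      have hη1 : η * ε ≤ 2 := by
        have : η ≤ 2 := by
          refine le_of_sq_le_sq ?_ (by norm_num)
          rw [hη2]; nlinarith
        nlinarith
      have : 2 / ε * (η⁻¹ * w⁻¹) = 2 / (η * ε) * w⁻¹ := by field_simp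
      rw [this]
      refine le_mul_of_one_le_left (by positivity) ?_
      rwa [le_div_iff₀ (by positivity), one_mul]
    have e : 400 / ε * ((η * w) ^ 2 + (η * w)⁻¹) =
        200 * (2 / ε * (η * w) ^ 2 + 2 / ε * (η * w)⁻¹) := by ring
    rw [e]; linarith
  have h := hsup ε α y (400 / ε) hε h0 (by linarith) hy0 (by positivity)
    (le_sqrt_div_of_le (by linarith) hε (by linarith)) hb
  refine h.trans ?_
  have e0 : C * 400 * Real.exp (1 + 8 * K * γ * L) / ε *
      Real.exp (-(c r₁ r₂ (Real.log (2 * ε / Real.pi)) * Real.sqrt (Real.pi / (2 * ε)))) =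
      C * (400 / ε) * (Real.exp (1 + 8 * K * γ * L) *
      Real.exp (-(c r₁ r₂ (Real.log (2 * ε / Real.pi)) * Real.sqrt (Real.pi / (2 * ε))))) := by ring
  rw [e0, ← Real.exp_add]
  refine mul_le_mul_of_nonneg_left (Real.exp_le_exp.2 ?_) (by positivity)
  have hy4 : (Real.pi / 2 - y) ^ 2 ≤ 4 * (K * ε) := by
    have : (Real.pi / 2 - y) ^ 2 ≤ (2 * Real.sqrt α) ^ 2 :=
      pow_le_pow_left₀ (by linarith) hy3 2
    rw [mul_pow, Real.sq_sqrt h0] at this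
    linarith
  have := c_mul_sqrt_le hr₁ hr₂ hε hK hy1 hy4 hε4
  rw [← hLdef] at this
  linarith

/-- Lower bound when `α = o(ε)`. -/
theorem exists_lower_of_small (hr₁ : 0 < r₁) (hr₂ : 0 < r₂) (hF : HasFourierExpansion F Fhat)
    (hupper : FourierUpper r₁ r₂ Fhat) (hlower : FourierLower r₁ r₂ Fhat)
    {u₀ : ℝ} (hu₀ : 0 < u₀) {ν K : ℝ} (hν : 1 < ν) :
    ∃ ε₀ C₁ : ℝ, 0 < ε₀ ∧ 0 < C₁ ∧ ∀ ε α : ℝ, 0 < ε → ε < ε₀ → 0 ≤ α → α < 1 → α ≤ K * ε ^ ν →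
      C₁ / ε * Real.exp (-(c r₁ r₂ (Real.log (2 * ε / Real.pi)) *
          Real.sqrt (Real.pi / (2 * ε)))) ≤ melnikovSup F ε α u₀ := by
  obtain ⟨C, X₀, hC, hinf⟩ := exists_le_melnikovSup hr₁ hr₂ hF hupper hlower hu₀
  have hL := decayRate_pos hr₁ hr₂
  have hγ := γ_pos
  have hpi3 := Real.pi_gt_three
  have hpi4 := Real.pi_lt_four
  set L := decayRate r₁ r₂ with hLdef
  obtain ⟨ε₀, hε₀, hev⟩ := exists_pos_of_eventually
    ((eventually_mul_rpow_le K (by linarith : 0 < ν) (by norm_num : (0 : ℝ) < 1 / 2)).and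
      ((eventually_mul_rpow_le (γ * L * K) (by linarith : 0 < ν - 1) one_pos).and
        ((eventually_mul_rpow_le ((max X₀ 1) ^ 2) one_pos one_pos).and
          (eventually_mul_rpow_le (300 * γ / L) one_pos one_pos))))
  refine ⟨ε₀, C * (L / (4 * γ)), hε₀, by positivity, ?_⟩
  intro ε α hε hε' h0 h1 hα
  obtain ⟨hε1, hε2, hε3, hε4⟩ := hev ε hε hε'
  rw [Real.rpow_one] at hε3 hε4
  have hX : X₀ ≤ Real.sqrt (Real.pi / 2 / ε) :=
    (le_max_left X₀ 1).trans (le_sqrt_div_of_le (by positivity) hε (by linarith))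
  obtain ⟨w, hw, hw1, hw2, hle⟩ := hinf ε α (Real.pi / 2) hε h0 h1 (by linarith) hX
  have e1 : ε / (Real.pi / 2) = 2 * ε / Real.pi := by field_simp
  have e2 : Real.pi / 2 / ε = Real.pi / (2 * ε) := by field_simp
  rw [e1, e2] at hle
  refine le_trans ?_ hle
  have hb := norm_bhat_ge_of_small h0 (hα.trans hε1) hw
  have hεν : ε ^ ν = ε ^ (ν - 1) * ε := by
    rw [← Real.rpow_add_one hε.ne']; congr 1; ring
  -- At the minimiser w²ε ≤ γL, and ν > 1 makes α = o(ε). Thus w√α stays bounded and the poles act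
  -- as a double pole.
  have hwα : w ^ 2 * α ≤ 1 := by
    have h3 : w ^ 2 * ε ≤ γ * L := by nlinarith [mul_pos (pow_pos hw 2) hε]
    calc w ^ 2 * α ≤ w ^ 2 * (K * (ε ^ (ν - 1) * ε)) := by
          rw [← hεν]; exact mul_le_mul_of_nonneg_left hα (by positivity)
      _ = (K * ε ^ (ν - 1)) * (w ^ 2 * ε) := by ring
      _ ≤ (K * ε ^ (ν - 1)) * (γ * L) := by
          refine mul_le_mul_of_nonneg_left h3 ?_
          have : 0 ≤ K * ε ^ (ν - 1) * ε := by
            rw [mul_assoc, ← hεν]; linarith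
          exact nonneg_of_mul_nonneg_left this hε
      _ ≤ 1 := by linarith
  have hex : Real.exp (2 * w * Real.sqrt α) ≤ 9 := by
    have h3 : w * Real.sqrt α ≤ 1 := by
      refine le_of_sq_le_sq ?_ zero_le_one
      rw [mul_pow, Real.sq_sqrt h0]; linarith
    have h4 : Real.exp (2 * w * Real.sqrt α) ≤ Real.exp 1 ^ 2 := by
      rw [← Real.exp_nat_mul]
      refine Real.exp_le_exp.2 ?_
      push_cast; linarith
    have h5 := Real.exp_one_lt_three
    have h6 := Real.exp_pos 1
    nlinarith
  have hwbig : L / (2 * γ) / ε ≤ w ^ 2 := by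
    rw [div_le_iff₀ hε]
    have : L / (2 * γ) = L / γ / 2 := by field_simp
    rw [this]
    nlinarith [mul_pos (pow_pos hw 2) hε]
  -- With the exponential bounded by 9, the subtracted term is at most 72α; 144α ≤ w² makes this at
  -- most half of w².
  have hw150 : 144 * α ≤ w ^ 2 := by
    refine le_trans ?_ hwbig
    have : 150 ≤ L / (2 * γ) / ε := by
      rw [div_mul_eq_mul_div, div_le_iff₀ hL] at hε4
      rw [div_div, le_div_iff₀ (by positivity)]
      linarith
    linarith
  have hhalf : w ^ 2 / 2 ≤ w ^ 2 - 8 * α * Real.exp (2 * w * Real.sqrt α) := by nlinarith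
  have hfin : L / (4 * γ) / ε ≤ Real.exp (w * (Real.pi / 2)) * ‖bhat α w‖ := by
    have h7 : w ^ 2 / 2 ≤ Real.exp (w * (Real.pi / 2)) * ‖bhat α w‖ := by
      have h8 := mul_le_mul_of_nonneg_left
        ((mul_le_mul_of_nonneg_right hhalf (Real.exp_pos (-(w * (Real.pi / 2)))).le).trans hb)
        (Real.exp_pos (w * (Real.pi / 2))).le
      have h9 : Real.exp (w * (Real.pi / 2)) * (w ^ 2 / 2 * Real.exp (-(w * (Real.pi / 2)))) =
          w ^ 2 / 2 := by
        rw [mul_comm, mul_assoc, ← Real.exp_add, neg_add_cancel, Real.exp_zero, mul_one]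
      linarith
    refine le_trans ?_ h7
    have : L / (4 * γ) / ε = L / (2 * γ) / ε / 2 := by field_simp; norm_num
    rw [this]; linarith
  calc _ = C * Real.exp (-(c r₁ r₂ (Real.log (2 * ε / Real.pi)) *
          Real.sqrt (Real.pi / (2 * ε)))) * (L / (4 * γ) / ε) := by ring
    _ ≤ _ := mul_le_mul_of_nonneg_left hfin (by positivity)

end
end MelnikovQP

/-! ### The case of `α` bounded below by a multiple of ε^ν. -/

namespace MelnikovQP

noncomputable section

open Filter Topology

variable {F : ℝ → ℝ → ℝ} {Fhat : ℤ × ℤ → ℂ} {r₁ r₂ : ℝ}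

/-- The condition r < 2 means that ε is small compared with √(1 - α), which is of the order of Im
ρ₋, uniformly in α. This makes X large. -/
theorem eventually_le_mul_sqrt {r K z : ℝ} (hr : r < 2) (hK : 0 < K) (hz : 0 < z) :
    ∀ᶠ ε in 𝓝[>] (0 : ℝ), ∀ α : ℝ, α < 1 - K * ε ^ r → ε ≤ z * Real.sqrt (1 - α) := by
  filter_upwards [self_mem_nhdsWithin, eventually_mul_rpow_le 1 (by linarith : 0 < 2 - r)
    (by positivity : 0 < z ^ 2 * K)] with ε hε hε2 α hα
  have hε : 0 < ε := hε
  have hα' : K * ε ^ r ≤ 1 - α := by linarith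
  have hpos : 0 < K * ε ^ r := by positivity
  refine le_of_sq_le_sq ?_ (by positivity)
  rw [mul_pow, Real.sq_sqrt (by linarith)]
  have e : ε ^ 2 = ε ^ (2 - r) * ε ^ r := by
    rw [← Real.rpow_add hε, sub_add_cancel, Real.rpow_two]
  calc ε ^ 2 ≤ z ^ 2 * K * ε ^ r := by
        rw [e]; exact mul_le_mul_of_nonneg_right (by linarith) (by positivity)
    _ = z ^ 2 * (K * ε ^ r) := by ring
    _ ≤ _ := by gcongr

theorem im_rhoMinus_bounds {α : ℝ} {ρ : ℂ} (h0 : 0 < α) (h1 : α < 1) (hρ : IsRhoMinus α ρ) :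
    Real.sqrt (1 - α) ≤ ρ.im ∧ ρ.im ≤ 2 * Real.sqrt (1 - α) := by
  have hs := sin_im_rhoMinus_sq h0 h1 hρ
  have hpi := Real.pi_lt_four
  have hsin : 0 ≤ Real.sin ρ.im :=
    Real.sin_nonneg_of_nonneg_of_le_pi hρ.2.1.le (by linarith [hρ.2.2, Real.pi_pos])
  have e : Real.sin ρ.im = Real.sqrt (1 - α) := by rw [← hs, Real.sqrt_sq hsin]
  refine ⟨e ▸ Real.sin_le hρ.2.1.le, ?_⟩
  have := Real.mul_le_sin hρ.2.1.le hρ.2.2.le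
  rw [e, div_mul_eq_mul_div, div_le_iff₀ Real.pi_pos] at this
  nlinarith [Real.sqrt_nonneg (1 - α)]

theorem rpow_five_quarters {x y : ℝ} (hy : 0 ≤ y) (hxy : y ^ 4 = x) : x ^ (5 / 4 : ℝ) = y ^ 5 := by
  rw [← hxy, ← Real.rpow_natCast y 4, ← Real.rpow_mul hy, ← Real.rpow_natCast y 5]
  norm_num

theorem le_sq_add_inv {t : ℝ} (ht : 0 < t) :
    1 ≤ t ^ 2 + t⁻¹ ∧ t ≤ t ^ 2 + t⁻¹ ∧ t⁻¹ ≤ t ^ 2 + t⁻¹ := by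
  have hti : 0 < t⁻¹ := inv_pos.2 ht
  have h2 : 0 < t ^ 2 := by positivity
  rcases le_total t 1 with h | h
  · have : 1 ≤ t⁻¹ := (one_le_inv₀ ht).2 h
    exact ⟨by linarith, by linarith, by linarith⟩
  · have : t ≤ t ^ 2 := by rw [sq]; exact le_mul_of_one_le_left ht.le h
    exact ⟨by linarith, by linarith, by linarith⟩

/-- For b = √α, s = √(1 - α) and η = √(yε) this puts the prefactor of `norm_bhat_le_of_large` into
the form that `exists_melnikovSup_le` requires. In the variable t = ηw every term is a multiple of
1, t or 1/t, each at most t² + 1/t. -/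
theorem one_add_inv_mul_le {α b s η w : ℝ} (h0 : 0 < α) (h1 : α < 1) (hb0 : 0 < b) (hb1 : b ≤ 1)
    (hs0 : 0 < s) (hη0 : 0 < η) (hηs : η ≤ s) (hη_le : η ≤ 2) (hw : 0 < w) :
    (1 + w⁻¹) * (w / b + α / s) ≤ 6 * ((η * w) ^ 2 + (η * w)⁻¹) / (η * b) := by
  obtain ⟨w2, w1, w3⟩ := le_sq_add_inv (mul_pos hη0 hw)
  have e2 : (1 + w⁻¹) * (w / b + α / s) =
      (η * w + η + b * α * (η / s) + b * α * (η / s) * η * (η * w)⁻¹) / (η * b) := by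
    field_simp
    ring
  rw [e2]
  refine div_le_div_of_nonneg_right ?_ (by positivity)
  have f1 : η / s ≤ 1 := (div_le_one hs0).2 hηs
  have f0 : 0 ≤ η / s := by positivity
  have f2 : b * α * (η / s) ≤ 1 := mul_le_one₀ (mul_le_one₀ hb1 h0.le h1.le) f0 f1
  have f3 : b * α * (η / s) * η ≤ 1 * 2 := mul_le_mul f2 hη_le hη0.le one_pos.le
  have hti : 0 ≤ (η * w)⁻¹ := by positivity
  have f4 := mul_le_mul_of_nonneg_right f3 hti
  linarith

/-- In the lower bound this lets the second part of the residues take away at most half of the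
first. -/
theorem two_mul_div_le {α b s κ w : ℝ} (h1 : α < 1) (hb0 : 0 < b) (hb1 : b ≤ 1)
    (hs0 : 0 < s) (h : 8 ≤ κ * (w * s)) : 2 * α / s ≤ κ * w / (4 * b) := by
  rw [div_le_div_iff₀ hs0 (by positivity)]
  have : α * b ≤ 1 := mul_le_one₀ h1.le hb0.le hb1
  linarith

set_option maxHeartbeats 1000000 in
/-- Upper bound away from `α = 0`. -/
theorem exists_upper_of_large (hr₁ : 0 < r₁) (hr₂ : 0 < r₂) (hF : HasFourierExpansion F Fhat)
    (hmean : Fhat (0, 0) = 0) (hupper : FourierUpper r₁ r₂ Fhat) {u₀ : ℝ} (hu₀ : 0 < u₀)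
    {r K : ℝ} (hr : r < 2) (hK : 0 < K) :
    ∃ ε₀ C₂ : ℝ, 0 < ε₀ ∧ 0 < C₂ ∧ ∀ ε α : ℝ, 0 < ε → ε < ε₀ → 0 < α → α < 1 →
      α < 1 - K * ε ^ r → ∀ ρ : ℂ, IsRhoMinus α ρ →
      melnikovSup F ε α u₀ ≤
        C₂ / (Real.sqrt (ε * α) * (1 - α) ^ (5 / 4 : ℝ)) *
          Real.exp (-(c r₁ r₂ (Real.log (ε / ρ.im)) * Real.sqrt (ρ.im / ε))) := by
  obtain ⟨C, X₀, hC, hX₀, hsup⟩ := exists_melnikovSup_le hr₁ hr₂ hF hmean hupper hu₀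
  have hX₀pos : 0 < X₀ := by linarith
  obtain ⟨ε₀, hε₀, hev⟩ := exists_pos_of_eventually
    ((eventually_le_nhdsGT_zero one_pos).and
      ((eventually_le_mul_sqrt hr hK (by positivity : 0 < (X₀ ^ 2)⁻¹)).and
        (eventually_le_mul_sqrt hr hK (by norm_num : (0 : ℝ) < 1 / 2))))
  refine ⟨ε₀, C * (24 * 6), hε₀, by positivity, ?_⟩
  intro ε α hε hε' h0 h1 hα ρ hρ
  obtain ⟨⟨-, hε1⟩, hε2, hε3⟩ := hev ε hε hε'
  replace hε2 := hε2 α hα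
  replace hε3 := hε3 α hα
  obtain ⟨hy1, hy2⟩ := im_rhoMinus_bounds h0 h1 hρ
  have h1' : 0 < 1 - α := by linarith
  set s := Real.sqrt (1 - α) with hs
  have hs0 : 0 < s := Real.sqrt_pos.2 h1'
  have hs1 : s ≤ 1 := Real.sqrt_le_one.2 (by linarith)
  have hs2 : s ^ 2 = 1 - α := Real.sq_sqrt h1'.le
  -- The fourth root q of 1 - α removes the fractional power: (1 - α)^{5/4} = q⁵. Four factors q
  -- come from 1/(1 - α), the fifth from η ≥ √ε q.
  set q := Real.sqrt s with hq
  have hq0 : 0 < q := Real.sqrt_pos.2 hs0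
  have hq2 : q ^ 2 = s := Real.sq_sqrt hs0.le
  have hq4 : q ^ 4 = 1 - α := by rw [← hs2, ← hq2]; ring
  set b := Real.sqrt α with hb
  have hb0 : 0 < b := Real.sqrt_pos.2 h0
  have hb2 : b ^ 2 = α := Real.sq_sqrt h0.le
  have hb1 : b ≤ 1 := Real.sqrt_le_one.2 h1.le
  set e := Real.sqrt ε with he
  have he0 : 0 < e := Real.sqrt_pos.2 hε
  have he2 : e ^ 2 = ε := Real.sq_sqrt hε.le
  have hsqrt : Real.sqrt (ε * α) = e * b := Real.sqrt_mul hε.le α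
  rw [rpow_five_quarters hq0.le hq4, hsqrt]
  have hy0 := hρ.2.1
  set y := ρ.im with hy
  set η := Real.sqrt (y * ε) with hη
  have hη0 : 0 < η := Real.sqrt_pos.2 (by positivity)
  have hη2 : η ^ 2 = y * ε := Real.sq_sqrt (by positivity)
  have hηq : e * q ≤ η := by
    refine le_of_sq_le_sq ?_ hη0.le
    rw [mul_pow, he2, hq2, hη2, mul_comm]
    gcongr
  have hη_le : η ≤ 2 := by
    refine le_of_sq_le_sq ?_ (by norm_num)
    rw [hη2]; nlinarith
  have hηs : η ≤ s := by
    refine le_of_sq_le_sq ?_ hs0.le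
    rw [hη2]; nlinarith
  have hX : X₀ ≤ Real.sqrt (y / ε) := by
    refine le_sqrt_div_of_le hX₀pos hε ?_
    rw [← div_eq_inv_mul, le_div_iff₀ (by positivity)] at hε2
    linarith
  have hbound : ∀ w, 0 < w → ‖bhat α w‖ ≤ 24 * 6 / (e * b * q ^ 5) *
      ((η * w) ^ 2 + (η * w)⁻¹) * Real.exp (-(w * y)) := by
    intro w hw
    refine (norm_bhat_le_of_large h0 h1 hw hρ).trans ?_
    rw [← mul_assoc]
    refine mul_le_mul_of_nonneg_right ?_ (Real.exp_pos _).le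
    have hprod := one_add_inv_mul_le h0 h1 hb0 hb1 hs0 hη0 hηs hη_le hw
    set W := (η * w) ^ 2 + (η * w)⁻¹ with hW
    have hW0 : 0 < W := by positivity
    have hpi := Real.pi_lt_four
    have hpi0 := Real.pi_pos
    calc (1 + w⁻¹) * (Real.pi / (1 - α) * (w / b + α / s))
        = Real.pi / q ^ 4 * ((1 + w⁻¹) * (w / b + α / s)) := by rw [hq4]; ring
      _ ≤ 4 / q ^ 4 * (6 * W / (η * b)) := by gcongr
      _ ≤ 4 / q ^ 4 * (6 * W / (e * q * b)) := by gcongr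
      _ = 24 / (e * b * q ^ 5) * W := by field_simp; ring
      _ ≤ 24 * 6 / (e * b * q ^ 5) * W := by gcongr; norm_num
  have h := hsup ε α y (24 * 6 / (e * b * q ^ 5)) hε h0.le h1 hy0 (by positivity) hX hbound
  rwa [← mul_div_assoc] at h

set_option maxHeartbeats 1000000 in
/-- Lower bound away from `α = 0`. -/
theorem exists_lower_of_large (hr₁ : 0 < r₁) (hr₂ : 0 < r₂) (hF : HasFourierExpansion F Fhat)
    (hupper : FourierUpper r₁ r₂ Fhat) (hlower : FourierLower r₁ r₂ Fhat)
    {u₀ : ℝ} (hu₀ : 0 < u₀) {ν r K : ℝ} (hν : ν ≤ 1) (hr : r < 2) (hK : 0 < K) :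
    ∃ ε₀ C₁ : ℝ, 0 < ε₀ ∧ 0 < C₁ ∧ ∀ ε α : ℝ, 0 < ε → ε < ε₀ → 0 < α → α < 1 →
      K * ε ^ ν < α → α < 1 - K * ε ^ r → ∀ ρ : ℂ, IsRhoMinus α ρ →
      C₁ / (Real.sqrt (ε * α) * (1 - α) ^ (5 / 4 : ℝ)) *
          Real.exp (-(c r₁ r₂ (Real.log (ε / ρ.im)) * Real.sqrt (ρ.im / ε))) ≤
        melnikovSup F ε α u₀ := by
  obtain ⟨C, X₀, hC, hinf⟩ := exists_le_melnikovSup hr₁ hr₂ hF hupper hlower hu₀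
  have hL := decayRate_pos hr₁ hr₂
  have hγ := γ_pos
  have hLγ : 0 < decayRate r₁ r₂ / γ := by positivity
  set G := decayRate r₁ r₂ / γ with hG
  -- A lower bound for 1 - e^{-2w√α}: at the minimiser w²ε ≥ G/2, and α ≥ Kε because ν ≤ 1, so w√α ≥
  -- √(GK/2).
  set κ := 1 - Real.exp (-(2 * Real.sqrt (G * K / 2))) with hκ
  have hκ0 : 0 < κ := by
    have : 0 < Real.sqrt (G * K / 2) := Real.sqrt_pos.2 (by positivity)
    rw [hκ, sub_pos, Real.exp_lt_one_iff]
    linarith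
  have hX₁ : 0 < max X₀ 1 := by positivity
  set lam := Real.sqrt (G / 2) with hlam
  have hlam0 : 0 < lam := Real.sqrt_pos.2 (by positivity)
  obtain ⟨ε₀, hε₀, hev⟩ := exists_pos_of_eventually
    ((eventually_le_nhdsGT_zero one_pos).and
      ((eventually_le_mul_sqrt hr hK (by positivity : 0 < ((max X₀ 1) ^ 2)⁻¹)).and
        (eventually_le_mul_sqrt hr hK (by positivity : (0 : ℝ) < G * κ ^ 2 / 128))))
  refine ⟨ε₀, C * (κ * lam / 16), hε₀, by positivity, ?_⟩
  intro ε α hε hε' h0 h1 hαl hα ρ hρ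
  obtain ⟨⟨-, hε1⟩, hε2, hε3⟩ := hev ε hε hε'
  replace hε2 := hε2 α hα
  replace hε3 := hε3 α hα
  obtain ⟨hy1, hy2⟩ := im_rhoMinus_bounds h0 h1 hρ
  have h1' : 0 < 1 - α := by linarith
  set s := Real.sqrt (1 - α) with hs
  have hs0 : 0 < s := Real.sqrt_pos.2 h1'
  have hs1 : s ≤ 1 := Real.sqrt_le_one.2 (by linarith)
  have hs2 : s ^ 2 = 1 - α := Real.sq_sqrt h1'.le
  set q := Real.sqrt s with hq
  have hq0 : 0 < q := Real.sqrt_pos.2 hs0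
  have hq2 : q ^ 2 = s := Real.sq_sqrt hs0.le
  have hq4 : q ^ 4 = 1 - α := by rw [← hs2, ← hq2]; ring
  set b := Real.sqrt α with hb
  have hb0 : 0 < b := Real.sqrt_pos.2 h0
  have hb2 : b ^ 2 = α := Real.sq_sqrt h0.le
  have hb1 : b ≤ 1 := Real.sqrt_le_one.2 h1.le
  set e := Real.sqrt ε with he
  have he0 : 0 < e := Real.sqrt_pos.2 hε
  have he2 : e ^ 2 = ε := Real.sq_sqrt hε.le
  have hsqrt : Real.sqrt (ε * α) = e * b := Real.sqrt_mul hε.le α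
  rw [rpow_five_quarters hq0.le hq4, hsqrt]
  have hy0 := hρ.2.1
  have hX : X₀ ≤ Real.sqrt (ρ.im / ε) := by
    refine (le_max_left X₀ 1).trans (le_sqrt_div_of_le hX₁ hε ?_)
    rw [← div_eq_inv_mul, le_div_iff₀ (by positivity)] at hε2
    linarith
  obtain ⟨w, hw, hw1, -, hle⟩ := hinf ε α ρ.im hε h0.le h1 hy0 hX
  refine le_trans ?_ hle
  have hwe : G / 2 ≤ s * ε * w ^ 2 := by
    have : ρ.im * ε * w ^ 2 ≤ 2 * s * ε * w ^ 2 := by gcongr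
    linarith
  have hwl : lam ≤ w * e * q := by
    rw [hlam, Real.sqrt_le_left (by positivity), mul_pow, mul_pow, he2, hq2]
    linarith
  have hwb : Real.sqrt (G * K / 2) ≤ w * b := by
    rw [Real.sqrt_le_left (by positivity), mul_pow, hb2]
    have h3 : K * ε ≤ α := by
      refine le_trans ?_ hαl.le
      refine mul_le_mul_of_nonneg_left ?_ hK.le
      have := Real.rpow_le_rpow_of_exponent_ge hε hε1 hν
      rwa [Real.rpow_one] at this
    have h4 : G / 2 ≤ ε * w ^ 2 := by
      refine hwe.trans ?_
      rw [mul_assoc]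
      exact mul_le_of_le_one_left (by positivity) hs1
    calc G * K / 2 = (G / 2) * K := by ring
      _ ≤ (ε * w ^ 2) * K := by gcongr
      _ = w ^ 2 * (K * ε) := by ring
      _ ≤ _ := by gcongr
  have hκw : κ ≤ 1 - Real.exp (-(2 * w * b)) := by
    rw [hκ]
    have : Real.exp (-(2 * w * b)) ≤ Real.exp (-(2 * Real.sqrt (G * K / 2))) := by
      rw [Real.exp_le_exp]; linarith
    linarith
  have h2α : Real.sqrt (2 * α) ≤ 2 * b := by
    rw [Real.sqrt_le_left (by positivity), mul_pow, hb2]; linarith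
  have h2α0 : 0 < Real.sqrt (2 * α) := Real.sqrt_pos.2 (by linarith)
  -- The threshold Gκ²/128 was chosen for this: 64ε ≤ κ² s G/2 ≤ (κws)² ε.
  have hκw2 : 8 ≤ κ * (w * s) := by
    refine le_of_sq_le_sq ?_ (by positivity)
    have h5 : (κ * (w * s)) ^ 2 * ε = κ ^ 2 * s * (s * ε * w ^ 2) := by ring
    have h6 : κ ^ 2 * s * (G / 2) ≤ (κ * (w * s)) ^ 2 * ε := by
      rw [h5]
      exact mul_le_mul_of_nonneg_left hwe (by positivity)
    have h7 : 8 ^ 2 * ε ≤ (κ * (w * s)) ^ 2 * ε := by linarith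
    exact le_of_mul_le_mul_right h7 hε
  have hsecond : 2 * α / s ≤ κ * w / (4 * b) := two_mul_div_le h1 hb0 hb1 hs0 hκw2
  have hfirst : κ * w / (2 * b) ≤ w / Real.sqrt (2 * α) * (1 - Real.exp (-(2 * w * b))) := by
    calc κ * w / (2 * b) = w / (2 * b) * κ := by ring
      _ ≤ _ := by gcongr
  have hhalf : κ * w / (2 * b) = κ * w / (4 * b) + κ * w / (4 * b) := by field_simp; norm_num
  have h4b : 0 < κ * w / (4 * b) := by positivity
  have hB := norm_bhat_ge_of_large h0 h1 hw hρ (by linarith)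
  have hmain : (4 * (1 - α))⁻¹ * (κ * w / (4 * b)) ≤ Real.exp (w * ρ.im) * ‖bhat α w‖ := by
    have h8 := mul_le_mul_of_nonneg_left hB (Real.exp_pos (w * ρ.im)).le
    have h9 : (4 * (1 - α))⁻¹ * (κ * w / (4 * b)) ≤ (4 * (1 - α))⁻¹ *
        (w / Real.sqrt (2 * α) * (1 - Real.exp (-(2 * w * b))) - 2 * α / s) := by
      refine mul_le_mul_of_nonneg_left (by linarith) (by positivity)
    refine h9.trans (le_trans (le_of_eq ?_) h8)
    rw [mul_comm (Real.exp _), mul_assoc _ (Real.exp _), ← Real.exp_add, neg_add_cancel,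
      Real.exp_zero, mul_one]
  have hfin : κ * lam / 16 / (e * b * q ^ 5) ≤ Real.exp (w * ρ.im) * ‖bhat α w‖ := by
    refine le_trans ?_ hmain
    rw [← hq4]
    calc κ * lam / 16 / (e * b * q ^ 5) ≤ κ * (w * e * q) / 16 / (e * b * q ^ 5) := by gcongr
      _ = _ := by field_simp; norm_num
  calc _ = C * Real.exp (-(c r₁ r₂ (Real.log (ε / ρ.im)) * Real.sqrt (ρ.im / ε))) *
        (κ * lam / 16 / (e * b * q ^ 5)) := by ring
    _ ≤ _ := mul_le_mul_of_nonneg_left hfin (by positivity)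

end
end MelnikovQP

/-! ### Assembly of the cases. -/

theorem proposition3p1
    (F : ℝ → ℝ → ℝ) (Fhat : ℤ × ℤ → ℂ) (r₁ r₂ : ℝ) (hr₁ : 0 < r₁) (hr₂ : 0 < r₂)
    (hF : MelnikovQP.HasFourierExpansion F Fhat)
    (hmean : Fhat (0, 0) = 0)
    (hupper : MelnikovQP.FourierUpper r₁ r₂ Fhat)
    (hlower : MelnikovQP.FourierLower r₁ r₂ Fhat)
    (u₀ : ℝ) (hu₀ : 0 < u₀) :
    -- the Melnikov integral converges absolutely
    (∀ ε α u θ₁ θ₂ : ℝ, 0 < ε → 0 ≤ α → α < 1 →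
      MeasureTheory.Integrable (MelnikovQP.melnikovIntegrand F ε α u θ₁ θ₂)) ∧
    -- wide strip
    (∀ ν C : ℝ, 1 < ν → 0 < C →
      ∃ ε₀ C₁ C₂ : ℝ, 0 < ε₀ ∧ 0 < C₁ ∧ 0 < C₂ ∧
        ∀ ε α : ℝ, 0 < ε → ε < ε₀ → 0 ≤ α → α < 1 → α ≤ C * ε ^ ν →
          BddAbove (MelnikovQP.melnikovValues F ε α u₀) ∧
          C₁ / ε * Real.exp (-(MelnikovQP.c r₁ r₂ (Real.log (2 * ε / Real.pi)) *
              Real.sqrt (Real.pi / (2 * ε)))) ≤ MelnikovQP.melnikovSup F ε α u₀ ∧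
          MelnikovQP.melnikovSup F ε α u₀ ≤
            C₂ / ε * Real.exp (-(MelnikovQP.c r₁ r₂ (Real.log (2 * ε / Real.pi)) *
              Real.sqrt (Real.pi / (2 * ε))))) ∧
    -- intermediate case
    (∀ αs K : ℝ, 0 ≤ αs → 0 ≤ K →
      ∃ ε₀ C₂ : ℝ, 0 < ε₀ ∧ 0 < C₂ ∧
        ∀ ε α : ℝ, 0 < ε → ε < ε₀ → 0 ≤ α → α < 1 → |α - αs * ε| ≤ K * ε ^ 2 →
          BddAbove (MelnikovQP.melnikovValues F ε α u₀) ∧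
          MelnikovQP.melnikovSup F ε α u₀ ≤
            C₂ / ε * Real.exp (-(MelnikovQP.c r₁ r₂ (Real.log (2 * ε / Real.pi)) *
              Real.sqrt (Real.pi / (2 * ε))))) ∧
    -- narrow strip
    (∀ ν r C : ℝ, 0 < ν → ν ≤ 1 → 0 ≤ r → r < 2 → 0 < C →
      ∃ ε₀ C₁ C₂ : ℝ, 0 < ε₀ ∧ 0 < C₁ ∧ 0 < C₂ ∧
        ∀ ε α : ℝ, 0 < ε → ε < ε₀ → 0 ≤ α → α < 1 → C * ε ^ ν < α → α < 1 - C * ε ^ r →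
          ∀ ρ : ℂ, MelnikovQP.IsRhoMinus α ρ →
            BddAbove (MelnikovQP.melnikovValues F ε α u₀) ∧
            C₁ / (Real.sqrt (ε * α) * (1 - α) ^ (5 / 4 : ℝ)) *
                Real.exp (-(MelnikovQP.c r₁ r₂ (Real.log (ε / ρ.im)) *
                  Real.sqrt (ρ.im / ε))) ≤ MelnikovQP.melnikovSup F ε α u₀ ∧
            MelnikovQP.melnikovSup F ε α u₀ ≤
              C₂ / (Real.sqrt (ε * α) * (1 - α) ^ (5 / 4 : ℝ)) *
                Real.exp (-(MelnikovQP.c r₁ r₂ (Real.log (ε / ρ.im)) *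
                  Real.sqrt (ρ.im / ε)))) := by
  have hs := hupper.summable hr₁ hr₂
  refine ⟨fun ε α u θ₁ θ₂ _ h0 h1 =>
      MelnikovQP.integrable_melnikovIntegrand hs hF h0 h1 u θ₁ θ₂, ?_, ?_, ?_⟩
  · intro ν C hν hC
    obtain ⟨ε₁, C₁, hε₁, hC₁, hl⟩ := MelnikovQP.exists_lower_of_small hr₁ hr₂ hF hupper hlower hu₀
      (K := C) hν
    obtain ⟨ε₂, C₂, hε₂, hC₂, hu⟩ := MelnikovQP.exists_upper_of_small hr₁ hr₂ hF hmean hupper hu₀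
      hC.le
    -- The bound 1 on ε gives ε^ν ≤ ε, so that the upper bound for α = O(ε) applies.
    refine ⟨min (min ε₁ ε₂) 1, C₁, C₂, by positivity, hC₁, hC₂, ?_⟩
    intro ε α hε hε' h0 h1 hα
    obtain ⟨⟨hl1, hu1⟩, hone⟩ := by simpa only [lt_min_iff] using hε'
    refine ⟨MelnikovQP.bddAbove_melnikovValues hs hF h0 h1 u₀, hl ε α hε hl1 h0 h1 hα,
      hu ε α hε hu1 h0 (hα.trans (mul_le_mul_of_nonneg_left ?_ hC.le))⟩
    simpa using Real.rpow_le_rpow_of_exponent_ge hε hone.le hν.le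
  · intro αs K hαs hK
    -- For ε < 1 the hypothesis gives α ≤ (αs + K) ε, so this is again the case α = O(ε).
    obtain ⟨ε₂, C₂, hε₂, hC₂, hu⟩ := MelnikovQP.exists_upper_of_small hr₁ hr₂ hF hmean hupper hu₀
      (add_nonneg hαs hK)
    refine ⟨min ε₂ 1, C₂, by positivity, hC₂, ?_⟩
    intro ε α hε hε' h0 h1 hα
    obtain ⟨hu1, hone⟩ := lt_min_iff.1 hε'
    refine ⟨MelnikovQP.bddAbove_melnikovValues hs hF h0 h1 u₀, hu ε α hε hu1 h0 ?_⟩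
    have hsq : K * ε ^ 2 ≤ K * ε :=
      mul_le_mul_of_nonneg_left (by rw [sq]; exact mul_le_of_le_one_left hε.le hone.le) hK
    linarith [(abs_le.1 hα).2]
  · intro ν r C _ hν _ hr hC
    obtain ⟨ε₁, C₁, hε₁, hC₁, hl⟩ := MelnikovQP.exists_lower_of_large hr₁ hr₂ hF hupper hlower hu₀
      hν hr hC
    obtain ⟨ε₂, C₂, hε₂, hC₂, hu⟩ := MelnikovQP.exists_upper_of_large hr₁ hr₂ hF hmean hupper hu₀
      hr hC
    refine ⟨min ε₁ ε₂, C₁, C₂, by positivity, hC₁, hC₂, ?_⟩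
    intro ε α hε hε' h0 h1 hαl hαu ρ hρ
    obtain ⟨hl1, hu1⟩ := lt_min_iff.1 hε'
    have hα : 0 < α := lt_of_le_of_lt (by positivity) hαl
    exact ⟨MelnikovQP.bddAbove_melnikovValues hs hF h0 h1 u₀,
      hl ε α hε hl1 hα h1 hαl hαu ρ hρ, hu ε α hε hu1 hα h1 hαu ρ hρ⟩
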